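/- Let $n\ge 2$ be an integer, $\kappa>0$, $\varepsilon\in(0,1)$, and let $h:(0,\infty)\to[0,\infty)$ be a $C^2$ function with $h''(d)>0$ for all $d>0$, $$\lim_{d\to0^+}h(d)=\infty,\quad \lim_{d\to\infty}\frac{h(d)}{d}=\infty,\quad \lim_{d\to0^+}h'(d)=-\infty,\quad \lim_{d\to\infty}h'(d)=\infty.$$ For $v_1,\dots,v_n>0$ let $$\hat\Phi(v_1,\dots,v_n)=\frac{\kappa}{n}v_1^n+h(v_1\cdots v_n)+\kappa\,v_1\cdots v_n\Big(\frac{n-1}{n}+\ln(v_2\cdots v_n)\Big),$$ let $\hat\Phi_{,i}$ be its partial derivative with respect to $v_i$, and for a function $r$ write $\hat\Phi_{,i}(r(R))=\hat\Phi_{,i}\big(r'(R),\tfrac{r(R)}{R},\dots,\tfrac{r(R)}{R}\big)$ and $\hat T(r(R))=\big(\tfrac{r(R)}{R}\big)^{1-n}\hat\Phi_{,1}(r(R))$. For $\lambda>0$ let $$\mathcal A_\lambda^\varepsilon=\{r\in W^{1,1}(\varepsilon,1): r(1)=\lambda,\ r'(R)>0\text{ for a.e. }R\in(\varepsilon,1),\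 r(\varepsilon)\ge0\}$$ (functions in $W^{1,1}(\varepsilon,1)$ being identified with their continuous representatives on $[\varepsilon,1]$), and for $r\in\mathcal A_\lambda^\varepsilon$ let $$\hat I_\varepsilon(r)=\int_\varepsilon^1R^{n-1}\hat\Phi\Big(r'(R),\frac{r(R)}{R},\dots,\frac{r(R)}{R}\Big)dR-\frac{\kappa(n-1)}{n}\lambda^n\ln\lambda\in(-\infty,\infty].$$ Assume that $\bar\lambda=1$ is the unique solution $\bar\lambda>0$ of $\hat\Phi_{,1}(\bar\lambda,\dots,\bar\lambda)=0$. Then, for every $\lambda>0$, the functional $\hat I_\varepsilon$ has a unique global minimizer over $\mathcal A_\lambda^\varepsilon$. Moreover, there exists $\delta(\varepsilon)>0$ (independent of $\lambda$) such that, whenever $\lambda>0$, $\lambda\in(1-\delta(\varepsilon),\infty)$ and $r_\varepsilon$ is a global minimizer of $\hat I_\varepsilon$ over $\mathcal A_\lambda^\varepsilon$, one has $r_\varepsilon\in C^2([\varepsilon,1])$, $$\frac{d}{dR}\Big[R^{n-1}\hat\Phi_{,1}(r_\varepsilon(R))\Big]=(n-1)R^{n-2}\hat\Phi_{,2}(r_\varepsilon(R)),\qquad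 R\in(\varepsilon,1),$$ and 1. $r_\varepsilon'(R)>0$ for all $R\in[\varepsilon,1]$ (one-sided derivatives at the end points), 2. $r_\varepsilon(\varepsilon)>0$, 3. $\hat T(r_\varepsilon(\varepsilon))=0$. -/

import Mathlib

open MeasureTheory Set Filter Topology
open scoped ContDiff

noncomputable section

namespace PuncturedBall

/-! ### The Sobolev space `W^{1,1}(a,b)` -/

/-- `g ∈ L¹(a,b)` is the weak (distributional) derivative of `r` on `(a,b)`. -/
def IsWeakDeriv (a b : ℝ) (r g : ℝ → ℝ) : Prop :=
  IntegrableOn g (Ioo a b) ∧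
    ∀ φ : ℝ → ℝ, ContDiff ℝ ∞ φ → HasCompactSupport φ → tsupport φ ⊆ Ioo a b →
      ∫ R in Ioo a b, r R * deriv φ R = - ∫ R in Ioo a b, g R * φ R

/-- `r ∈ W^{1,1}(a,b)`. -/
def MemW11 (a b : ℝ) (r : ℝ → ℝ) : Prop :=
  IntegrableOn r (Ioo a b) ∧ ∃ g : ℝ → ℝ, IsWeakDeriv a b r g

/-- The weak derivative of `r ∈ W^{1,1}(a,b)`, which is determined up to a null set. -/
def weakDeriv (a b : ℝ) (r : ℝ → ℝ) : ℝ → ℝ :=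
  Classical.epsilon (IsWeakDeriv a b r)

/-- The admissible set `A_lam^ε`. Elements of `W^{1,1}(ε,1)` are represented by functions that are
continuous on `[ε,1]`, so that the boundary values are plain values. -/
def admissible (ε lam : ℝ) : Set (ℝ → ℝ) :=
  {r | MemW11 ε 1 r ∧ ContinuousOn r (Icc ε 1) ∧ r 1 = lam ∧
    (∀ᵐ R ∂(volume.restrict (Ioo ε 1)), 0 < weakDeriv ε 1 r R) ∧ 0 ≤ r ε}

/-! ### The modified stored energy function -/

/-- The modified stored energy
`Φ̂(v₁,…,vₙ) = (κ/n) v₁ⁿ + h(v₁⋯vₙ) + κ v₁⋯vₙ ((n-1)/n + ln(v₂⋯vₙ))`;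
the argument `v₁` has index `0`, the argument `v₂` has index `1`. -/
def modPhi (n : ℕ) [n.AtLeastTwo] (κ : ℝ) (h : ℝ → ℝ) (v : Fin n → ℝ) : ℝ :=
  κ / n * v 0 ^ n + h (∏ i, v i)
    + κ * (∏ i, v i) * (((n : ℝ) - 1) / n + Real.log (∏ i ∈ Finset.univ.erase (0 : Fin n), v i))

/-- The partial derivative of `F` with respect to its `i`-th argument, at `v`. -/
def partialDeriv {n : ℕ} (F : (Fin n → ℝ) → ℝ) (i : Fin n) (v : Fin n → ℝ) : ℝ :=
  deriv (fun t => F (Function.update v i t)) (v i)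

/-- The argument `(q, v, …, v)`. -/
def stretches (n : ℕ) [n.AtLeastTwo] (q v : ℝ) : Fin n → ℝ :=
  Function.update (fun _ => v) 0 q

/-- The integral of an extended-integrable real function, with values in `[-∞,∞]`: integral of the
positive part minus integral of the negative part. -/
def extIntegral (μ : Measure ℝ) (f : ℝ → ℝ) : EReal :=
  ((∫⁻ x, ENNReal.ofReal (f x) ∂μ : ENNReal) : EReal)
    - ((∫⁻ x, ENNReal.ofReal (-f x) ∂μ : ENNReal) : EReal)

/-- The modified energy `Î_ε` on the punctured ball, with values in `[-∞,∞]`. -/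
def modEnergy (n : ℕ) [n.AtLeastTwo] (κ : ℝ) (h : ℝ → ℝ) (ε lam : ℝ) (r : ℝ → ℝ) : EReal :=
  extIntegral (volume.restrict (Ioo ε 1))
      (fun R => R ^ (n - 1) * modPhi n κ h (stretches n (weakDeriv ε 1 r R) (r R / R)))
    - ((κ * ((n : ℝ) - 1) / n * lam ^ n * Real.log lam : ℝ) : EReal)

/-- `r` is a global minimizer of `Î_ε` over `A_lam^ε`. -/
def IsGlobalMinimizer (n : ℕ) [n.AtLeastTwo] (κ : ℝ) (h : ℝ → ℝ) (ε lam : ℝ)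
    (r : ℝ → ℝ) : Prop :=
  r ∈ admissible ε lam ∧ IsMinOn (modEnergy n κ h ε lam) (admissible ε lam) r

/-! ### The Euler-Lagrange equation and the modified Cauchy stress -/

/-- `Φ̂_{,i}(r(R)) = Φ̂_{,i}(r'(R), r(R)/R, …, r(R)/R)` for a differentiable `r` on `[ε,1]`, with
the one-sided derivative at the end points. -/
def modPhiAlong (n : ℕ) [n.AtLeastTwo] (κ : ℝ) (h : ℝ → ℝ) (ε : ℝ) (r : ℝ → ℝ) (i : Fin n)
    (R : ℝ) : ℝ :=
  partialDeriv (modPhi n κ h) i (stretches n (derivWithin r (Icc ε 1) R) (r R / R))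

/-- `r` solves `d/dR [R^{n-1} Φ̂_{,1}(r(R))] = (n-1) R^{n-2} Φ̂_{,2}(r(R))` on `(ε,1)`. -/
def SolvesModEL (n : ℕ) [n.AtLeastTwo] (κ : ℝ) (h : ℝ → ℝ) (ε : ℝ) (r : ℝ → ℝ) : Prop :=
  ∀ R ∈ Ioo ε 1,
    HasDerivAt (fun S => S ^ (n - 1) * modPhiAlong n κ h ε r 0 S)
      (((n : ℝ) - 1) * R ^ (n - 2) * modPhiAlong n κ h ε r 1 R) R

/-- The modified radial Cauchy stress `T̂(r(R)) = (r(R)/R)^{1-n} Φ̂_{,1}(r(R))`. -/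
def modStress (n : ℕ) [n.AtLeastTwo] (κ : ℝ) (h : ℝ → ℝ) (ε : ℝ) (r : ℝ → ℝ) (R : ℝ) : ℝ :=
  (r R / R) ^ (1 - (n : ℤ)) * modPhiAlong n κ h ε r 0 R

end PuncturedBall

end

/-!
Minimisers of the modified energy on the punctured ball are studied in the volume coordinate
`u(R) = r(R)^n` and the Jacobian determinant `d = r' (r/R)^{n-1}`, which are linked by
`u' = n R^{n-1} d` and `u(1) = lam^n`. The logarithmic term of the stored energy is, up to the exact
derivative of `r^n log (r/R)`, a function of `(u, d)`, and `modEnergy_eq` rewrites the modified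
energy as `∫ dens(R, u, d) dR - bdry(u(ε))`. The density is jointly convex in `(u, d)`
(`dens_convex`), because it is `h(d)` plus a perspective of the `n`-th power; the boundary term is
a convex function that is subtracted, so the problem is convex only at fixed cavity volume `u(ε)`.

*Existence.* Superlinearity of `h` and its blow-up at `0` turn strict convexity into a quantitative
midpoint inequality (`integral_abs_sub_le`), so minimising sequences are Cauchy in `L¹`
(`exists_isRedMin`).

*Regularity.* A minimiser with `u(ε) > 0` is stationary under bounded variations of `d` supported
where `d` is bounded and bounded away from `0`. This gives the Euler-Lagrange equation in integrated
form, with the natural boundary condition as constant of integration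
(`IsCritical.eulerLagrange`). Written in the ratios `v = r/R` and `p = R r'/r`, it determines `p`
through the implicit function theorem, so that `r` is `C²` and the stress vanishes at `R = ε`
(`IsCritical.isRadialSolution`).

*Uniqueness.* At fixed cavity volume a minimiser is unique by strict convexity
(`ae_eq_of_isRedMin`). If two minimisers had different cavity volumes, the minimal energy as a
function of the cavity volume would have a maximum in between, and the competitor realising it
would be critical, like the minimiser with the larger cavity (`IsRedMin.not_vol_lt`). But solutions
that are stress-free at `R = ε` are determined by their boundary displacement
(`IsCritical.vol_eq`): the equation is invariant under `R ↦ c R`, and, by monotonicity of the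
Euler-Lagrange operator in `u`, solutions that start from the same `v` with different slopes do not
meet again. Shifting one of two solutions along the other contradicts equal boundary values, since
the sign of the stress is known.

*Open cavity.* For a deformation with `u(ε) = 0`, linearising `h` at `1` and keeping a quadratic
remainder of the `n`-th power leaves a quadratic form in `(u, u')`, which is bounded below by an
exact derivative `(k u)'`, where `k` solves a Riccati equation (`riccati_le`,
`setIntegral_dens_ge`). The bound exceeds the energy of the undeformed state. If `lam ≥ 1`, there is
a radius `b` with `u(b) = b^n`, and replacing the deformation by the undeformed one up to `b` lowers
the energy (`IsRedMin.vol_pos_of_one_le`). If `lam` is close to `1`, the homogeneous deformation has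
lower energy, by continuity in `lam` of both sides (`eventually_vol_pos`). Hence the admissible
compression `δ` depends on `ε`, but not on `lam`.
-/

namespace PuncturedBall

/-! ### Absolutely continuous functions -/

/-- `f` is a primitive of the integrable function `g` on `[a,b]`, normalised at the right end
point. Equivalently, `f` is absolutely continuous on `[a,b]` with derivative `g` almost
everywhere. -/
structure IsPrim (a b : ℝ) (f g : ℝ → ℝ) : Prop where
  integrableOn : IntegrableOn g (Ioo a b)
  eq_sub : ∀ x ∈ Icc a b, f x = f b - ∫ t in x..b, g t

section Primitive

variable {a b : ℝ} {f g : ℝ → ℝ}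

theorem IsPrim.intervalIntegrable (hf : IsPrim a b f g) {x y : ℝ} (hab : a ≤ b)
    (hx : x ∈ Icc a b) (hy : y ∈ Icc a b) : IntervalIntegrable g volume x y := by
  have h1 : IntervalIntegrable g volume a b :=
    (intervalIntegrable_iff_integrableOn_Ioo_of_le hab).2 hf.integrableOn
  refine h1.mono_set ?_
  rw [uIcc_of_le hab]
  exact uIcc_subset_Icc hx hy

theorem IsPrim.integral_eq (hf : IsPrim a b f g) (hab : a ≤ b) {x y : ℝ}
    (hx : x ∈ Icc a b) (hy : y ∈ Icc a b) : ∫ t in x..y, g t = f y - f x := by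
  have hb : b ∈ Icc a b := ⟨hab, le_rfl⟩
  rw [hf.eq_sub x hx, hf.eq_sub y hy,
    ← intervalIntegral.integral_add_adjacent_intervals (hf.intervalIntegrable hab hx hy)
      (hf.intervalIntegrable hab hy hb)]
  ring

theorem IsPrim.setIntegral_eq (hf : IsPrim a b f g) (hab : a ≤ b) :
    ∫ t in Ioo a b, g t = f b - f a := by
  rw [← hf.integral_eq hab ⟨le_rfl, hab⟩ ⟨hab, le_rfl⟩, intervalIntegral.integral_of_le hab,
    integral_Ioc_eq_integral_Ioo]

theorem IsPrim.mono (hf : IsPrim a b f g) (hab : a ≤ b) {x y : ℝ} (hx : x ∈ Icc a b)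
    (hy : y ∈ Icc a b) : IsPrim x y f g := by
  refine ⟨hf.integrableOn.mono_set (Ioo_subset_Ioo hx.1 hy.2), fun z hz => ?_⟩
  rw [hf.integral_eq hab ⟨hx.1.trans hz.1, hz.2.trans hy.2⟩ hy]
  ring

theorem IsPrim.congr (hf : IsPrim a b f g) {f' g' : ℝ → ℝ} (hff : EqOn f' f (Icc a b))
    (hgg : g' =ᵐ[volume.restrict (Ioo a b)] g) : IsPrim a b f' g' := by
  refine ⟨hf.integrableOn.congr hgg.symm, fun x hx => ?_⟩
  have hab : a ≤ b := hx.1.trans hx.2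
  rw [hff hx, hff ⟨hab, le_rfl⟩, hf.eq_sub x hx]
  congr 1
  rw [intervalIntegral.integral_of_le hx.2, intervalIntegral.integral_of_le hx.2,
    integral_Ioc_eq_integral_Ioo, integral_Ioc_eq_integral_Ioo]
  exact (integral_congr_ae
    (ae_restrict_of_ae_restrict_of_subset (Ioo_subset_Ioo hx.1 le_rfl) hgg)).symm

theorem IsPrim.absolutelyContinuousOnInterval (hf : IsPrim a b f g) (hab : a ≤ b) :
    AbsolutelyContinuousOnInterval f a b := by
  have hb : b ∈ Icc a b := ⟨hab, le_rfl⟩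
  have h1 := (hf.intervalIntegrable hab ⟨le_rfl, hab⟩
    hb).absolutelyContinuousOnInterval_intervalIntegral (c := b) (by rwa [uIcc_of_le hab])
  have h2 : AbsolutelyContinuousOnInterval (fun _ : ℝ => f b) a b :=
    ((LipschitzWith.const (f b)).lipschitzOnWith).absolutelyContinuousOnInterval
  have heq : ∀ x ∈ uIcc a b,
      ((fun _ : ℝ => f b) + fun x : ℝ => ∫ v in b..x, g v : ℝ → ℝ) x = f x := by
    intro x hx
    rw [uIcc_of_le hab] at hx
    simp only [Pi.add_apply]
    rw [hf.eq_sub x hx, intervalIntegral.integral_symm]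
    ring
  refine Tendsto.congr' ?_ (h2.add h1)
  filter_upwards [mem_inf_of_right (mem_principal_self _)] with E hE
  refine Finset.sum_congr rfl fun i hi => ?_
  rw [heq _ (hE.1 i hi).1, heq _ (hE.1 i hi).2]

theorem IsPrim.continuousOn (hf : IsPrim a b f g) (hab : a ≤ b) : ContinuousOn f (Icc a b) := by
  simpa [uIcc_of_le hab] using (hf.absolutelyContinuousOnInterval hab).continuousOn

theorem IsPrim.ae_hasDerivAt (hf : IsPrim a b f g) (hab : a ≤ b) :
    ∀ᵐ x ∂(volume.restrict (Ioo a b)), HasDerivAt f (g x) x := by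
  have hb : b ∈ uIcc a b := by simp
  have h1 := (hf.intervalIntegrable hab ⟨le_rfl, hab⟩ ⟨hab, le_rfl⟩).ae_hasDerivAt_integral
  rw [ae_restrict_iff' measurableSet_Ioo]
  filter_upwards [h1] with x hx hx'
  have h2 := hx (by rw [uIcc_of_le hab]; exact Ioo_subset_Icc_self hx') b hb
  have h3 : HasDerivAt (fun y => f b + ∫ t in b..y, g t) (g x) x := h2.const_add _
  refine h3.congr_of_eventuallyEq ?_
  filter_upwards [Ioo_mem_nhds hx'.1 hx'.2] with y hy
  rw [hf.eq_sub y (Ioo_subset_Icc_self hy), intervalIntegral.integral_symm]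
  ring

theorem isPrim_of_absolutelyContinuousOnInterval (hab : a ≤ b)
    (hf : AbsolutelyContinuousOnInterval f a b)
    (hg : ∀ᵐ x ∂(volume.restrict (Ioo a b)), HasDerivAt f (g x) x) : IsPrim a b f g := by
  have h0 : IsPrim a b f (deriv f) := by
    refine ⟨(intervalIntegrable_iff_integrableOn_Ioo_of_le hab).1 hf.intervalIntegrable_deriv,
      fun x hx => ?_⟩
    rw [(hf.mono (by rw [uIcc_of_le hab, uIcc_of_le hx.2];
                     exact Icc_subset_Icc hx.1 le_rfl)).integral_deriv_eq_sub]
    ring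
  exact h0.congr (fun _ _ => rfl) (hg.mono fun x hx => hx.deriv.symm)

theorem IsPrim.mul {f' g' : ℝ → ℝ} (hf : IsPrim a b f g) (hf' : IsPrim a b f' g') (hab : a ≤ b) :
    IsPrim a b (fun x => f x * f' x) (fun x => g x * f' x + f x * g' x) := by
  refine isPrim_of_absolutelyContinuousOnInterval hab
    ((hf.absolutelyContinuousOnInterval hab).mul (hf'.absolutelyContinuousOnInterval hab)) ?_
  filter_upwards [hf.ae_hasDerivAt hab, hf'.ae_hasDerivAt hab] with x h1 h2
  exact h1.mul h2

theorem IsPrim.add {f' g' : ℝ → ℝ} (hf : IsPrim a b f g) (hf' : IsPrim a b f' g') (hab : a ≤ b) :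
    IsPrim a b (fun x => f x + f' x) (fun x => g x + g' x) := by
  refine isPrim_of_absolutelyContinuousOnInterval hab
    ((hf.absolutelyContinuousOnInterval hab).add (hf'.absolutelyContinuousOnInterval hab)) ?_
  filter_upwards [hf.ae_hasDerivAt hab, hf'.ae_hasDerivAt hab] with x h1 h2
  exact h1.add h2

theorem isPrim_of_hasDerivAt (h : ∀ x ∈ Icc a b, HasDerivAt f (g x) x)
    (hg : ContinuousOn g (Icc a b)) : IsPrim a b f g := by
  refine ⟨hg.integrableOn_Icc.mono_set Ioo_subset_Icc_self, fun x hx => ?_⟩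
  have hsub : uIcc x b ⊆ Icc a b := by
    rw [uIcc_of_le hx.2]; exact Icc_subset_Icc hx.1 le_rfl
  rw [intervalIntegral.integral_eq_sub_of_hasDerivAt (fun y hy => h y (hsub hy))
    ((hg.mono hsub).intervalIntegrable)]
  ring

theorem IsPrim.const_mul (hf : IsPrim a b f g) (c : ℝ) :
    IsPrim a b (fun x => c * f x) (fun x => c * g x) := by
  refine ⟨hf.integrableOn.const_mul c, fun x hx => ?_⟩
  rw [intervalIntegral.integral_const_mul, hf.eq_sub x hx]
  ring

/-- Chain rule: the composition of an absolutely continuous function with a function that is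
continuously differentiable near its range. -/
theorem IsPrim.comp (hf : IsPrim a b f g) (hab : a ≤ b) {F F' : ℝ → ℝ} {m M : ℝ}
    (hm : ∀ x ∈ Icc a b, f x ∈ Icc m M) (hF : ∀ y ∈ Icc m M, HasDerivAt F (F' y) y)
    (hF' : ContinuousOn F' (Icc m M)) :
    IsPrim a b (fun x => F (f x)) (fun x => F' (f x) * g x) := by
  obtain ⟨C, hC⟩ := isCompact_Icc.exists_bound_of_continuousOn hF'
  have hlip : LipschitzOnWith (Real.toNNReal C) F (Icc m M) := by
    refine (convex_Icc m M).lipschitzOnWith_of_nnnorm_hasDerivWithin_le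
      (fun y hy => (hF y hy).hasDerivWithinAt) (fun y hy => ?_)
    rw [← NNReal.coe_le_coe, coe_nnnorm]
    exact (hC y hy).trans (Real.le_coe_toNNReal C)
  have hac : AbsolutelyContinuousOnInterval (fun x => F (f x)) a b := by
    have h1 := hf.absolutelyContinuousOnInterval hab
    unfold AbsolutelyContinuousOnInterval at h1 ⊢
    have h2 := h1.const_mul ((Real.toNNReal C : NNReal) : ℝ)
    rw [mul_zero] at h2
    refine squeeze_zero' (Eventually.of_forall fun E => by positivity) ?_ h2
    filter_upwards [mem_inf_of_right (mem_principal_self _)] with E hE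
    rw [Finset.mul_sum]
    refine Finset.sum_le_sum fun i hi => ?_
    have h3 := hE.1 i hi
    rw [uIcc_of_le hab] at h3
    exact hlip.dist_le_mul _ (hm _ h3.1) _ (hm _ h3.2)
  refine isPrim_of_absolutelyContinuousOnInterval hab hac ?_
  filter_upwards [hf.ae_hasDerivAt hab, ae_restrict_mem measurableSet_Ioo] with x h1 hx
  exact (hF _ (hm x (Ioo_subset_Icc_self hx))).comp x h1

theorem IsPrim.strictMonoOn (hf : IsPrim a b f g)
    (hg : ∀ᵐ x ∂(volume.restrict (Ioo a b)), 0 < g x) : StrictMonoOn f (Icc a b) := by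
  intro x hx y hy hxy
  have hab : a ≤ b := hx.1.trans hx.2
  have hg' : ∀ᵐ t ∂(volume.restrict (Ioo x y)), 0 < g t :=
    ae_restrict_of_ae_restrict_of_subset (Ioo_subset_Ioo hx.1 hy.2) hg
  rw [← sub_pos, ← hf.integral_eq hab hx hy, intervalIntegral.integral_of_le hxy.le,
    integral_Ioc_eq_integral_Ioo, integral_pos_iff_support_of_nonneg_ae
      (hg'.mono fun t ht => ht.le) (hf.mono hab hx hy).integrableOn]
  rw [pos_iff_ne_zero]
  intro h0
  have h1 : ∀ᵐ t ∂(volume.restrict (Ioo x y)), t ∉ Function.support g :=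
    (measure_eq_zero_iff_ae_notMem).1 h0
  have h2 : ∀ᵐ t ∂(volume.restrict (Ioo x y)), False := by
    filter_upwards [h1, hg'] with t h3 h4
    exact h3 h4.ne'
  have h3 : (volume.restrict (Ioo x y)) univ = 0 := by
    have := ae_iff.1 h2
    simpa using this
  rw [Measure.restrict_apply_univ, Real.volume_Ioo] at h3
  simp at h3
  linarith

/-- A continuous function that is a primitive of a nonnegative function on every `[c,b]`, `c > a`,
is a primitive of it on `[a,b]`; integrability up to `a` is automatic. -/
theorem isPrim_of_forall_gt (hab : a < b) (hf : ContinuousOn f (Icc a b))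
    (hg : ∀ᵐ x ∂(volume.restrict (Ioo a b)), 0 ≤ g x)
    (h : ∀ c ∈ Ioo a b, IsPrim c b f g) : IsPrim a b f g := by
  obtain ⟨u, hu_anti, hu_mem, hu_lim⟩ := exists_seq_strictAnti_tendsto' hab
  have hfa : Tendsto (fun k => f (u k)) atTop (𝓝 (f a)) := by
    have h1 : Tendsto f (𝓝[Icc a b] a) (𝓝 (f a)) := hf a ⟨le_rfl, hab.le⟩
    refine h1.comp (tendsto_nhdsWithin_iff.2 ⟨hu_lim, Eventually.of_forall fun k => ?_⟩)
    exact Ioo_subset_Icc_self (hu_mem k)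
  have hint : IntegrableOn g (Ioc a b) := by
    refine integrableOn_Ioc_of_intervalIntegral_norm_bounded_left (l := atTop) (a := u)
      (I := f b - f a + 1) (fun k => ?_) hu_lim ?_
    · exact (((h _ (hu_mem k)).integrableOn)).congr_set_ae Ioo_ae_eq_Ioc.symm
    · filter_upwards [hfa.eventually (lt_mem_nhds (show f a - 1 < f a by linarith))] with k hk
      have hk' := hu_mem k
      have h2 : ∫ x in Ioc (u k) b, ‖g x‖ = ∫ x in Ioc (u k) b, g x := by
        rw [integral_Ioc_eq_integral_Ioo, integral_Ioc_eq_integral_Ioo]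
        refine integral_congr_ae ?_
        filter_upwards [ae_restrict_of_ae_restrict_of_subset (Ioo_subset_Ioo hk'.1.le le_rfl) hg]
          with x hx
        rw [Real.norm_of_nonneg hx]
      rw [h2, integral_Ioc_eq_integral_Ioo, (h _ hk').setIntegral_eq hk'.2.le]
      linarith
  have hint' : IntegrableOn g (Ioo a b) := hint.mono_set Ioo_subset_Ioc_self
  have hii : IntervalIntegrable g volume a b :=
    (intervalIntegrable_iff_integrableOn_Ioo_of_le hab.le).2 hint'
  have hgt : ∀ x ∈ Ioo a b, f x = f b - ∫ t in x..b, g t := fun x hx =>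
    (h x hx).eq_sub x ⟨le_rfl, hx.2.le⟩
  refine ⟨hint', fun x hx => ?_⟩
  rcases hx.1.eq_or_lt with rfl | hx1
  · have hc : ContinuousOn (fun y => ∫ t in y..b, g t) (uIcc a b) :=
      by
      refine intervalIntegral.continuousOn_primitive_interval_left ?_
      rw [uIcc_of_le hab.le]
      exact hint'.congr_set_ae Ioo_ae_eq_Icc.symm
    rw [uIcc_of_le hab.le] at hc
    have h1 : Tendsto (fun k => f b - ∫ t in (u k)..b, g t) atTop (𝓝 (f b - ∫ t in a..b, g t)) := by
      refine Tendsto.sub tendsto_const_nhds ?_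
      have h2 : Tendsto (fun y => ∫ t in y..b, g t) (𝓝[Icc a b] a) (𝓝 (∫ t in a..b, g t)) :=
        hc a ⟨le_rfl, hab.le⟩
      exact h2.comp (tendsto_nhdsWithin_iff.2 ⟨hu_lim, Eventually.of_forall fun k =>
        Ioo_subset_Icc_self (hu_mem k)⟩)
    refine tendsto_nhds_unique hfa (h1.congr fun k => ?_)
    exact (hgt _ (hu_mem k)).symm
  · rcases hx.2.eq_or_lt with rfl | hx2
    · simp
    · exact hgt x ⟨hx1, hx2⟩

end Primitive

/-! ### Weak derivatives of continuous functions -/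

section WeakDeriv

variable {a b : ℝ} {r g : ℝ → ℝ}

theorem eq_zero_of_tsupport_subset {φ : ℝ → ℝ} {s : Set ℝ} (hφ : tsupport φ ⊆ s) {x : ℝ}
    (hx : x ∉ s) : φ x = 0 :=
  image_eq_zero_of_notMem_tsupport fun h => hx (hφ h)

theorem isPrim_of_contDiff {φ : ℝ → ℝ} (hφ : ContDiff ℝ ∞ φ) : IsPrim a b φ (deriv φ) :=
  isPrim_of_hasDerivAt (fun x _ => (hφ.differentiable (by simp) x).hasDerivAt)
    (hφ.continuous_deriv (by simp)).continuousOn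

/-- Integration by parts against a test function. -/
theorem IsPrim.integral_mul_deriv (hr : IsPrim a b r g) (hab : a ≤ b) {φ : ℝ → ℝ}
    (hφ : ContDiff ℝ ∞ φ) (hs : tsupport φ ⊆ Ioo a b) :
    ∫ R in Ioo a b, r R * deriv φ R = - ∫ R in Ioo a b, g R * φ R := by
  have h1 := (hr.mul (isPrim_of_contDiff hφ) hab).setIntegral_eq hab
  rw [eq_zero_of_tsupport_subset hs (x := a) (by simp),
    eq_zero_of_tsupport_subset hs (x := b) (by simp), integral_add] at h1
  · linarith
  · obtain ⟨C, hC⟩ := isCompact_Icc.exists_bound_of_continuousOn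
      (hφ.continuous.continuousOn (s := Icc a b))
    exact Integrable.mul_bdd (c := C) hr.integrableOn hφ.continuous.aestronglyMeasurable
      ((ae_restrict_mem measurableSet_Ioo).mono fun x hx => hC x (Ioo_subset_Icc_self hx))
  · exact (((hr.continuousOn hab).mul
      (hφ.continuous_deriv (by simp)).continuousOn).integrableOn_Icc).mono_set Ioo_subset_Icc_self

theorem IsPrim.isWeakDeriv (hr : IsPrim a b r g) (hab : a ≤ b) : IsWeakDeriv a b r g :=
  ⟨hr.integrableOn, fun _ hφ _ hs => hr.integral_mul_deriv hab hφ hs⟩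

/-- The lemma of Du Bois-Reymond: a continuous function that is orthogonal to all derivatives of
test functions is constant. -/
theorem exists_eq_const_of_integral_mul_deriv_eq_zero (hab : a < b) {f : ℝ → ℝ}
    (hf : ContinuousOn f (Icc a b))
    (h : ∀ φ : ℝ → ℝ, ContDiff ℝ ∞ φ → HasCompactSupport φ → tsupport φ ⊆ Ioo a b →
      ∫ R in Ioo a b, f R * deriv φ R = 0) :
    ∃ c, ∀ x ∈ Icc a b, f x = c := by
  have hfi : ∀ φ : ℝ → ℝ, Continuous φ → IntegrableOn (fun x => f x * φ x) (Ioo a b) := fun φ hφ =>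
    ((hf.mul hφ.continuousOn).integrableOn_Icc).mono_set Ioo_subset_Icc_self
  have hci : ∀ φ : ℝ → ℝ, Continuous φ → IntegrableOn φ (Ioo a b) := fun φ hφ =>
    (hφ.continuousOn.integrableOn_Icc).mono_set Ioo_subset_Icc_self
  -- a normalised bump function
  obtain ⟨ψ, hψ, hψc, hψs, hψ1⟩ : ∃ ψ : ℝ → ℝ, ContDiff ℝ ∞ ψ ∧ HasCompactSupport ψ ∧
      tsupport ψ ⊆ Ioo a b ∧ ∫ R in Ioo a b, ψ R = 1 := by
    let B : ContDiffBump ((a + b) / 2) := ⟨(b - a) / 8, (b - a) / 4, by linarith, by linarith⟩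
    have hB : tsupport (B.normed volume) ⊆ Ioo a b := by
      rw [B.tsupport_normed_eq, Real.closedBall_eq_Icc]
      exact Icc_subset_Ioo (by simp only [B]; linarith) (by simp only [B]; linarith)
    refine ⟨B.normed volume, B.contDiff_normed, B.hasCompactSupport_normed, hB, ?_⟩
    rw [setIntegral_eq_integral_of_forall_compl_eq_zero
      (fun x hx => eq_zero_of_tsupport_subset hB hx), B.integral_normed]
  set c := ∫ R in Ioo a b, f R * ψ R with hc
  have hker : ∀ φ : ℝ → ℝ, ContDiff ℝ ∞ φ → HasCompactSupport φ → tsupport φ ⊆ Ioo a b →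
      ∫ R in Ioo a b, (f R - c) * φ R = 0 := by
    intro φ hφ hφc hφs
    -- subtracting a multiple of `ψ` gives mean zero, hence the derivative of a test function
    set m := ∫ R in Ioo a b, φ R with hm
    let φ0 : ℝ → ℝ := fun x => φ x - m * ψ x
    have hφ0 : ContDiff ℝ ∞ φ0 := hφ.sub (contDiff_const.mul hψ)
    let Φ : ℝ → ℝ := fun x => ∫ t in a..x, φ0 t
    have hΦd : ∀ x, HasDerivAt Φ (φ0 x) x := fun x =>
      intervalIntegral.integral_hasDerivAt_right (hφ0.continuous.intervalIntegrable _ _)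
        (hφ0.continuous.stronglyMeasurableAtFilter _ _) hφ0.continuous.continuousAt
    have hΦ' : deriv Φ = φ0 := funext fun x => (hΦd x).deriv
    have hΦ : ContDiff ℝ ∞ Φ := by
      rw [contDiff_infty_iff_deriv, hΦ']
      exact ⟨fun x => (hΦd x).differentiableAt, hφ0⟩
    have hK : IsCompact (tsupport φ ∪ tsupport ψ) := hφc.isCompact.union hψc.isCompact
    have hKs : tsupport φ ∪ tsupport ψ ⊆ Ioo a b := union_subset hφs hψs
    obtain ⟨p, q, hpq, hap, hqb⟩ : ∃ p q, tsupport φ ∪ tsupport ψ ⊆ Icc p q ∧ a < p ∧ q < b := by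
      have hne : (tsupport φ ∪ tsupport ψ).Nonempty := by
        by_contra hemp
        rw [not_nonempty_iff_eq_empty, union_empty_iff] at hemp
        have h0 : ∀ x, ψ x = 0 := fun x =>
          image_eq_zero_of_notMem_tsupport (by rw [hemp.2]; simp)
        simp [h0] at hψ1
      exact ⟨sInf _, sSup _, fun x hx => ⟨csInf_le hK.bddBelow hx, le_csSup hK.bddAbove hx⟩,
        (hKs (hK.sInf_mem hne)).1, (hKs (hK.sSup_mem hne)).2⟩
    have hφ00 : ∀ x, x ∉ Icc p q → φ0 x = 0 := by
      intro x hx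
      have h1 : φ x = 0 := image_eq_zero_of_notMem_tsupport fun h => hx (hpq (Or.inl h))
      have h2 : ψ x = 0 := image_eq_zero_of_notMem_tsupport fun h => hx (hpq (Or.inr h))
      simp [φ0, h1, h2]
    have hint0 : ∫ t in a..b, φ0 t = 0 := by
      rw [intervalIntegral.integral_of_le hab.le, integral_Ioc_eq_integral_Ioo,
        integral_sub (hci _ hφ.continuous) ((hci _ hψ.continuous).const_mul m),
        integral_const_mul, hψ1, hm]
      ring
    have hΦsupp : tsupport Φ ⊆ Icc p q := by
      refine closure_minimal (fun x hx => ?_) isClosed_Icc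
      by_contra hxn
      refine hx ?_
      rw [mem_Icc, not_and_or, not_le, not_le] at hxn
      rcases hxn with hxp | hxq
      · change ∫ t in a..x, φ0 t = 0
        refine (intervalIntegral.integral_congr (g := fun _ => (0 : ℝ)) fun t ht => ?_).trans
          (by simp)
        refine hφ00 t fun ht' => ?_
        have := (mem_uIcc.1 ht)
        rcases this with h | h <;> linarith [ht'.1, h.1, h.2]
      · have h1 : ∫ t in x..b, φ0 t = 0 := by
          refine (intervalIntegral.integral_congr (g := fun _ => (0 : ℝ)) fun t ht => ?_).trans
            (by simp)
          refine hφ00 t fun ht' => ?_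
          have := (mem_uIcc.1 ht)
          rcases this with h | h <;> linarith [ht'.2, h.1, h.2]
        have h2 := intervalIntegral.integral_add_adjacent_intervals
          (hφ0.continuous.intervalIntegrable (μ := volume) a x)
          (hφ0.continuous.intervalIntegrable (μ := volume) x b)
        change ∫ t in a..x, φ0 t = 0
        linarith
    have h3 := h Φ hΦ (IsCompact.of_isClosed_subset isCompact_Icc (isClosed_tsupport _) hΦsupp)
      (hΦsupp.trans (Icc_subset_Ioo hap hqb))
    rw [hΦ'] at h3
    have h4 : ∀ R, f R * φ0 R = f R * φ R - m * (f R * ψ R) := fun R => by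
      simp only [φ0]; ring
    simp_rw [h4] at h3
    rw [integral_sub (hfi _ hφ.continuous) ((hfi _ hψ.continuous).const_mul m),
      integral_const_mul, ← hc] at h3
    simp_rw [sub_mul]
    rw [integral_sub (hfi _ hφ.continuous) ((hci _ hφ.continuous).const_mul c),
      integral_const_mul, ← hm]
    linarith
  refine ⟨c, ?_⟩
  have hae : ∀ᵐ x, x ∈ Ioo a b → f x - c = 0 := by
    refine isOpen_Ioo.ae_eq_zero_of_integral_contDiff_smul_eq_zero ?_ ?_
    · exact ((hf.sub continuousOn_const).mono Ioo_subset_Icc_self).locallyIntegrableOn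
        measurableSet_Ioo
    · intro φ hφ hφc hφs
      have h1 := hker φ hφ hφc hφs
      rw [← setIntegral_eq_integral_of_forall_compl_eq_zero (s := Ioo a b)
        (fun x hx => by rw [eq_zero_of_tsupport_subset hφs hx, zero_smul])]
      rw [← h1]
      refine integral_congr_ae (Eventually.of_forall fun x => ?_)
      simp [mul_comm]
  have hae' : f =ᵐ[volume.restrict (Icc a b)] fun _ => c := by
    rw [← restrict_Ioo_eq_restrict_Icc]
    exact ((ae_restrict_iff' measurableSet_Ioo).2 hae).mono fun x hx => sub_eq_zero.1 hx
  exact fun x hx => Measure.eqOn_Icc_of_ae_eq volume hab.ne hae' hf continuousOn_const hx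

/-- A continuous function with integrable weak derivative `g` is a primitive of `g`. -/
theorem IsWeakDeriv.isPrim (hab : a < b) (hr : ContinuousOn r (Icc a b))
    (h : IsWeakDeriv a b r g) : IsPrim a b r g := by
  let G : ℝ → ℝ := fun x => - ∫ t in x..b, g t
  have hG : IsPrim a b G g := ⟨h.1, fun x _ => by simp [G]⟩
  obtain ⟨c, hc⟩ := exists_eq_const_of_integral_mul_deriv_eq_zero hab
    (hr.sub (hG.continuousOn hab.le)) (fun φ hφ hφc hφs => by
      have h1 := h.2 φ hφ hφc hφs
      have h2 := hG.integral_mul_deriv hab.le hφ hφs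
      have hd : Continuous (deriv φ) := hφ.continuous_deriv (by simp)
      simp only [Pi.sub_apply, sub_mul]
      rw [integral_sub, h1, h2, sub_self]
      · exact ((hr.mul hd.continuousOn).integrableOn_Icc).mono_set Ioo_subset_Icc_self
      · exact (((hG.continuousOn hab.le).mul hd.continuousOn).integrableOn_Icc).mono_set
          Ioo_subset_Icc_self)
  refine ⟨h.1, fun x hx => ?_⟩
  have h1 := hc x hx
  have h2 := hc b ⟨hab.le, le_rfl⟩
  simp only [G, Pi.sub_apply, intervalIntegral.integral_same] at h1 h2
  linarith

theorem IsPrim.ae_eq {g' : ℝ → ℝ} (hab : a ≤ b) (h : IsPrim a b r g) (h' : IsPrim a b r g') :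
    g =ᵐ[volume.restrict (Ioo a b)] g' := by
  filter_upwards [h.ae_hasDerivAt hab, h'.ae_hasDerivAt hab] with x h1 h2
  exact h1.unique h2

/-- For a continuous `r ∈ W^{1,1}(a,b)`, `r` is a primitive of its weak derivative. -/
theorem MemW11.isPrim_weakDeriv (hab : a < b) (hr : MemW11 a b r)
    (hc : ContinuousOn r (Icc a b)) : IsPrim a b r (weakDeriv a b r) :=
  IsWeakDeriv.isPrim hab hc (Classical.epsilon_spec hr.2)

theorem IsPrim.memW11 (hab : a ≤ b) (hr : IsPrim a b r g) : MemW11 a b r :=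
  ⟨(hr.continuousOn hab).integrableOn_Icc.mono_set Ioo_subset_Icc_self, g, hr.isWeakDeriv hab⟩

theorem IsPrim.weakDeriv_ae_eq (hab : a < b) (hr : IsPrim a b r g) :
    weakDeriv a b r =ᵐ[volume.restrict (Ioo a b)] g :=
  ((hr.memW11 hab.le).isPrim_weakDeriv hab (hr.continuousOn hab.le)).ae_eq hab.le hr

end WeakDeriv

/-! ### The volume coordinate -/

/-- The function `u` with `u(1) = L` and `u'(R) = n R^{n-1} d(R)`. For a radial deformation `r` with
Jacobian determinant `d = r' (r/R)^{n-1}` and `L = r(1)^n` it is `r^n`. -/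
noncomputable def vol (n : ℕ) (L : ℝ) (d : ℝ → ℝ) (R : ℝ) : ℝ :=
  L - ∫ S in R..1, n * S ^ (n - 1) * d S

/-- The part of the energy density that remains in the coordinates `(u, d)` after an exact
derivative has been split off; it is nonnegative and jointly convex in `(u, d)`. -/
noncomputable def dens (n : ℕ) (κ : ℝ) (h : ℝ → ℝ) (R u d : ℝ) : ℝ :=
  R ^ (n - 1) * (κ / n * (d ^ n * (R ^ n / u) ^ (n - 1) + (n - 1) * (u / R ^ n)) + h d)

/-- The boundary term at `R = ε`, as a function of `u(ε) = r(ε)^n`. -/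
noncomputable def bdry (n : ℕ) (κ ε x : ℝ) : ℝ :=
  κ * (n - 1) / n ^ 2 * (x * Real.log (x / ε ^ n))

section Volume

variable {n : ℕ} {ε L : ℝ} {d : ℝ → ℝ}

theorem isPrim_vol (hd : IntegrableOn d (Ioo ε 1)) :
    IsPrim ε 1 (vol n L d) (fun S => n * S ^ (n - 1) * d S) := by
  refine ⟨?_, fun x _ => by simp [vol]⟩
  have hc : Continuous fun S : ℝ => (n : ℝ) * S ^ (n - 1) := by fun_prop
  obtain ⟨C, hC⟩ := isCompact_Icc.exists_bound_of_continuousOn (hc.continuousOn (s := Icc ε 1))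
  exact Integrable.bdd_mul (c := C) hd hc.aestronglyMeasurable
      ((ae_restrict_mem measurableSet_Ioo).mono fun x hx => hC x (Ioo_subset_Icc_self hx))

@[simp] theorem vol_one : vol n L d 1 = L := by simp [vol]

theorem vol_congr {d' : ℝ → ℝ} (h : d =ᵐ[volume.restrict (Ioo ε 1)] d') :
    EqOn (vol n L d) (vol n L d') (Icc ε 1) := by
  intro x hx
  unfold vol
  congr 1
  rw [intervalIntegral.integral_of_le hx.2, intervalIntegral.integral_of_le hx.2,
    integral_Ioc_eq_integral_Ioo, integral_Ioc_eq_integral_Ioo]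
  refine integral_congr_ae ?_
  filter_upwards [ae_restrict_of_ae_restrict_of_subset (Ioo_subset_Ioo hx.1 le_rfl) h] with t ht
  rw [ht]

theorem continuousOn_vol (hε1 : ε < 1) (hd : IntegrableOn d (Ioo ε 1)) :
    ContinuousOn (vol n L d) (Icc ε 1) :=
  (isPrim_vol hd).continuousOn hε1.le

theorem strictMonoOn_vol (hn : 2 ≤ n) (hε : 0 < ε) (hd : IntegrableOn d (Ioo ε 1))
    (hpos : ∀ᵐ R ∂(volume.restrict (Ioo ε 1)), 0 < d R) : StrictMonoOn (vol n L d) (Icc ε 1) := by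
  refine (isPrim_vol hd).strictMonoOn ?_
  filter_upwards [hpos, ae_restrict_mem measurableSet_Ioo] with x hx hx'
  have : 0 < x := hε.trans hx'.1
  have : (0 : ℝ) < n := by exact_mod_cast (by omega : 0 < n)
  positivity

end Volume

section Dictionary

variable {n : ℕ} {ε lam : ℝ}

/-- The Jacobian determinant `r' (r/R)^{n-1}` of the radial deformation `r`. -/
noncomputable def jac (n : ℕ) (ε : ℝ) (r : ℝ → ℝ) (R : ℝ) : ℝ :=
  weakDeriv ε 1 r R * (r R / R) ^ (n - 1)

theorem isPrim_of_admissible (hε1 : ε < 1) {r : ℝ → ℝ} (hr : r ∈ admissible ε lam) :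
    IsPrim ε 1 r (weakDeriv ε 1 r) :=
  hr.1.isPrim_weakDeriv hε1 hr.2.1

theorem pos_of_admissible (hε1 : ε < 1) {r : ℝ → ℝ} (hr : r ∈ admissible ε lam) {R : ℝ}
    (hR : R ∈ Ioc ε 1) : 0 < r R :=
  hr.2.2.2.2.trans_lt ((isPrim_of_admissible hε1 hr).strictMonoOn hr.2.2.2.1 ⟨le_rfl, hε1.le⟩
    ⟨hR.1.le, hR.2⟩ hR.1)

theorem nonneg_of_admissible (hε1 : ε < 1) {r : ℝ → ℝ} (hr : r ∈ admissible ε lam) {R : ℝ}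
    (hR : R ∈ Icc ε 1) : 0 ≤ r R := by
  rcases hR.1.eq_or_lt with rfl | h
  · exact hr.2.2.2.2
  · exact (pos_of_admissible hε1 hr ⟨h, hR.2⟩).le

theorem isPrim_pow_of_admissible (hε1 : ε < 1) {r : ℝ → ℝ} (hr : r ∈ admissible ε lam) :
    IsPrim ε 1 (fun R => r R ^ n) (fun R => n * r R ^ (n - 1) * weakDeriv ε 1 r R) := by
  have hp := isPrim_of_admissible hε1 hr
  obtain ⟨C, hC⟩ := isCompact_Icc.exists_bound_of_continuousOn hr.2.1
  exact hp.comp hε1.le (F := fun y => y ^ n) (F' := fun y => n * y ^ (n - 1)) (m := -C) (M := C)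
    (fun x hx => abs_le.1 (hC x hx)) (fun y _ => hasDerivAt_pow n y) (by fun_prop)

theorem jac_pos (hε : 0 < ε) (hε1 : ε < 1) {r : ℝ → ℝ} (hr : r ∈ admissible ε lam) :
    ∀ᵐ R ∂(volume.restrict (Ioo ε 1)), 0 < jac n ε r R := by
  filter_upwards [hr.2.2.2.1, ae_restrict_mem measurableSet_Ioo] with R h1 hR
  have := pos_of_admissible hε1 hr ⟨hR.1, hR.2.le⟩
  have := hε.trans hR.1
  unfold jac
  positivity

theorem integrableOn_jac (hε : 0 < ε) (hε1 : ε < 1) {r : ℝ → ℝ} (hr : r ∈ admissible ε lam) :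
    IntegrableOn (jac n ε r) (Ioo ε 1) := by
  have hc : ContinuousOn (fun R => (r R / R) ^ (n - 1)) (Icc ε 1) :=
    (hr.2.1.div continuousOn_id fun x hx => (hε.trans_le hx.1).ne').pow _
  obtain ⟨C, hC⟩ := isCompact_Icc.exists_bound_of_continuousOn hc
  exact Integrable.mul_bdd (c := C) (isPrim_of_admissible hε1 hr).integrableOn
    ((hc.mono Ioo_subset_Icc_self).aestronglyMeasurable measurableSet_Ioo)
    ((ae_restrict_mem measurableSet_Ioo).mono fun x hx => hC x (Ioo_subset_Icc_self hx))

theorem vol_jac (hε : 0 < ε) (hε1 : ε < 1) {r : ℝ → ℝ} (hr : r ∈ admissible ε lam) :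
    EqOn (vol n (lam ^ n) (jac n ε r)) (fun R => r R ^ n) (Icc ε 1) := by
  have h1 : IsPrim ε 1 (fun R => r R ^ n) (fun R => n * R ^ (n - 1) * jac n ε r R) := by
    refine (isPrim_pow_of_admissible hε1 hr).congr (fun _ _ => rfl) ?_
    filter_upwards [ae_restrict_mem measurableSet_Ioo] with R hR
    have hR0 : R ≠ 0 := (hε.trans hR.1).ne'
    unfold jac
    rw [div_pow]
    field_simp
  intro R hR
  simp only
  rw [h1.eq_sub R hR, vol, hr.2.2.1]

/-- The radial deformation with prescribed Jacobian determinant. -/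
noncomputable def defOfJac (n : ℕ) (L : ℝ) (d : ℝ → ℝ) (R : ℝ) : ℝ :=
  vol n L d R ^ ((n : ℝ)⁻¹)

theorem vol_nonneg (hn : 2 ≤ n) (hε : 0 < ε) (hε1 : ε < 1) {L : ℝ} {d : ℝ → ℝ}
    (hd : IntegrableOn d (Ioo ε 1))
    (hpos : ∀ᵐ R ∂(volume.restrict (Ioo ε 1)), 0 < d R) (h0 : 0 ≤ vol n L d ε) {R : ℝ}
    (hR : R ∈ Icc ε 1) : 0 ≤ vol n L d R :=
  h0.trans ((strictMonoOn_vol hn hε hd hpos).monotoneOn ⟨le_rfl, hε1.le⟩ hR hR.1)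

theorem vol_pos (hn : 2 ≤ n) (hε : 0 < ε) (hε1 : ε < 1) {L : ℝ} {d : ℝ → ℝ}
    (hd : IntegrableOn d (Ioo ε 1))
    (hpos : ∀ᵐ R ∂(volume.restrict (Ioo ε 1)), 0 < d R) (h0 : 0 ≤ vol n L d ε) {R : ℝ}
    (hR : R ∈ Ioc ε 1) : 0 < vol n L d R :=
  h0.trans_lt (strictMonoOn_vol hn hε hd hpos ⟨le_rfl, hε1.le⟩ ⟨hR.1.le, hR.2⟩ hR.1)

theorem defOfJac_pow (hn : 2 ≤ n) {L : ℝ} {d : ℝ → ℝ} {R : ℝ} (h : 0 ≤ vol n L d R) :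
    defOfJac n L d R ^ n = vol n L d R := by
  unfold defOfJac
  exact Real.rpow_inv_natCast_pow h (by omega)

/-- The deformation is absolutely continuous up to the cavity surface, even if the cavity is closed
and `r = u^{1/n}` is not differentiable there: its derivative is nonnegative, hence integrable. -/
theorem isPrim_defOfJac (hn : 2 ≤ n) (hε : 0 < ε) (hε1 : ε < 1) {L : ℝ} {d : ℝ → ℝ}
    (hd : IntegrableOn d (Ioo ε 1))
    (hpos : ∀ᵐ R ∂(volume.restrict (Ioo ε 1)), 0 < d R) (h0 : 0 ≤ vol n L d ε) :
    IsPrim ε 1 (defOfJac n L d) (fun R => d R * (R / defOfJac n L d R) ^ (n - 1)) := by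
  have hn0 : (n : ℝ) ≠ 0 := by exact_mod_cast (by omega : n ≠ 0)
  have hrpos : ∀ R ∈ Ioc ε 1, 0 < defOfJac n L d R := fun R hR =>
    Real.rpow_pos_of_pos (vol_pos hn hε hε1 hd hpos h0 hR) _
  refine isPrim_of_forall_gt hε1 ?_ ?_ ?_
  · exact (continuousOn_vol hε1 hd).rpow_const fun x _ => Or.inr (by positivity)
  · filter_upwards [hpos, ae_restrict_mem measurableSet_Ioo] with R h1 hR
    have h2 := hrpos R ⟨hR.1, hR.2.le⟩
    have h3 := hε.trans hR.1
    positivity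
  · intro c hc
    have hcI : c ∈ Icc ε 1 := Ioo_subset_Icc_self hc
    have hc1 : (1 : ℝ) ∈ Icc ε 1 := ⟨hε1.le, le_rfl⟩
    have hp := (isPrim_vol (n := n) (L := L) hd).mono hε1.le hcI hc1
    have hmono := (strictMonoOn_vol (L := L) hn hε hd hpos).monotoneOn
    have hvc := vol_pos hn hε hε1 hd hpos h0 ⟨hc.1, hc.2.le⟩
    have hcomp := hp.comp hc.2.le (F := fun y => y ^ ((n : ℝ)⁻¹))
      (F' := fun y => (n : ℝ)⁻¹ * y ^ ((n : ℝ)⁻¹ - 1)) (m := vol n L d c) (M := vol n L d 1)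
      (fun x hx => ⟨hmono hcI ⟨hcI.1.trans hx.1, hx.2⟩ hx.1,
        hmono ⟨hcI.1.trans hx.1, hx.2⟩ hc1 hx.2⟩)
      (fun y hy => Real.hasDerivAt_rpow_const (Or.inl (hvc.trans_le hy.1).ne'))
      (continuousOn_const.mul (continuousOn_id.rpow_const fun y hy =>
        Or.inl (hvc.trans_le hy.1).ne'))
    refine hcomp.congr (fun _ _ => rfl) ?_
    filter_upwards [ae_restrict_mem measurableSet_Ioo] with R hR
    have hR' : R ∈ Ioc ε 1 := ⟨hc.1.trans hR.1, hR.2.le⟩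
    have hv := vol_pos hn hε hε1 hd hpos h0 hR'
    have hr := hrpos R hR'
    have h1 : vol n L d R ^ ((n : ℝ)⁻¹ - 1) = (defOfJac n L d R ^ (n - 1))⁻¹ := by
      rw [Real.rpow_sub hv, Real.rpow_one]
      change defOfJac n L d R / vol n L d R = _
      rw [← defOfJac_pow hn hv.le]
      obtain ⟨m, rfl⟩ : ∃ m, n = m + 1 := ⟨n - 1, by omega⟩
      rw [Nat.add_sub_cancel, pow_succ]
      field_simp
    rw [h1, div_pow]
    field_simp

theorem defOfJac_mem_admissible (hn : 2 ≤ n) (hε : 0 < ε) (hε1 : ε < 1) (hlam : 0 < lam)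
    {d : ℝ → ℝ} (hd : IntegrableOn d (Ioo ε 1))
    (hpos : ∀ᵐ R ∂(volume.restrict (Ioo ε 1)), 0 < d R) (h0 : 0 ≤ vol n (lam ^ n) d ε) :
    defOfJac n (lam ^ n) d ∈ admissible ε lam := by
  have hp := isPrim_defOfJac hn hε hε1 hd hpos h0
  refine ⟨hp.memW11 hε1.le, hp.continuousOn hε1.le, ?_, ?_, Real.rpow_nonneg h0 _⟩
  · simp only [defOfJac, vol_one]
    exact Real.pow_rpow_inv_natCast hlam.le (by omega)
  · filter_upwards [hp.weakDeriv_ae_eq hε1, hpos, ae_restrict_mem measurableSet_Ioo] with R h1 h2 hR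
    rw [h1]
    have h3 : 0 < defOfJac n (lam ^ n) d R :=
      Real.rpow_pos_of_pos (vol_pos hn hε hε1 hd hpos h0 ⟨hR.1, hR.2.le⟩) _
    have h4 := hε.trans hR.1
    positivity

theorem jac_defOfJac (hn : 2 ≤ n) (hε : 0 < ε) (hε1 : ε < 1) {L : ℝ}
    {d : ℝ → ℝ} (hd : IntegrableOn d (Ioo ε 1))
    (hpos : ∀ᵐ R ∂(volume.restrict (Ioo ε 1)), 0 < d R) (h0 : 0 ≤ vol n L d ε) :
    jac n ε (defOfJac n L d) =ᵐ[volume.restrict (Ioo ε 1)] d := by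
  have hp := isPrim_defOfJac hn hε hε1 hd hpos h0
  filter_upwards [hp.weakDeriv_ae_eq hε1, ae_restrict_mem measurableSet_Ioo] with R h1 hR
  have h3 : 0 < defOfJac n L d R :=
    Real.rpow_pos_of_pos (vol_pos hn hε hε1 hd hpos h0 ⟨hR.1, hR.2.le⟩) _
  have h4 := hε.trans hR.1
  rw [jac, h1, mul_assoc, ← mul_pow, div_mul_div_cancel₀ h3.ne', div_self h4.ne', one_pow, mul_one]

end Dictionary

/-! ### The energy in the volume coordinate -/

section Energy

theorem hasDerivAt_pow_mul_log {n : ℕ} (hn : 2 ≤ n) (y : ℝ) :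
    HasDerivAt (fun y : ℝ => y ^ n * Real.log y)
      (n * y ^ (n - 1) * Real.log y + y ^ (n - 1)) y := by
  obtain ⟨m, rfl⟩ : ∃ m, n = m + 2 := ⟨n - 2, by omega⟩
  rcases eq_or_ne y 0 with rfl | hy
  · have h1 : HasDerivAt (fun y : ℝ => y * (y ^ m * (y * Real.log y))) 0 0 := by
      rw [hasDerivAt_iff_tendsto_slope_zero]
      have h2 : Continuous fun y : ℝ => y ^ m * (y * Real.log y) :=
        (continuous_pow m).mul Real.continuous_mul_log
      have h3 := (h2.tendsto 0).mono_left (nhdsWithin_le_nhds (s := {0}ᶜ))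
      simp only [zero_mul, mul_zero] at h3
      refine h3.congr' ?_
      filter_upwards [self_mem_nhdsWithin] with t ht
      have ht' : t ≠ 0 := ht
      simp only [zero_add, zero_mul, sub_zero, smul_eq_mul]
      field_simp
    convert h1 using 1
    · ext y; ring
    · simp
  · have h1 := (hasDerivAt_pow (m + 2) y).mul (Real.hasDerivAt_log hy)
    have h2 : y ^ (m + 2) * y⁻¹ = y ^ (m + 2 - 1) := by
      rw [pow_succ y (m + 1), mul_assoc, mul_inv_cancel₀ hy, mul_one]
      rfl
    rw [h2] at h1
    exact h1

theorem continuous_pow_mul_log_deriv {n : ℕ} (hn : 2 ≤ n) :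
    Continuous fun y : ℝ => n * y ^ (n - 1) * Real.log y + y ^ (n - 1) := by
  obtain ⟨m, rfl⟩ : ∃ m, n = m + 2 := ⟨n - 2, by omega⟩
  have h : (fun y : ℝ => ((m + 2 : ℕ) : ℝ) * y ^ (m + 2 - 1) * Real.log y + y ^ (m + 2 - 1))
      = fun y => ((m + 2 : ℕ) : ℝ) * (y ^ m * (y * Real.log y)) + y ^ (m + 1) := by
    ext y
    simp only [show m + 2 - 1 = m + 1 from rfl]
    ring
  rw [h]
  have := Real.continuous_mul_log
  fun_prop

theorem prod_stretches (n : ℕ) [n.AtLeastTwo] (q v : ℝ) :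
    ∏ i, stretches n q v i = q * v ^ (n - 1) := by
  unfold stretches
  rw [Finset.prod_update_of_mem (Finset.mem_univ _), Finset.prod_const,
    Finset.card_sdiff_of_subset (by simp)]
  simp

theorem prod_erase_stretches (n : ℕ) [n.AtLeastTwo] (q v : ℝ) :
    ∏ i ∈ Finset.univ.erase (0 : Fin n), stretches n q v i = v ^ (n - 1) := by
  unfold stretches
  rw [Finset.prod_update_of_notMem (by simp), Finset.prod_const, Finset.card_erase_of_mem (by simp)]
  simp

theorem modPhi_stretches (n : ℕ) [n.AtLeastTwo] (κ : ℝ) (h : ℝ → ℝ) (q v : ℝ) :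
    modPhi n κ h (stretches n q v) = κ / n * q ^ n + h (q * v ^ (n - 1)) +
      κ * (q * v ^ (n - 1)) * (((n : ℝ) - 1) / n + (n - 1) * Real.log v) := by
  have h1 : ((n - 1 : ℕ) : ℝ) = (n : ℝ) - 1 := by
    rw [Nat.cast_sub (by have := Nat.AtLeastTwo.one_lt (n := n); omega)]; simp
  unfold modPhi
  rw [prod_stretches, prod_erase_stretches, Real.log_pow, h1]
  simp [stretches]

variable {n : ℕ} {κ ε lam : ℝ} {h : ℝ → ℝ}

/-- `r^n log(r/R)` is absolutely continuous, also if `r` vanishes at the left end point. -/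
theorem isPrim_pow_mul_log (hn : 2 ≤ n) (hε : 0 < ε) (hε1 : ε < 1) {r : ℝ → ℝ}
    (hr : r ∈ admissible ε lam) :
    IsPrim ε 1 (fun R => r R ^ n * Real.log (r R / R))
      (fun R => (n * r R ^ (n - 1) * Real.log (r R / R) + r R ^ (n - 1)) * weakDeriv ε 1 r R
        - r R ^ n / R) := by
  have hp := isPrim_of_admissible hε1 hr
  obtain ⟨C, hC⟩ := isCompact_Icc.exists_bound_of_continuousOn hr.2.1
  have h1 := hp.comp hε1.le (m := -C) (M := C) (fun x hx => abs_le.1 (hC x hx))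
    (fun y _ => hasDerivAt_pow_mul_log hn y) (continuous_pow_mul_log_deriv hn).continuousOn
  have hlog : IsPrim ε 1 (fun R => -Real.log R) (fun R => -R⁻¹) :=
    isPrim_of_hasDerivAt (fun x hx => (Real.hasDerivAt_log (hε.trans_le hx.1).ne').neg)
      (continuousOn_id.inv₀ fun x hx => (hε.trans_le hx.1).ne').neg
  have h2 := (isPrim_pow_of_admissible (n := n) hε1 hr).mul hlog hε1.le
  refine (h1.add h2 hε1.le).congr (fun R hR => ?_) ?_
  · simp only
    rcases (nonneg_of_admissible hε1 hr hR).eq_or_lt with h0 | h0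
    · rw [← h0]; simp [show n ≠ 0 by omega]
    · rw [Real.log_div h0.ne' (hε.trans_le hR.1).ne']; ring
  · filter_upwards [ae_restrict_mem measurableSet_Ioo] with R hR
    rw [Real.log_div (pos_of_admissible hε1 hr ⟨hR.1, hR.2.le⟩).ne' (hε.trans hR.1).ne']
    ring

/-- The stored energy splits into the density in the coordinates `(u, d)` and the derivative of
`r^n log (r/R)`, up to the factor `κ (n-1)/n`. -/
theorem dens_add_eq (hn : 2 ≤ n) {R r q : ℝ} (hR : 0 < R) (hr : 0 < r) :
    R ^ (n - 1) * (κ / n * q ^ n + h (q * (r / R) ^ (n - 1)) +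
      κ * (q * (r / R) ^ (n - 1)) * (((n : ℝ) - 1) / n + (n - 1) * Real.log (r / R))) =
    dens n κ h R (r ^ n) (q * (r / R) ^ (n - 1)) + κ * (n - 1) / n *
      ((n * r ^ (n - 1) * Real.log (r / R) + r ^ (n - 1)) * q - r ^ n / R) := by
  have hn0 : (n : ℝ) ≠ 0 := by exact_mod_cast (by omega : n ≠ 0)
  have h1 : (q * (r / R) ^ (n - 1)) ^ n * (R ^ n / r ^ n) ^ (n - 1) = q ^ n := by
    rw [mul_pow, ← pow_mul, ← div_pow R r n, ← pow_mul, mul_comm n (n - 1), mul_assoc, ← mul_pow,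
      div_mul_div_cancel₀ hR.ne', div_self hr.ne', one_pow, mul_one]
  unfold dens
  rw [h1]
  have h2 : R ^ n = R ^ (n - 1) * R := by
    rw [← pow_succ]; congr 1; omega
  rw [h2, div_pow]
  have := pow_pos hR (n - 1)
  field_simp
  ring

theorem extIntegral_of_integrable {μ : Measure ℝ} {f : ℝ → ℝ} (hf : Integrable f μ) :
    extIntegral μ f = ((∫ x, f x ∂μ : ℝ) : EReal) := by
  have h1 : ∫⁻ x, ENNReal.ofReal (f x) ∂μ ≠ ⊤ := hf.lintegral_lt_top.ne
  have h2 : ∫⁻ x, ENNReal.ofReal (-f x) ∂μ ≠ ⊤ := hf.neg.lintegral_lt_top.ne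
  rw [integral_eq_lintegral_pos_part_sub_lintegral_neg_part hf, extIntegral, EReal.coe_sub,
    EReal.coe_ennreal_toReal h1, EReal.coe_ennreal_toReal h2]

/-- A nonnegative function whose integral diverges, perturbed by an integrable one, has extended
integral `∞`. -/
theorem extIntegral_add_eq_top {μ : Measure ℝ} {f g w : ℝ → ℝ} (hfg : f =ᵐ[μ] fun x => g x + w x)
    (hgm : AEStronglyMeasurable g μ) (hg0 : 0 ≤ᵐ[μ] g) (hg : ¬ Integrable g μ)
    (hw : Integrable w μ) : extIntegral μ f = ⊤ := by
  have h1 : ∫⁻ x, ENNReal.ofReal (f x) ∂μ = ⊤ := by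
    by_contra hne
    apply hg
    refine ⟨hgm, ?_⟩
    rw [hasFiniteIntegral_iff_ofReal hg0]
    have hw' : ∫⁻ x, ENNReal.ofReal (-w x) ∂μ < ⊤ := hw.neg.lintegral_lt_top
    have hle : ∫⁻ x, ENNReal.ofReal (g x) ∂μ ≤
        ∫⁻ x, (ENNReal.ofReal (f x) + ENNReal.ofReal (-w x)) ∂μ := by
      refine lintegral_mono_ae ?_
      filter_upwards [hfg] with x hx
      rw [hx]
      calc ENNReal.ofReal (g x) = ENNReal.ofReal ((g x + w x) + -w x) := by ring_nf
        _ ≤ _ := ENNReal.ofReal_add_le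
    refine hle.trans_lt ?_
    have hm : AEMeasurable (fun x => ENNReal.ofReal (-w x)) μ :=
      hw.neg.aestronglyMeasurable.aemeasurable.ennreal_ofReal
    rw [lintegral_add_right' _ hm]
    exact ENNReal.add_lt_top.2 ⟨lt_top_iff_ne_top.2 hne, hw'⟩
  have h2 : ∫⁻ x, ENNReal.ofReal (-f x) ∂μ ≠ ⊤ := by
    refine (lt_of_le_of_lt (lintegral_mono_ae ?_) hw.neg.lintegral_lt_top).ne
    filter_upwards [hfg, hg0] with x hx hx0
    rw [hx]
    refine ENNReal.ofReal_le_ofReal ?_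
    simp only [Pi.zero_apply] at hx0
    simp only [Pi.neg_apply]
    linarith
  rw [extIntegral, h1]
  lift (∫⁻ x, ENNReal.ofReal (-f x) ∂μ) to NNReal using h2 with c
  exact EReal.top_sub_coe (c : ℝ)

end Energy

/-! ### The compressibility function -/

/-- The assumptions on the function `h` in the stored energy. -/
structure IsBulkEnergy (h : ℝ → ℝ) : Prop where
  smooth : ContDiffOn ℝ 2 h (Ioi 0)
  nonneg : ∀ d : ℝ, 0 < d → 0 ≤ h d
  convex : ∀ d : ℝ, 0 < d → 0 < deriv (deriv h) d
  zero : Tendsto h (𝓝[>] 0) atTop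
  superlinear : Tendsto (fun d => h d / d) atTop atTop
  deriv_zero : Tendsto (deriv h) (𝓝[>] 0) atBot
  deriv_top : Tendsto (deriv h) atTop atTop

namespace IsBulkEnergy

variable {h : ℝ → ℝ} (H : IsBulkEnergy h)
include H

theorem contDiffOn_deriv : ContDiffOn ℝ 1 (deriv h) (Ioi 0) := by
  have h1 : ContDiffOn ℝ (1 + 1) h (Ioi 0) := by
    have := H.smooth
    norm_num
    exact this
  exact ((contDiffOn_succ_iff_deriv_of_isOpen isOpen_Ioi).1 h1).2.2

theorem hasDerivAt {d : ℝ} (hd : 0 < d) : HasDerivAt h (deriv h d) d :=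
  ((H.smooth.differentiableOn (by norm_num)).differentiableAt (Ioi_mem_nhds hd)).hasDerivAt

theorem hasDerivAt_deriv {d : ℝ} (hd : 0 < d) :
    HasDerivAt (deriv h) (deriv (deriv h) d) d :=
  ((H.contDiffOn_deriv.differentiableOn (by norm_num)).differentiableAt
    (Ioi_mem_nhds hd)).hasDerivAt

theorem continuousOn : ContinuousOn h (Ioi 0) := H.smooth.continuousOn

theorem continuousOn_deriv : ContinuousOn (deriv h) (Ioi 0) := H.contDiffOn_deriv.continuousOn

theorem strictMonoOn_deriv : StrictMonoOn (deriv h) (Ioi 0) :=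
  strictMonoOn_of_deriv_pos (convex_Ioi 0) H.continuousOn_deriv
    (fun d hd => H.convex d (by simpa using hd))

theorem strictConvexOn : StrictConvexOn ℝ (Ioi 0) h := by
  refine StrictMonoOn.strictConvexOn_of_deriv (convex_Ioi 0) H.continuousOn ?_
  rw [interior_Ioi]
  exact H.strictMonoOn_deriv

theorem tangent_le {d e : ℝ} (hd : 0 < d) (he : 0 < e) : h e + deriv h e * (d - e) ≤ h d := by
  have hc := H.strictConvexOn.convexOn
  rcases lt_trichotomy d e with h1 | rfl | h1
  · have := hc.slope_le_of_hasDerivAt (x := d) (y := e) hd he h1 (H.hasDerivAt he)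
    rw [slope_def_field, div_le_iff₀ (by linarith)] at this
    linarith
  · simp
  · have := hc.le_slope_of_hasDerivAt (x := e) (y := d) he hd h1 (H.hasDerivAt he)
    rw [slope_def_field, le_div_iff₀ (by linarith)] at this
    linarith

end IsBulkEnergy

/-- Composition with a function that is continuous only on the positive reals. -/
theorem aestronglyMeasurable_comp_of_pos {F : ℝ → ℝ} {μ : Measure ℝ} {d : ℝ → ℝ}
    (hF : ContinuousOn F (Ioi 0)) (hd : AEStronglyMeasurable d μ) (hpos : ∀ᵐ x ∂μ, 0 < d x) :
    AEStronglyMeasurable (fun x => F (d x)) μ := by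
  classical
  have h1 : Measurable ((Ioi (0 : ℝ)).piecewise F 0) :=
    ContinuousOn.measurable_piecewise hF continuous_zero.continuousOn measurableSet_Ioi
  refine (h1.comp_aemeasurable hd.aemeasurable).aestronglyMeasurable.congr ?_
  filter_upwards [hpos] with x hx
  exact piecewise_eq_of_mem (Ioi (0 : ℝ)) F 0 (show d x ∈ Ioi 0 from hx)

/-! ### The reduced variational problem -/

section Reduced

/-- The competitors of finite energy in the reduced problem: positive integrable functions `d`, the
Jacobian determinants, whose volume coordinate is nonnegative at `ε`. -/
structure FiniteEnergy (n : ℕ) (κ : ℝ) (h : ℝ → ℝ) (ε L : ℝ) (d : ℝ → ℝ) : Prop where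
  integrableOn : IntegrableOn d (Ioo ε 1)
  pos : ∀ᵐ R ∂(volume.restrict (Ioo ε 1)), 0 < d R
  bdry_nonneg : 0 ≤ vol n L d ε
  energy : IntegrableOn (fun R => dens n κ h R (vol n L d R) (d R)) (Ioo ε 1)

/-- The convex part of the reduced energy. -/
noncomputable def bulkEnergy (n : ℕ) (κ : ℝ) (h : ℝ → ℝ) (ε L : ℝ) (d : ℝ → ℝ) : ℝ :=
  ∫ R in Ioo ε 1, dens n κ h R (vol n L d R) (d R)

/-- The reduced energy. -/
noncomputable def redEnergy (n : ℕ) (κ : ℝ) (h : ℝ → ℝ) (ε L : ℝ) (d : ℝ → ℝ) : ℝ :=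
  bulkEnergy n κ h ε L d - bdry n κ ε (vol n L d ε)

/-- `d` minimises the reduced energy among the competitors with `u(ε) ∈ K`. -/
structure IsRedMin (n : ℕ) (κ : ℝ) (h : ℝ → ℝ) (ε L : ℝ) (K : Set ℝ) (d : ℝ → ℝ) : Prop where
  finiteEnergy : FiniteEnergy n κ h ε L d
  mem : vol n L d ε ∈ K
  le : ∀ d', FiniteEnergy n κ h ε L d' → vol n L d' ε ∈ K →
    redEnergy n κ h ε L d ≤ redEnergy n κ h ε L d'

variable {n : ℕ} {κ ε L lam : ℝ} {h : ℝ → ℝ} {d d' : ℝ → ℝ}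

theorem dens_nonneg (hn : 2 ≤ n) (hκ : 0 < κ) (H : IsBulkEnergy h) {R u d : ℝ} (hR : 0 < R)
    (hu : 0 ≤ u) (hd : 0 < d) : 0 ≤ dens n κ h R u d := by
  have h1 := H.nonneg d hd
  have h2 : (0 : ℝ) ≤ n - 1 := by
    have : (2 : ℝ) ≤ n := by exact_mod_cast hn
    linarith
  unfold dens
  positivity

theorem aestronglyMeasurable_dens (H : IsBulkEnergy h) {u : ℝ → ℝ}
    (hu : AEStronglyMeasurable u (volume.restrict (Ioo ε 1)))
    (hd : AEStronglyMeasurable d (volume.restrict (Ioo ε 1)))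
    (hpos : ∀ᵐ R ∂(volume.restrict (Ioo ε 1)), 0 < d R) :
    AEStronglyMeasurable (fun R => dens n κ h R (u R) (d R)) (volume.restrict (Ioo ε 1)) := by
  have h1 := aestronglyMeasurable_comp_of_pos H.continuousOn hd hpos
  have hu' := hu.aemeasurable
  have hd' := hd.aemeasurable
  have h1' := h1.aemeasurable
  have key : ∀ g : ℝ → ℝ, AEMeasurable g (volume.restrict (Ioo ε 1)) →
      AEMeasurable (fun R => R ^ (n - 1) * (κ / n * (d R ^ n * (R ^ n / u R) ^ (n - 1)
        + (n - 1) * (u R / R ^ n)) + g R)) (volume.restrict (Ioo ε 1)) := by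
    intro g hg
    fun_prop
  exact (key _ h1').aestronglyMeasurable

theorem dens_congr (h : d =ᵐ[volume.restrict (Ioo ε 1)] d') {κ : ℝ} {h : ℝ → ℝ} :
    (fun R => dens n κ h R (vol n L d R) (d R)) =ᵐ[volume.restrict (Ioo ε 1)]
      fun R => dens n κ h R (vol n L d' R) (d' R) := by
  rename_i hdd
  filter_upwards [hdd, ae_restrict_mem measurableSet_Ioo] with R h1 hR
  rw [h1, vol_congr hdd (Ioo_subset_Icc_self hR)]

theorem FiniteEnergy.congr (hε1 : ε < 1) (hd : FiniteEnergy n κ h ε L d)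
    (hdd : d =ᵐ[volume.restrict (Ioo ε 1)] d') : FiniteEnergy n κ h ε L d' := by
  refine ⟨hd.integrableOn.congr hdd, ?_, ?_, hd.energy.congr (dens_congr hdd)⟩
  · filter_upwards [hd.pos, hdd] with R h1 h2
    rwa [← h2]
  · rw [← vol_congr hdd ⟨le_rfl, hε1.le⟩]
    exact hd.bdry_nonneg

theorem redEnergy_congr (hε1 : ε < 1) (hdd : d =ᵐ[volume.restrict (Ioo ε 1)] d') :
    redEnergy n κ h ε L d = redEnergy n κ h ε L d' := by
  unfold redEnergy bulkEnergy
  rw [integral_congr_ae (dens_congr hdd), vol_congr hdd ⟨le_rfl, hε1.le⟩]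

/-- A constant Jacobian determinant has finite energy if the cavity is nondegenerate. -/
theorem finiteEnergy_const (hn : 2 ≤ n) (hε : 0 < ε) (hε1 : ε < 1) {c : ℝ}
    (hc : 0 < c) (hL : 0 < L - c * (1 - ε ^ n)) :
    FiniteEnergy n κ h ε L (fun _ => c) ∧
      ∀ R, vol n L (fun _ => c) R = L - c * (1 - R ^ n) := by
  have hn0 : (n : ℝ) ≠ 0 := by exact_mod_cast (by omega : n ≠ 0)
  have hvol : ∀ R, vol n L (fun _ => c) R = L - c * (1 - R ^ n) := by
    intro R
    unfold vol
    rw [intervalIntegral.integral_mul_const, intervalIntegral.integral_const_mul, integral_pow]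
    have h1 : n - 1 + 1 = n := by omega
    have h2 : ((n - 1 : ℕ) : ℝ) + 1 = n := by exact_mod_cast h1
    rw [h1, h2]
    field_simp
    simp only [one_pow]
    ring
  refine ⟨⟨integrableOn_const (by simp), Eventually.of_forall fun _ => hc, ?_, ?_⟩, hvol⟩
  · rw [hvol]; exact hL.le
  · refine IntegrableOn.mono_set (t := Icc ε 1) (ContinuousOn.integrableOn_Icc ?_)
      Ioo_subset_Icc_self
    simp_rw [hvol]
    unfold dens
    have h1 : ∀ R ∈ Icc ε 1, L - c * (1 - R ^ n) ≠ 0 := by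
      intro R hR
      have : ε ^ n ≤ R ^ n := pow_le_pow_left₀ hε.le hR.1 n
      nlinarith
    have h2 : ∀ R ∈ Icc ε 1, R ^ n ≠ 0 := fun R hR => (pow_pos (hε.trans_le hR.1) n).ne'
    have h3 : ContinuousOn (fun R : ℝ => R ^ n / (L - c * (1 - R ^ n))) (Icc ε 1) :=
      ContinuousOn.div (by fun_prop) (by fun_prop) h1
    have h4 : ContinuousOn (fun R : ℝ => (L - c * (1 - R ^ n)) / R ^ n) (Icc ε 1) :=
      ContinuousOn.div (by fun_prop) (by fun_prop) h2
    fun_prop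

theorem exists_finiteEnergy (hn : 2 ≤ n) (hε : 0 < ε) (hε1 : ε < 1) {x : ℝ}
    (hx : x ∈ Ioo 0 L) : ∃ d, FiniteEnergy n κ h ε L d ∧ vol n L d ε = x := by
  have h1 : ε ^ n < 1 := pow_lt_one₀ hε.le hε1 (by omega)
  have h2 : (L - x) / (1 - ε ^ n) * (1 - ε ^ n) = L - x :=
    div_mul_cancel₀ _ (by linarith)
  obtain ⟨h3, h4⟩ := finiteEnergy_const (κ := κ) (h := h) hn hε hε1
    (c := (L - x) / (1 - ε ^ n)) (L := L)
    (div_pos (by linarith [hx.2]) (by linarith)) (by rw [h2]; linarith [hx.1])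
  exact ⟨_, h3, by rw [h4, h2]; ring⟩

theorem bdry_pow (hn : 2 ≤ n) {x : ℝ} :
    bdry n κ ε (x ^ n) = κ * (n - 1) / n * (x ^ n * Real.log (x / ε)) := by
  have hn0 : (n : ℝ) ≠ 0 := by exact_mod_cast (by omega : n ≠ 0)
  unfold bdry
  rw [← div_pow, Real.log_pow]
  field_simp

variable [n.AtLeastTwo]

theorem two_le_of_atLeastTwo : 2 ≤ n := Nat.AtLeastTwo.prop

/-- The modified energy of an admissible deformation is the reduced energy of its Jacobian
determinant. -/
theorem modEnergy_eq (hκ : 0 < κ) (hε : 0 < ε) (hε1 : ε < 1) (H : IsBulkEnergy h)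
    {r : ℝ → ℝ} (hr : r ∈ admissible ε lam) :
    (FiniteEnergy n κ h ε (lam ^ n) (jac n ε r) →
      modEnergy n κ h ε lam r = (redEnergy n κ h ε (lam ^ n) (jac n ε r) : ℝ)) ∧
    (¬ FiniteEnergy n κ h ε (lam ^ n) (jac n ε r) → modEnergy n κ h ε lam r = ⊤) := by
  have hn : 2 ≤ n := two_le_of_atLeastTwo
  have hw := (isPrim_pow_mul_log hn hε hε1 hr).const_mul (κ * (n - 1) / n)
  have hvol := vol_jac (n := n) hε hε1 hr
  have heq : (fun R => R ^ (n - 1) * modPhi n κ h (stretches n (weakDeriv ε 1 r R) (r R / R)))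
      =ᵐ[volume.restrict (Ioo ε 1)] fun R =>
        dens n κ h R (vol n (lam ^ n) (jac n ε r) R) (jac n ε r R) + κ * (n - 1) / n *
      ((n * r R ^ (n - 1) * Real.log (r R / R) + r R ^ (n - 1)) * weakDeriv ε 1 r R
        - r R ^ n / R) := by
    filter_upwards [ae_restrict_mem measurableSet_Ioo] with R hR
    rw [modPhi_stretches, dens_add_eq hn (hε.trans hR.1)
      (pos_of_admissible hε1 hr ⟨hR.1, hR.2.le⟩), hvol (Ioo_subset_Icc_self hR)]
    rfl
  have hε' : ε ∈ Icc ε 1 := ⟨le_rfl, hε1.le⟩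
  have hb0 : 0 ≤ vol n (lam ^ n) (jac n ε r) ε := by
    rw [hvol hε']
    exact pow_nonneg hr.2.2.2.2 n
  have hint := integrableOn_jac (n := n) hε hε1 hr
  have hpos := jac_pos (n := n) hε hε1 hr
  constructor
  · intro hfe
    have hi : Integrable (fun R => R ^ (n - 1) *
        modPhi n κ h (stretches n (weakDeriv ε 1 r R) (r R / R))) (volume.restrict (Ioo ε 1)) :=
      (hfe.energy.add hw.integrableOn).congr heq.symm
    rw [modEnergy, extIntegral_of_integrable hi, integral_congr_ae heq,
      integral_add hfe.energy hw.integrableOn, hw.setIntegral_eq hε1.le, ← EReal.coe_sub, redEnergy,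
      hvol hε', bdry_pow hn, bulkEnergy, hr.2.2.1, div_one]
    congr 1
    ring
  · intro hfe
    rw [modEnergy, extIntegral_add_eq_top heq ?_ ?_ ?_ hw.integrableOn, EReal.top_sub_coe]
    · exact aestronglyMeasurable_dens H (((continuousOn_vol hε1 hint).mono
        Ioo_subset_Icc_self).aestronglyMeasurable measurableSet_Ioo) hint.aestronglyMeasurable hpos
    · filter_upwards [hpos, ae_restrict_mem measurableSet_Ioo] with R h1 hR
      exact dens_nonneg hn hκ H (hε.trans hR.1)
        (vol_nonneg hn hε hε1 hint hpos hb0 (Ioo_subset_Icc_self hR)) h1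
    · exact fun hE => hfe ⟨hint, hpos, hb0, hE⟩

theorem modEnergy_defOfJac (hκ : 0 < κ) (hε : 0 < ε) (hε1 : ε < 1) (hlam : 0 < lam)
    (H : IsBulkEnergy h) (hd : FiniteEnergy n κ h ε (lam ^ n) d) :
    modEnergy n κ h ε lam (defOfJac n (lam ^ n) d) = (redEnergy n κ h ε (lam ^ n) d : ℝ) := by
  have hn : 2 ≤ n := two_le_of_atLeastTwo
  have h1 := jac_defOfJac hn hε hε1 hd.integrableOn hd.pos hd.bdry_nonneg
  rw [(modEnergy_eq hκ hε hε1 H (defOfJac_mem_admissible hn hε hε1 hlam hd.integrableOn hd.pos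
    hd.bdry_nonneg)).1 (hd.congr hε1 h1.symm), redEnergy_congr hε1 h1]

theorem IsGlobalMinimizer.isRedMin (hκ : 0 < κ) (hε : 0 < ε) (hε1 : ε < 1) (hlam : 0 < lam)
    (H : IsBulkEnergy h) {r : ℝ → ℝ} (hr : IsGlobalMinimizer n κ h ε lam r) :
    IsRedMin n κ h ε (lam ^ n) univ (jac n ε r) := by
  have hn : 2 ≤ n := two_le_of_atLeastTwo
  have key : ∀ d', FiniteEnergy n κ h ε (lam ^ n) d' →
      modEnergy n κ h ε lam r ≤ (redEnergy n κ h ε (lam ^ n) d' : ℝ) := by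
    intro d' hd'
    rw [← modEnergy_defOfJac hκ hε hε1 hlam H hd']
    exact hr.2 (defOfJac_mem_admissible hn hε hε1 hlam hd'.integrableOn hd'.pos hd'.bdry_nonneg)
  have hfe : FiniteEnergy n κ h ε (lam ^ n) (jac n ε r) := by
    by_contra hne
    have hpos : 0 < lam ^ n := pow_pos hlam n
    obtain ⟨d', hd', -⟩ := exists_finiteEnergy (κ := κ) (h := h) hn hε hε1 (x := lam ^ n / 2)
      (L := lam ^ n) ⟨by linarith, by linarith⟩
    have h1 := key d' hd'
    rw [(modEnergy_eq hκ hε hε1 H hr.1).2 hne] at h1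
    exact EReal.coe_ne_top _ (top_le_iff.1 h1)
  refine ⟨hfe, mem_univ _, fun d' hd' _ => ?_⟩
  have h1 := key d' hd'
  rw [(modEnergy_eq hκ hε hε1 H hr.1).1 hfe] at h1
  exact EReal.coe_le_coe_iff.1 h1

theorem IsRedMin.isGlobalMinimizer (hκ : 0 < κ) (hε : 0 < ε) (hε1 : ε < 1) (hlam : 0 < lam)
    (H : IsBulkEnergy h) (hd : IsRedMin n κ h ε (lam ^ n) univ d) :
    IsGlobalMinimizer n κ h ε lam (defOfJac n (lam ^ n) d) := by
  have hn : 2 ≤ n := two_le_of_atLeastTwo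
  have hfe := hd.finiteEnergy
  refine ⟨defOfJac_mem_admissible hn hε hε1 hlam hfe.integrableOn hfe.pos hfe.bdry_nonneg,
    fun r hr => ?_⟩
  change modEnergy n κ h ε lam _ ≤ modEnergy n κ h ε lam r
  rw [modEnergy_defOfJac hκ hε hε1 hlam H hfe]
  by_cases hfr : FiniteEnergy n κ h ε (lam ^ n) (jac n ε r)
  · rw [(modEnergy_eq hκ hε hε1 H hr).1 hfr, EReal.coe_le_coe_iff]
    exact hd.le _ hfr (mem_univ _)
  · rw [(modEnergy_eq hκ hε hε1 H hr).2 hfr]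
    exact le_top

end Reduced

/-! ### Convexity -/

section Convexity

/-- Young's inequality `n a b^{n-1} ≤ a^n + (n-1) b^n` with `n = m + 1`. -/
theorem young_pow (m : ℕ) {a b : ℝ} (ha : 0 ≤ a) (hb : 0 ≤ b) :
    (m + 1) * a * b ^ m ≤ a ^ (m + 1) + m * b ^ (m + 1) := by
  induction m with
  | zero => simp
  | succ m ih =>
    have h1 := mul_le_mul_of_nonneg_left ih ha
    have h2 : 0 ≤ (m + 1) * b ^ m * (a - b) ^ 2 := by positivity
    push_cast
    have h3 : a ^ (m + 1 + 1) + (m + 1) * b ^ (m + 1 + 1) - (m + 1 + 1) * a * b ^ (m + 1) =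
      a * (a ^ (m + 1) + m * b ^ (m + 1)) - a * ((m + 1) * a * b ^ m) +
        (m + 1) * b ^ m * (a - b) ^ 2 := by ring
    linarith

/-- A Bernoulli inequality with quadratic remainder. -/
theorem bernoulli_quadratic {n : ℕ} (hn : 2 ≤ n) {p : ℝ} (hp : 0 ≤ p) :
    n * p + (n - 1) * (p - 1) ^ 2 ≤ p ^ n + (n - 1) := by
  obtain ⟨m, rfl⟩ : ∃ m, n = m + 2 := ⟨n - 2, by omega⟩
  have h1 := mul_le_mul_of_nonneg_left (young_pow m hp zero_le_one) hp
  have h2 : p ^ (m + 2) = p * p ^ (m + 1) := by ring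
  push_cast
  simp only [one_pow, mul_one] at h1
  nlinarith

/-- The supporting planes of the perspective function `(d, y) ↦ d^n / y^{n-1}`. -/
theorem perspective_ge (m : ℕ) {X u d p : ℝ} (hX : 0 < X) (hu : 0 < u) (hd : 0 ≤ d) (hp : 0 ≤ p) :
    (m + 1) * p ^ m * d - m * p ^ (m + 1) * (u / X) ≤ d ^ (m + 1) * (X / u) ^ m := by
  have h1 := young_pow m (a := d * (X / u)) (b := p) (by positivity) hp
  have h2 := mul_le_mul_of_nonneg_right h1 (show 0 ≤ u / X by positivity)
  have h3 : (d * (X / u)) ^ (m + 1) * (u / X) = d ^ (m + 1) * (X / u) ^ m := by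
    rw [mul_pow, pow_succ (X / u)]
    field_simp
  have h4 : (m + 1) * (d * (X / u)) * p ^ m * (u / X) = (m + 1) * p ^ m * d := by
    field_simp
  rw [h4, add_mul _ _ (u / X), h3] at h2
  linarith

theorem perspective_eq (m : ℕ) {X u d : ℝ} (hX : 0 < X) (hu : 0 < u) :
    d ^ (m + 1) * (X / u) ^ m = (m + 1) * (d * (X / u)) ^ m * d
      - m * (d * (X / u)) ^ (m + 1) * (u / X) := by
  rw [mul_pow, mul_pow, pow_succ (X / u)]
  field_simp
  ring

variable {n : ℕ} {κ ε L : ℝ} {h : ℝ → ℝ}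

/-- Joint convexity of the density, with the convexity defect of `h` as a remainder. -/
theorem dens_convex (hn : 2 ≤ n) (hκ : 0 < κ) {R u₁ u₂ d₁ d₂ s : ℝ} (hR : 0 < R) (hu₁ : 0 < u₁)
    (hu₂ : 0 < u₂) (hd₁ : 0 < d₁) (hd₂ : 0 < d₂) (hs0 : 0 ≤ s) (hs1 : s ≤ 1) :
    dens n κ h R ((1 - s) * u₁ + s * u₂) ((1 - s) * d₁ + s * d₂) +
      R ^ (n - 1) * ((1 - s) * h d₁ + s * h d₂ - h ((1 - s) * d₁ + s * d₂)) ≤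
    (1 - s) * dens n κ h R u₁ d₁ + s * dens n κ h R u₂ d₂ := by
  obtain ⟨m, rfl⟩ : ∃ m, n = m + 1 := ⟨n - 1, by omega⟩
  have hs1' : 0 ≤ 1 - s := by linarith
  have hX : 0 < R ^ (m + 1) := by positivity
  have hu : 0 < (1 - s) * u₁ + s * u₂ := by
    rcases hs0.eq_or_lt with rfl | h0
    · simpa
    · have := mul_nonneg hs1' hu₁.le
      have := mul_pos h0 hu₂
      linarith
  have hd : 0 ≤ (1 - s) * d₁ + s * d₂ := by positivity
  set u := (1 - s) * u₁ + s * u₂ with hu_def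
  set d := (1 - s) * d₁ + s * d₂ with hd_def
  set X := R ^ (m + 1) with hX_def
  have hp : 0 ≤ d * (X / u) := by positivity
  have e1 := mul_le_mul_of_nonneg_left (perspective_ge m hX hu₁ hd₁.le hp) hs1'
  have e2 := mul_le_mul_of_nonneg_left (perspective_ge m hX hu₂ hd₂.le hp) hs0
  have e3 := perspective_eq m (d := d) hX hu
  generalize d * (X / u) = p at e1 e2 e3
  have e4 : d ^ (m + 1) * (X / u) ^ m ≤
      (1 - s) * (d₁ ^ (m + 1) * (X / u₁) ^ m) + s * (d₂ ^ (m + 1) * (X / u₂) ^ m) := by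
    refine (le_of_eq ?_).trans (add_le_add e1 e2)
    rw [e3, hu_def]
    rw [hd_def]
    ring
  have hc : 0 ≤ R ^ m * (κ / ((m + 1 : ℕ) : ℝ)) := by positivity
  have e5 := mul_le_mul_of_nonneg_left e4 hc
  have e6 : u / X = (1 - s) * (u₁ / X) + s * (u₂ / X) := by rw [hu_def]; ring
  simp only [dens, ← hX_def, Nat.add_sub_cancel]
  rw [e6]
  linarith

namespace IsBulkEnergy

theorem gap_nonneg (H : IsBulkEnergy h) {x y s : ℝ} (hx : 0 < x) (hy : 0 < y) (hs0 : 0 ≤ s)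
    (hs1 : s ≤ 1) : 0 ≤ (1 - s) * h x + s * h y - h ((1 - s) * x + s * y) := by
  have := H.strictConvexOn.convexOn.2 hx hy (show 0 ≤ 1 - s by linarith) hs0 (by ring)
  simp only [smul_eq_mul] at this
  linarith

theorem gap_pos (H : IsBulkEnergy h) {x y s : ℝ} (hx : 0 < x) (hy : 0 < y) (hxy : x ≠ y)
    (hs0 : 0 < s) (hs1 : s < 1) : 0 < (1 - s) * h x + s * h y - h ((1 - s) * x + s * y) := by
  have := H.strictConvexOn.2 hx hy hxy (show 0 < 1 - s by linarith) hs0 (by ring)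
  simp only [smul_eq_mul] at this
  linarith

/-- Uniform strict convexity modulo large values of `h`: the distance of two points is controlled
by the midpoint convexity defect of `h`, up to an arbitrarily small multiple of `h` itself. -/
theorem dist_le_gap (H : IsBulkEnergy h) {δ : ℝ} (hδ : 0 < δ) :
    ∃ K : ℝ, 0 ≤ K ∧ ∀ x y : ℝ, 0 < x → 0 < y →
      |x - y| ≤ δ * (1 + h x + h y) +
        K * ((1 - 1 / 2) * h x + 1 / 2 * h y - h ((1 - 1 / 2) * x + 1 / 2 * y)) := by
  -- for values above `β` or below `α`, the distance is absorbed by `δ * h`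
  obtain ⟨β, hβ0, hβ⟩ : ∃ β : ℝ, 0 < β ∧ ∀ x, β ≤ x → x ≤ δ * h x := by
    obtain ⟨b, hb⟩ := eventually_atTop.1 (H.superlinear.eventually_ge_atTop (1 / δ))
    refine ⟨max b 1, by positivity, fun x hx => ?_⟩
    have hx0 : 0 < x := by linarith [le_max_right b 1]
    have h1 := hb x ((le_max_left b 1).trans hx)
    rw [div_le_div_iff₀ hδ hx0] at h1
    linarith
  obtain ⟨α, hα0, hα⟩ : ∃ α : ℝ, 0 < α ∧ ∀ x, 0 < x → x < α → β ≤ δ * h x := by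
    have h1 := H.zero.eventually_ge_atTop (β / δ)
    rw [eventually_nhdsWithin_iff, Metric.eventually_nhds_iff] at h1
    obtain ⟨α, hα0, hα⟩ := h1
    refine ⟨α, hα0, fun x hx hxα => ?_⟩
    have h2 := hα (y := x) (by rw [Real.dist_eq, sub_zero, abs_of_pos hx]; exact hxα) hx
    rw [div_le_iff₀ hδ] at h2
    linarith
  let gap : ℝ × ℝ → ℝ := fun z =>
    (1 - 1 / 2) * h z.1 + 1 / 2 * h z.2 - h ((1 - 1 / 2) * z.1 + 1 / 2 * z.2)
  let C : Set (ℝ × ℝ) := (Icc α β ×ˢ Icc α β) ∩ {z | δ ≤ |z.1 - z.2|}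
  have hC : IsCompact C := (isCompact_Icc.prod isCompact_Icc).inter_right
    (isClosed_le continuous_const (by fun_prop))
  have hgap : ContinuousOn gap C := by
    have hc := H.continuousOn
    have h1 : ContinuousOn (fun z : ℝ × ℝ => h z.1) C :=
      hc.comp continuous_fst.continuousOn fun z hz => hα0.trans_le hz.1.1.1
    have h2 : ContinuousOn (fun z : ℝ × ℝ => h z.2) C :=
      hc.comp continuous_snd.continuousOn fun z hz => hα0.trans_le hz.1.2.1
    have h3 : ContinuousOn (fun z : ℝ × ℝ => h ((1 - 1 / 2) * z.1 + 1 / 2 * z.2)) C := by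
      refine hc.comp (by fun_prop) fun z hz => ?_
      have h4 := hα0.trans_le hz.1.1.1
      have h5 := hα0.trans_le hz.1.2.1
      simp only [mem_Ioi]
      linarith
    exact ((continuousOn_const.mul h1).add (continuousOn_const.mul h2)).sub h3
  -- on the compact set that remains, the convexity defect is bounded below
  obtain ⟨c, hc0, hc⟩ : ∃ c : ℝ, 0 < c ∧ ∀ z ∈ C, c ≤ gap z := by
    rcases C.eq_empty_or_nonempty with hemp | hne
    · exact ⟨1, one_pos, by simp [hemp]⟩
    · obtain ⟨z, hz, hmin⟩ := hC.exists_isMinOn hne hgap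
      refine ⟨gap z, ?_, fun w hw => hmin hw⟩
      refine H.gap_pos (hα0.trans_le hz.1.1.1) (hα0.trans_le hz.1.2.1) ?_ (by norm_num)
        (by norm_num)
      intro heq
      have := hz.2
      simp only [mem_ofPred_eq, heq, sub_self, abs_zero] at this
      linarith
  refine ⟨β / c, by positivity, fun x y hx hy => ?_⟩
  have hg := H.gap_nonneg hx hy (s := 1 / 2) (by norm_num) (by norm_num)
  have hKg : 0 ≤ β / c * ((1 - 1 / 2) * h x + 1 / 2 * h y - h ((1 - 1 / 2) * x + 1 / 2 * y)) :=
    mul_nonneg (by positivity) hg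
  have hhx := mul_nonneg hδ.le (H.nonneg x hx)
  have hhy := mul_nonneg hδ.le (H.nonneg y hy)
  rw [mul_add, mul_add, mul_one]
  rcases le_or_gt β x with hxb | hxb
  · have h1 := hβ x hxb
    rcases le_or_gt y x with h2 | h2
    · rw [abs_of_nonneg (by linarith)]; linarith
    · have h3 := hβ y (by linarith)
      rw [abs_of_neg (by linarith)]; linarith
  rcases le_or_gt β y with hyb | hyb
  · have h1 := hβ y hyb
    rw [abs_of_neg (by linarith)]; linarith
  have hdist : |x - y| ≤ β := abs_le.2 ⟨by linarith, by linarith⟩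
  rcases lt_or_ge x α with hxa | hxa
  · have := hα x hx hxa
    linarith
  rcases lt_or_ge y α with hya | hya
  · have := hα y hy hya
    linarith
  rcases lt_or_ge |x - y| δ with hlt | hge
  · linarith
  · have h1 := hc (x, y) ⟨⟨⟨hxa, hxb.le⟩, ⟨hya, hyb.le⟩⟩, hge⟩
    have h2 : β ≤ β / c * gap (x, y) := by
      rw [div_mul_eq_mul_div, le_div_iff₀ hc0]
      exact mul_le_mul_of_nonneg_left h1 hβ0.le
    simp only [gap] at h2
    linarith

end IsBulkEnergy

variable {d₁ d₂ : ℝ → ℝ}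

theorem vol_comb (hε1 : ε < 1) (h₁ : IntegrableOn d₁ (Ioo ε 1)) (h₂ : IntegrableOn d₂ (Ioo ε 1))
    {L₁ L₂ : ℝ} (a b : ℝ) {R : ℝ} (hR : R ∈ Icc ε 1) :
    vol n (a * L₁ + b * L₂) (fun x => a * d₁ x + b * d₂ x) R =
      a * vol n L₁ d₁ R + b * vol n L₂ d₂ R := by
  have i1 := (isPrim_vol (n := n) (L := 0) h₁).intervalIntegrable hε1.le hR ⟨hε1.le, le_rfl⟩
  have i2 := (isPrim_vol (n := n) (L := 0) h₂).intervalIntegrable hε1.le hR ⟨hε1.le, le_rfl⟩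
  unfold vol
  have e : ∀ S : ℝ, (n : ℝ) * S ^ (n - 1) * (a * d₁ S + b * d₂ S) =
      a * (n * S ^ (n - 1) * d₁ S) + b * (n * S ^ (n - 1) * d₂ S) := fun S => by ring
  simp_rw [e]
  rw [intervalIntegral.integral_add (i1.const_mul a) (i2.const_mul b),
    intervalIntegral.integral_const_mul, intervalIntegral.integral_const_mul]
  ring

theorem FiniteEnergy.vol_convexComb (hε1 : ε < 1) (h₁ : FiniteEnergy n κ h ε L d₁)
    (h₂ : FiniteEnergy n κ h ε L d₂) (s : ℝ) {R : ℝ} (hR : R ∈ Icc ε 1) :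
    vol n L (fun x => (1 - s) * d₁ x + s * d₂ x) R =
      (1 - s) * vol n L d₁ R + s * vol n L d₂ R := by
  rw [← vol_comb hε1 h₁.integrableOn h₂.integrableOn _ _ hR]
  congr 1
  ring

/-- The bulk energy is convex, with the integrated convexity defect of `h` as a remainder. -/
theorem FiniteEnergy.convexComb (hn : 2 ≤ n) (hκ : 0 < κ) (hε : 0 < ε) (hε1 : ε < 1)
    (H : IsBulkEnergy h) (h₁ : FiniteEnergy n κ h ε L d₁) (h₂ : FiniteEnergy n κ h ε L d₂) {s : ℝ}
    (hs0 : 0 ≤ s) (hs1 : s ≤ 1) :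
    FiniteEnergy n κ h ε L (fun x => (1 - s) * d₁ x + s * d₂ x) ∧
    IntegrableOn (fun R => R ^ (n - 1) * ((1 - s) * h (d₁ R) + s * h (d₂ R) -
      h ((1 - s) * d₁ R + s * d₂ R))) (Ioo ε 1) ∧
    bulkEnergy n κ h ε L (fun x => (1 - s) * d₁ x + s * d₂ x) +
      ∫ R in Ioo ε 1, R ^ (n - 1) * ((1 - s) * h (d₁ R) + s * h (d₂ R) -
        h ((1 - s) * d₁ R + s * d₂ R)) ≤
      (1 - s) * bulkEnergy n κ h ε L d₁ + s * bulkEnergy n κ h ε L d₂ := by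
  have hs1' : 0 ≤ 1 - s := by linarith
  set d := fun x => (1 - s) * d₁ x + s * d₂ x with hd_def
  have hvol : ∀ R ∈ Icc ε 1, vol n L d R = (1 - s) * vol n L d₁ R + s * vol n L d₂ R :=
    fun R hR => h₁.vol_convexComb hε1 h₂ s hR
  have hint : IntegrableOn d (Ioo ε 1) :=
    (h₁.integrableOn.const_mul (1 - s)).add (h₂.integrableOn.const_mul s)
  have hpos : ∀ᵐ R ∂(volume.restrict (Ioo ε 1)), 0 < d R := by
    filter_upwards [h₁.pos, h₂.pos] with R p1 p2
    rcases hs0.eq_or_lt with rfl | h0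
    · simpa [hd_def] using p1
    · have := mul_nonneg hs1' p1.le
      have := mul_pos h0 p2
      simp only [hd_def]
      linarith
  have hb : 0 ≤ vol n L d ε := by
    rw [hvol ε ⟨le_rfl, hε1.le⟩]
    exact add_nonneg (mul_nonneg hs1' h₁.bdry_nonneg) (mul_nonneg hs0 h₂.bdry_nonneg)
  set gap := fun R : ℝ => R ^ (n - 1) * ((1 - s) * h (d₁ R) + s * h (d₂ R) -
      h ((1 - s) * d₁ R + s * d₂ R)) with hgap_def
  have hgap0 : ∀ᵐ R ∂(volume.restrict (Ioo ε 1)), 0 ≤ gap R := by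
    filter_upwards [h₁.pos, h₂.pos, ae_restrict_mem measurableSet_Ioo] with R p1 p2 hR
    exact mul_nonneg (pow_nonneg (hε.trans hR.1).le _) (H.gap_nonneg p1 p2 hs0 hs1)
  have hdens0 : ∀ᵐ R ∂(volume.restrict (Ioo ε 1)), 0 ≤ dens n κ h R (vol n L d R) (d R) := by
    filter_upwards [hpos, ae_restrict_mem measurableSet_Ioo] with R p hR
    exact dens_nonneg hn hκ H (hε.trans hR.1)
      (vol_nonneg hn hε hε1 hint hpos hb (Ioo_subset_Icc_self hR)) p
  have hle : ∀ᵐ R ∂(volume.restrict (Ioo ε 1)), dens n κ h R (vol n L d R) (d R) + gap R ≤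
      (1 - s) * dens n κ h R (vol n L d₁ R) (d₁ R) + s * dens n κ h R (vol n L d₂ R) (d₂ R) := by
    filter_upwards [h₁.pos, h₂.pos, ae_restrict_mem measurableSet_Ioo] with R p1 p2 hR
    rw [hvol R (Ioo_subset_Icc_self hR)]
    exact dens_convex hn hκ (hε.trans hR.1)
      (vol_pos hn hε hε1 h₁.integrableOn h₁.pos h₁.bdry_nonneg ⟨hR.1, hR.2.le⟩)
      (vol_pos hn hε hε1 h₂.integrableOn h₂.pos h₂.bdry_nonneg ⟨hR.1, hR.2.le⟩) p1 p2 hs0 hs1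
  have hI := (h₁.energy.const_mul (1 - s)).add (h₂.energy.const_mul s)
  have hdm : AEStronglyMeasurable (fun R => dens n κ h R (vol n L d R) (d R))
      (volume.restrict (Ioo ε 1)) :=
    aestronglyMeasurable_dens H (((continuousOn_vol hε1 hint).mono
      Ioo_subset_Icc_self).aestronglyMeasurable measurableSet_Ioo) hint.aestronglyMeasurable hpos
  have hgm : AEStronglyMeasurable gap (volume.restrict (Ioo ε 1)) := by
    have m1 := aestronglyMeasurable_comp_of_pos H.continuousOn h₁.integrableOn.aestronglyMeasurable
      h₁.pos
    have m2 := aestronglyMeasurable_comp_of_pos H.continuousOn h₂.integrableOn.aestronglyMeasurable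
      h₂.pos
    have m3 := aestronglyMeasurable_comp_of_pos H.continuousOn hint.aestronglyMeasurable hpos
    exact (continuous_pow (n - 1)).aestronglyMeasurable.mul
      (((m1.const_mul (1 - s)).add (m2.const_mul s)).sub m3)
  have hdi : IntegrableOn (fun R => dens n κ h R (vol n L d R) (d R)) (Ioo ε 1) := by
    refine Integrable.mono' hI hdm ?_
    filter_upwards [hdens0, hgap0, hle] with R r1 r2 r3
    rw [Real.norm_of_nonneg r1]
    exact (by linarith : _ ≤ _ + gap R).trans r3
  have hgi : IntegrableOn gap (Ioo ε 1) := by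
    refine Integrable.mono' hI hgm ?_
    filter_upwards [hdens0, hgap0, hle] with R r1 r2 r3
    rw [Real.norm_of_nonneg r2]
    exact (by linarith : gap R ≤ _ + gap R).trans r3
  refine ⟨⟨hint, hpos, hb, hdi⟩, hgi, ?_⟩
  have h3 := integral_mono_ae (hdi.add hgi) hI hle
  unfold bulkEnergy
  rw [← integral_add hdi hgi, ← integral_const_mul, ← integral_const_mul, ← integral_add
    (h₁.energy.const_mul (1 - s)) (h₂.energy.const_mul s)]
  exact h3

end Convexity

/-! ### Existence of minimisers -/

section Existence

/-- Completeness of `L¹`, stated for functions, together with almost everywhere convergence of a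
subsequence. -/
theorem exists_tendsto_of_cauchy_integral {α : Type*} [MeasurableSpace α] {μ : Measure α}
    {D : ℕ → α → ℝ} (hD : ∀ k, Integrable (D k) μ)
    (hC : ∀ η : ℝ, 0 < η → ∃ N, ∀ k ≥ N, ∀ l ≥ N, ∫ x, |D k x - D l x| ∂μ < η) :
    ∃ d : α → ℝ, Integrable d μ ∧ Tendsto (fun k => ∫ x, |D k x - d x| ∂μ) atTop (𝓝 0) ∧
      ∃ φ : ℕ → ℕ, StrictMono φ ∧ ∀ᵐ x ∂μ, Tendsto (fun k => D (φ k) x) atTop (𝓝 (d x)) := by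
  have hdist : ∀ {f g : α → ℝ} (hf : Integrable f μ) (hg : Integrable g μ),
      dist (hf.toL1 f) (hg.toL1 g) = ∫ x, |f x - g x| ∂μ := by
    intro f g hf hg
    rw [L1.dist_eq_integral_dist]
    refine integral_congr_ae ?_
    filter_upwards [hf.coeFn_toL1, hg.coeFn_toL1] with x h1 h2
    rw [h1, h2, Real.dist_eq]
  have hcau : CauchySeq fun k => (hD k).toL1 (D k) := by
    rw [Metric.cauchySeq_iff]
    intro η hη
    obtain ⟨N, hN⟩ := hC η hη
    exact ⟨N, fun k hk l hl => by rw [hdist]; exact hN k hk l hl⟩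
  obtain ⟨F, hF⟩ := cauchySeq_tendsto_of_complete hcau
  have hFi : Integrable F μ := L1.integrable_coeFn F
  have hFF : hFi.toL1 F = F := Integrable.toL1_coeFn F hFi
  have h1 : Tendsto (fun k => ∫ x, |D k x - F x| ∂μ) atTop (𝓝 0) := by
    have h2 := (tendsto_iff_dist_tendsto_zero.1 hF)
    refine h2.congr fun k => ?_
    rw [← hdist (hD k) hFi, hFF]
  refine ⟨F, hFi, h1, ?_⟩
  have hm : TendstoInMeasure μ D atTop F := by
    refine tendstoInMeasure_of_tendsto_eLpNorm (p := 1) one_ne_zero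
      (fun k => (hD k).aestronglyMeasurable) hFi.aestronglyMeasurable ?_
    have h3 : ∀ k, eLpNorm (D k - (F : α → ℝ)) 1 μ = ENNReal.ofReal (∫ x, |D k x - F x| ∂μ) := by
      intro k
      rw [eLpNorm_one_eq_lintegral_enorm,
        ← ofReal_integral_norm_eq_lintegral_enorm ((hD k).sub hFi)]
      rfl
    simp_rw [h3]
    simpa using ENNReal.tendsto_ofReal h1
  exact hm.exists_seq_tendsto_ae

variable {n : ℕ} {κ ε L : ℝ} {h : ℝ → ℝ}

theorem continuous_bdry : Continuous (bdry n κ ε) := by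
  have h1 : bdry n κ ε = fun x => κ * (n - 1) / n ^ 2 *
      (ε ^ n * ((x / ε ^ n) * Real.log (x / ε ^ n))) := by
    ext x
    unfold bdry
    rcases eq_or_ne (ε ^ n) 0 with h0 | h0
    · simp [h0]
    · field_simp
  rw [h1]
  have := Real.continuous_mul_log
  exact continuous_const.mul (continuous_const.mul (this.comp (continuous_id.div_const _)))

/-- The volume coordinate depends continuously on `d ∈ L¹`. -/
theorem abs_vol_sub_le (hε : 0 < ε) (hε1 : ε < 1) {d₁ d₂ : ℝ → ℝ}
    (h₁ : IntegrableOn d₁ (Ioo ε 1)) (h₂ : IntegrableOn d₂ (Ioo ε 1)) {R : ℝ} (hR : R ∈ Icc ε 1) :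
    |vol n L d₁ R - vol n L d₂ R| ≤ n * ∫ x in Ioo ε 1, |d₁ x - d₂ x| := by
  have h0 := vol_comb (n := n) (L₁ := L) (L₂ := L) hε1 h₁ h₂ 1 (-1) hR
  have hd : IntegrableOn (fun x => 1 * d₁ x + -1 * d₂ x) (Ioo ε 1) :=
    (h₁.const_mul 1).add (h₂.const_mul (-1))
  have h3 : vol n L d₁ R - vol n L d₂ R = vol n (1 * L + -1 * L)
      (fun x => 1 * d₁ x + -1 * d₂ x) R := by
    rw [h0]; ring
  have hi := (isPrim_vol (n := n) (L := L) hd).integrableOn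
  rw [h3, vol, show 1 * L + -1 * L = 0 by ring, zero_sub, abs_neg,
    intervalIntegral.integral_of_le hR.2, integral_Ioc_eq_integral_Ioo]
  rw [← Real.norm_eq_abs]
  refine (norm_integral_le_integral_norm _).trans ?_
  refine (setIntegral_mono_set hi.norm (Eventually.of_forall fun _ => norm_nonneg _)
    (Ioo_subset_Ioo hR.1 le_rfl).eventuallyLE).trans ?_
  rw [← integral_const_mul]
  refine integral_mono_ae hi.norm (((h₁.sub h₂).abs).const_mul _) ?_
  filter_upwards [ae_restrict_mem measurableSet_Ioo] with x hx
  have hx0 : 0 < x := hε.trans hx.1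
  have hx1 : x ^ (n - 1) ≤ 1 := pow_le_one₀ hx0.le hx.2.le
  have e : |1 * d₁ x + -1 * d₂ x| = |d₁ x - d₂ x| := by congr 1; ring
  rw [norm_mul, norm_mul, Real.norm_eq_abs (1 * d₁ x + -1 * d₂ x), e, Real.norm_natCast,
    Real.norm_of_nonneg (by positivity)]
  have : 0 ≤ (n : ℝ) * |d₁ x - d₂ x| := by positivity
  nlinarith

theorem FiniteEnergy.integrableOn_h (hn : 2 ≤ n) (hκ : 0 < κ) (hε : 0 < ε) (hε1 : ε < 1)
    (H : IsBulkEnergy h) {d : ℝ → ℝ} (hd : FiniteEnergy n κ h ε L d) :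
    IntegrableOn (fun R => R ^ (n - 1) * h (d R)) (Ioo ε 1) ∧
      ∫ R in Ioo ε 1, R ^ (n - 1) * h (d R) ≤ bulkEnergy n κ h ε L d := by
  have hn1 : (0 : ℝ) ≤ n - 1 := by
    have : (2 : ℝ) ≤ n := by exact_mod_cast hn
    linarith
  have hle : ∀ᵐ R ∂(volume.restrict (Ioo ε 1)), 0 ≤ R ^ (n - 1) * h (d R) ∧
      R ^ (n - 1) * h (d R) ≤ dens n κ h R (vol n L d R) (d R) := by
    filter_upwards [hd.pos, ae_restrict_mem measurableSet_Ioo] with R p hR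
    have hR0 := hε.trans hR.1
    have hv := vol_pos hn hε hε1 hd.integrableOn hd.pos hd.bdry_nonneg ⟨hR.1, hR.2.le⟩
    have := H.nonneg _ p
    refine ⟨by positivity, ?_⟩
    unfold dens
    have h1 : 0 ≤ κ / n * (d R ^ n * (R ^ n / vol n L d R) ^ (n - 1) +
      (n - 1) * (vol n L d R / R ^ n)) := by positivity
    exact mul_le_mul_of_nonneg_left (by linarith) (by positivity)
  have hi : IntegrableOn (fun R => R ^ (n - 1) * h (d R)) (Ioo ε 1) := by
    refine Integrable.mono' hd.energy ((continuous_pow (n - 1)).aestronglyMeasurable.mul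
      (aestronglyMeasurable_comp_of_pos H.continuousOn hd.integrableOn.aestronglyMeasurable
        hd.pos)) ?_
    filter_upwards [hle] with R h1
    rw [Real.norm_of_nonneg h1.1]
    exact h1.2
  exact ⟨hi, integral_mono_ae hi hd.energy (hle.mono fun R h1 => h1.2)⟩

theorem bulkEnergy_nonneg (hn : 2 ≤ n) (hκ : 0 < κ) (hε : 0 < ε) (hε1 : ε < 1)
    (H : IsBulkEnergy h) {d : ℝ → ℝ} (hd : FiniteEnergy n κ h ε L d) :
    0 ≤ bulkEnergy n κ h ε L d := by
  refine integral_nonneg_of_ae ?_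
  filter_upwards [hd.pos, ae_restrict_mem measurableSet_Ioo] with R p hR
  exact dens_nonneg hn hκ H (hε.trans hR.1) (vol_nonneg hn hε hε1 hd.integrableOn hd.pos
    hd.bdry_nonneg (Ioo_subset_Icc_self hR)) p

/-- Two competitors whose midpoint convexity defect is small are close in `L¹`. -/
theorem integral_abs_sub_le (hn : 2 ≤ n) (hκ : 0 < κ) (hε : 0 < ε) (hε1 : ε < 1)
    (H : IsBulkEnergy h) {δ : ℝ} (hδ : 0 < δ) : ∃ K : ℝ, 0 ≤ K ∧ ∀ d₁ d₂ : ℝ → ℝ,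
      FiniteEnergy n κ h ε L d₁ → FiniteEnergy n κ h ε L d₂ →
      ε ^ (n - 1) * ∫ x in Ioo ε 1, |d₁ x - d₂ x| ≤
        δ * (1 + bulkEnergy n κ h ε L d₁ + bulkEnergy n κ h ε L d₂) +
        K * ((1 - 1 / 2) * bulkEnergy n κ h ε L d₁ + 1 / 2 * bulkEnergy n κ h ε L d₂ -
          bulkEnergy n κ h ε L (fun x => (1 - 1 / 2) * d₁ x + 1 / 2 * d₂ x)) := by
  obtain ⟨K, hK0, hK⟩ := H.dist_le_gap hδ
  refine ⟨K, hK0, fun d₁ d₂ h₁ h₂ => ?_⟩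
  obtain ⟨-, hgi, hgle⟩ := h₁.convexComb hn hκ hε hε1 H h₂ (s := 1 / 2) (by norm_num) (by norm_num)
  obtain ⟨i1, l1⟩ := h₁.integrableOn_h hn hκ hε hε1 H
  obtain ⟨i2, l2⟩ := h₂.integrableOn_h hn hκ hε hε1 H
  have i0 : IntegrableOn (fun _ : ℝ => (1 : ℝ)) (Ioo ε 1) := integrableOn_const (by simp)
  have l0 : ∫ _ in Ioo ε 1, (1 : ℝ) ≤ 1 := by
    simp [hε1.le, hε.le]
  have i01 : IntegrableOn (fun R => 1 + R ^ (n - 1) * h (d₁ R)) (Ioo ε 1) := i0.add i1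
  have hiR : IntegrableOn (fun R => δ * ((1 + R ^ (n - 1) * h (d₁ R)) + R ^ (n - 1) * h (d₂ R)))
      (Ioo ε 1) := (i01.add i2).const_mul δ
  have hkey : ∫ x in Ioo ε 1, ε ^ (n - 1) * |d₁ x - d₂ x| ≤
      ∫ R in Ioo ε 1, (δ * ((1 + R ^ (n - 1) * h (d₁ R)) + R ^ (n - 1) * h (d₂ R)) +
        K * (R ^ (n - 1) * ((1 - 1 / 2) * h (d₁ R) + 1 / 2 * h (d₂ R) -
      h ((1 - 1 / 2) * d₁ R + 1 / 2 * d₂ R)))) := by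
    refine integral_mono_ae (((h₁.integrableOn.sub h₂.integrableOn).abs).const_mul _)
      (hiR.add (hgi.const_mul K)) ?_
    filter_upwards [h₁.pos, h₂.pos, ae_restrict_mem measurableSet_Ioo] with R p1 p2 hR
    have hR0 : 0 < R := hε.trans hR.1
    have a1 : R ^ (n - 1) ≤ 1 := pow_le_one₀ hR0.le hR.2.le
    have a2 : ε ^ (n - 1) ≤ R ^ (n - 1) := pow_le_pow_left₀ hε.le hR.1.le _
    have a3 := hK (d₁ R) (d₂ R) p1 p2
    have a4 : 0 < R ^ (n - 1) := by positivity
    calc ε ^ (n - 1) * |d₁ R - d₂ R| ≤ R ^ (n - 1) * |d₁ R - d₂ R| :=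
          mul_le_mul_of_nonneg_right a2 (abs_nonneg _)
      _ ≤ R ^ (n - 1) * (δ * (1 + h (d₁ R) + h (d₂ R)) + K * ((1 - 1 / 2) * h (d₁ R) +
            1 / 2 * h (d₂ R) - h ((1 - 1 / 2) * d₁ R + 1 / 2 * d₂ R))) :=
          mul_le_mul_of_nonneg_left a3 a4.le
      _ ≤ _ := by
          have := mul_le_mul_of_nonneg_left a1 hδ.le
          linarith
  have e1 : ∫ R in Ioo ε 1, (δ * ((1 + R ^ (n - 1) * h (d₁ R)) + R ^ (n - 1) * h (d₂ R)) +
        K * (R ^ (n - 1) * ((1 - 1 / 2) * h (d₁ R) + 1 / 2 * h (d₂ R) -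
      h ((1 - 1 / 2) * d₁ R + 1 / 2 * d₂ R)))) =
      δ * ((∫ _ in Ioo ε 1, (1 : ℝ)) + (∫ R in Ioo ε 1, R ^ (n - 1) * h (d₁ R)) +
        ∫ R in Ioo ε 1, R ^ (n - 1) * h (d₂ R)) + K * ∫ R in Ioo ε 1, R ^ (n - 1) *
          ((1 - 1 / 2) * h (d₁ R) + 1 / 2 * h (d₂ R) - h ((1 - 1 / 2) * d₁ R + 1 / 2 * d₂ R)) := by
    rw [integral_add hiR (hgi.const_mul K), integral_const_mul, integral_const_mul,
      integral_add i01 i2, integral_add i0 i1]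
  rw [e1, integral_const_mul] at hkey
  refine hkey.trans (add_le_add (mul_le_mul_of_nonneg_left (by linarith) hδ.le)
    (mul_le_mul_of_nonneg_left (by linarith) hK0))

theorem tendsto_dens {R : ℝ} (H : IsBulkEnergy h) {u d : ℕ → ℝ} {u₀ d₀ : ℝ}
    (hu : Tendsto u atTop (𝓝 u₀)) (hd : Tendsto d atTop (𝓝 d₀)) (hu0 : 0 < u₀) (hd0 : 0 < d₀) :
    Tendsto (fun k => dens n κ h R (u k) (d k)) atTop (𝓝 (dens n κ h R u₀ d₀)) := by
  have h1 : Tendsto (fun k => h (d k)) atTop (𝓝 (h d₀)) :=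
    ((H.continuousOn.continuousAt (Ioi_mem_nhds hd0)).tendsto).comp hd
  have h2 : Tendsto (fun k => R ^ n / u k) atTop (𝓝 (R ^ n / u₀)) :=
    tendsto_const_nhds.div hu hu0.ne'
  have h3 : Tendsto (fun k => u k / R ^ n) atTop (𝓝 (u₀ / R ^ n)) :=
    hu.div_const _
  exact tendsto_const_nhds.mul (((tendsto_const_nhds.mul (((hd.pow n).mul (h2.pow (n - 1))).add
    (tendsto_const_nhds.mul h3)))).add h1)

/-- Lower semicontinuity: an `L¹` limit of competitors with convergent bulk energies is a
competitor whose bulk energy does not exceed the limit. -/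
theorem finiteEnergy_of_tendsto (hn : 2 ≤ n) (hκ : 0 < κ) (hε : 0 < ε) (hε1 : ε < 1)
    (H : IsBulkEnergy h) {D : ℕ → ℝ → ℝ} (hD : ∀ k, FiniteEnergy n κ h ε L (D k)) {d : ℝ → ℝ}
    (hd : IntegrableOn d (Ioo ε 1))
    (hlim : Tendsto (fun k => ∫ x in Ioo ε 1, |D k x - d x|) atTop (𝓝 0))
    (hae : ∀ᵐ x ∂(volume.restrict (Ioo ε 1)), Tendsto (fun k => D k x) atTop (𝓝 (d x)))
    {E : ℝ} (hE : Tendsto (fun k => bulkEnergy n κ h ε L (D k)) atTop (𝓝 E)) :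
    FiniteEnergy n κ h ε L d ∧ bulkEnergy n κ h ε L d ≤ E ∧
      ∀ R ∈ Icc ε 1, Tendsto (fun k => vol n L (D k) R) atTop (𝓝 (vol n L d R)) := by
  have hn1 : (0 : ℝ) ≤ n - 1 := by
    have : (2 : ℝ) ≤ n := by exact_mod_cast hn
    linarith
  have hvol : ∀ R ∈ Icc ε 1, Tendsto (fun k => vol n L (D k) R) atTop (𝓝 (vol n L d R)) := by
    intro R hR
    rw [tendsto_iff_dist_tendsto_zero]
    refine squeeze_zero (fun _ => dist_nonneg)
      (fun k => abs_vol_sub_le hε hε1 (hD k).integrableOn hd hR) ?_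
    simpa using hlim.const_mul (n : ℝ)
  have hb : 0 ≤ vol n L d ε :=
    ge_of_tendsto' (hvol ε ⟨le_rfl, hε1.le⟩) fun k => (hD k).bdry_nonneg
  have hposall : ∀ᵐ x ∂(volume.restrict (Ioo ε 1)), ∀ k, 0 < D k x :=
    ae_all_iff.2 fun k => (hD k).pos
  -- the lemma of Fatou for the densities
  let F : ℕ → ℝ → ENNReal := fun k R => ENNReal.ofReal (dens n κ h R (vol n L (D k) R) (D k R))
  have hFm : ∀ k, AEMeasurable (F k) (volume.restrict (Ioo ε 1)) := fun k =>
    (hD k).energy.aestronglyMeasurable.aemeasurable.ennreal_ofReal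
  have hdens0 : ∀ k, ∀ᵐ R ∂(volume.restrict (Ioo ε 1)),
      0 ≤ dens n κ h R (vol n L (D k) R) (D k R) := by
    intro k
    filter_upwards [(hD k).pos, ae_restrict_mem measurableSet_Ioo] with R p hR
    exact dens_nonneg hn hκ H (hε.trans hR.1) (vol_nonneg hn hε hε1 (hD k).integrableOn (hD k).pos
      (hD k).bdry_nonneg (Ioo_subset_Icc_self hR)) p
  have hFint : ∀ k, ∫⁻ R in Ioo ε 1, F k R = ENNReal.ofReal (bulkEnergy n κ h ε L (D k)) :=
    fun k => (ofReal_integral_eq_lintegral_ofReal (hD k).energy (hdens0 k)).symm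
  have hfatou : ∫⁻ R in Ioo ε 1, liminf (fun k => F k R) atTop ≤ ENNReal.ofReal E := by
    refine (lintegral_liminf_le' hFm).trans ?_
    simp_rw [hFint]
    exact (ENNReal.tendsto_ofReal hE).liminf_eq.le
  have hFl : AEMeasurable (fun R => liminf (fun k => F k R) atTop) (volume.restrict (Ioo ε 1)) :=
    ⟨fun R => liminf (fun k => (hFm k).mk _ R) atTop, Measurable.liminf fun k =>
      (hFm k).measurable_mk, by
        filter_upwards [ae_all_iff.2 fun k => (hFm k).ae_eq_mk] with R hR
        simp only [hR]⟩
  have hfin : ∀ᵐ R ∂(volume.restrict (Ioo ε 1)), liminf (fun k => F k R) atTop < ⊤ :=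
    ae_lt_top' hFl (hfatou.trans_lt ENNReal.ofReal_lt_top).ne
  -- the blow-up of `h` at `0` keeps the limit positive
  have hpos : ∀ᵐ R ∂(volume.restrict (Ioo ε 1)), 0 < d R := by
    filter_upwards [hfin, hae, hposall, ae_restrict_mem measurableSet_Ioo] with R h1 h2 h3 hR
    have h4 : 0 ≤ d R := ge_of_tendsto' h2 fun k => (h3 k).le
    refine lt_of_le_of_ne h4 fun h0 => ?_
    rw [← h0] at h2
    have hR0 : 0 < R := hε.trans hR.1
    have h5 : Tendsto (fun k => h (D k R)) atTop atTop :=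
      H.zero.comp (tendsto_nhdsWithin_iff.2 ⟨h2, Eventually.of_forall h3⟩)
    have h6 : Tendsto (fun k => F k R) atTop (𝓝 ⊤) := by
      refine ENNReal.tendsto_ofReal_atTop.comp ?_
      refine tendsto_atTop_mono (fun k => ?_) (h5.const_mul_atTop (pow_pos hR0 (n - 1)))
      unfold dens
      refine mul_le_mul_of_nonneg_left ?_ (by positivity)
      have hv := vol_pos hn hε hε1 (hD k).integrableOn (hD k).pos (hD k).bdry_nonneg
        ⟨hR.1, hR.2.le⟩
      have := h3 k
      have : 0 ≤ κ / n * (D k R ^ n * (R ^ n / vol n L (D k) R) ^ (n - 1) +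
        (n - 1) * (vol n L (D k) R / R ^ n)) := by positivity
      linarith
    rw [h6.liminf_eq] at h1
    exact lt_irrefl _ h1
  have hlimF : ∀ᵐ R ∂(volume.restrict (Ioo ε 1)),
      liminf (fun k => F k R) atTop = ENNReal.ofReal (dens n κ h R (vol n L d R) (d R)) := by
    filter_upwards [hpos, hae, ae_restrict_mem measurableSet_Ioo] with R p h1 hR
    exact (ENNReal.tendsto_ofReal (tendsto_dens H
      (hvol R (Ioo_subset_Icc_self hR)) h1
      (vol_pos hn hε hε1 hd hpos hb ⟨hR.1, hR.2.le⟩) p)).liminf_eq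
  rw [lintegral_congr_ae hlimF] at hfatou
  have hdm : AEStronglyMeasurable (fun R => dens n κ h R (vol n L d R) (d R))
      (volume.restrict (Ioo ε 1)) :=
    aestronglyMeasurable_dens H (((continuousOn_vol hε1 hd).mono
      Ioo_subset_Icc_self).aestronglyMeasurable measurableSet_Ioo) hd.aestronglyMeasurable hpos
  have hd0 : ∀ᵐ R ∂(volume.restrict (Ioo ε 1)), 0 ≤ dens n κ h R (vol n L d R) (d R) := by
    filter_upwards [hpos, ae_restrict_mem measurableSet_Ioo] with R p hR
    exact dens_nonneg hn hκ H (hε.trans hR.1) (vol_nonneg hn hε hε1 hd hpos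
      hb (Ioo_subset_Icc_self hR)) p
  have hdi : IntegrableOn (fun R => dens n κ h R (vol n L d R) (d R)) (Ioo ε 1) :=
    ⟨hdm, (hasFiniteIntegral_iff_ofReal hd0).2 (hfatou.trans_lt ENNReal.ofReal_lt_top)⟩
  refine ⟨⟨hd, hpos, hb, hdi⟩, ?_, hvol⟩
  rw [← ofReal_integral_eq_lintegral_ofReal hdi hd0] at hfatou
  have hE0 : 0 ≤ E := ge_of_tendsto' hE fun k => bulkEnergy_nonneg hn hκ hε hε1 H (hD k)
  exact (ENNReal.ofReal_le_ofReal_iff hE0).1 hfatou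

/-- The reduced energy attains its minimum among the competitors with `u(ε)` in a compact convex
set. Minimising sequences converge in `L¹`, since the energy of the midpoint of two competitors is
smaller than the mean of their energies by an amount that controls their distance. -/
theorem exists_isRedMin (hn : 2 ≤ n) (hκ : 0 < κ) (hε : 0 < ε) (hε1 : ε < 1)
    (H : IsBulkEnergy h) {K : Set ℝ} (hK : IsCompact K) (hKc : Convex ℝ K)
    (hne : ∃ d, FiniteEnergy n κ h ε L d ∧ vol n L d ε ∈ K) :
    ∃ d, IsRedMin n κ h ε L K d := by
  let S : Set ℝ := {e | ∃ d, FiniteEnergy n κ h ε L d ∧ vol n L d ε ∈ K ∧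
    redEnergy n κ h ε L d = e}
  obtain ⟨Cb, hCb⟩ := hK.exists_bound_of_continuousOn (continuous_bdry (n := n) (κ := κ)
    (ε := ε)).continuousOn
  have hSb : BddBelow S := by
    refine ⟨-Cb, ?_⟩
    rintro e ⟨d, hd, hdK, rfl⟩
    have h1 := bulkEnergy_nonneg hn hκ hε hε1 H hd
    have h2 := (abs_le.1 (hCb _ hdK)).2
    unfold redEnergy
    linarith
  have hSne : S.Nonempty := by
    obtain ⟨d, hd, hdK⟩ := hne
    exact ⟨_, d, hd, hdK, rfl⟩
  set I := sInf S with hI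
  obtain ⟨e, -, he, heS⟩ := exists_seq_tendsto_sInf hSne hSb
  choose D₀ hD₀ hD₀K hD₀e using heS
  obtain ⟨a, haK, φ, hφ, hφa⟩ := hK.tendsto_subseq hD₀K
  let D : ℕ → ℝ → ℝ := fun k => D₀ (φ k)
  have hD : ∀ k, FiniteEnergy n κ h ε L (D k) := fun k => hD₀ (φ k)
  have hDK : ∀ k, vol n L (D k) ε ∈ K := fun k => hD₀K (φ k)
  have hDa : Tendsto (fun k => vol n L (D k) ε) atTop (𝓝 a) := hφa
  have hDe : Tendsto (fun k => redEnergy n κ h ε L (D k)) atTop (𝓝 I) := by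
    refine (he.comp hφ.tendsto_atTop).congr fun k => ?_
    exact (hD₀e (φ k)).symm
  have hcb := continuous_bdry (n := n) (κ := κ) (ε := ε)
  have hbulk : ∀ d, bulkEnergy n κ h ε L d = redEnergy n κ h ε L d + bdry n κ ε (vol n L d ε) :=
    fun d => by unfold redEnergy; ring
  have hDb : Tendsto (fun k => bulkEnergy n κ h ε L (D k)) atTop (𝓝 (I + bdry n κ ε a)) := by
    simp_rw [hbulk]
    exact hDe.add ((hcb.tendsto a).comp hDa)
  -- the midpoint defect tends to zero
  have hdefect : Tendsto (fun z : ℕ × ℕ => (1 - 1 / 2) * bulkEnergy n κ h ε L (D z.1) +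
      1 / 2 * bulkEnergy n κ h ε L (D z.2) -
      (I + bdry n κ ε ((1 - 1 / 2) * vol n L (D z.1) ε + 1 / 2 * vol n L (D z.2) ε)))
      (atTop ×ˢ atTop) (𝓝 0) := by
    have t1 := hDb.comp (tendsto_fst (f := atTop (α := ℕ)) (g := atTop (α := ℕ)))
    have t2 := hDb.comp (tendsto_snd (f := atTop (α := ℕ)) (g := atTop (α := ℕ)))
    have t3 := hDa.comp (tendsto_fst (f := atTop (α := ℕ)) (g := atTop (α := ℕ)))
    have t4 := hDa.comp (tendsto_snd (f := atTop (α := ℕ)) (g := atTop (α := ℕ)))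
    have t5 : Tendsto (fun z : ℕ × ℕ => (1 - 1 / 2) * vol n L (D z.1) ε +
        1 / 2 * vol n L (D z.2) ε) (atTop ×ˢ atTop) (𝓝 a) := by
      have := (t3.const_mul (1 - 1 / 2 : ℝ)).add (t4.const_mul (1 / 2 : ℝ))
      rwa [show (1 - 1 / 2 : ℝ) * a + 1 / 2 * a = a by ring] at this
    have t6 := ((t1.const_mul (1 - 1 / 2 : ℝ)).add (t2.const_mul (1 / 2 : ℝ))).sub
      (tendsto_const_nhds (x := I) |>.add ((hcb.tendsto a).comp t5))
    rwa [show (1 - 1 / 2 : ℝ) * (I + bdry n κ ε a) + 1 / 2 * (I + bdry n κ ε a) -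
      (I + bdry n κ ε a) = 0 by ring] at t6
  have hmid : ∀ k l, I + bdry n κ ε ((1 - 1 / 2) * vol n L (D k) ε + 1 / 2 * vol n L (D l) ε) ≤
      bulkEnergy n κ h ε L (fun x => (1 - 1 / 2) * D k x + 1 / 2 * D l x) := by
    intro k l
    obtain ⟨hfe, -, -⟩ := (hD k).convexComb hn hκ hε hε1 H (hD l) (s := 1 / 2) (by norm_num)
      (by norm_num)
    have hv := (hD k).vol_convexComb hε1 (hD l) (1 / 2) (R := ε) ⟨le_rfl, hε1.le⟩
    have h1 : I ≤ redEnergy n κ h ε L (fun x => (1 - 1 / 2) * D k x + 1 / 2 * D l x) := by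
      refine csInf_le hSb ⟨_, hfe, ?_, rfl⟩
      rw [hv]
      exact hKc (hDK k) (hDK l) (by norm_num) (by norm_num) (by norm_num)
    rw [hbulk, hv]
    linarith
  obtain ⟨M, hM⟩ := hDb.bddAbove_range
  have hM' : ∀ k, bulkEnergy n κ h ε L (D k) ≤ M := fun k => hM ⟨k, rfl⟩
  have hM0 : 0 ≤ M := (bulkEnergy_nonneg hn hκ hε hε1 H (hD 0)).trans (hM' 0)
  have hcauchy : ∀ η : ℝ, 0 < η → ∃ N, ∀ k ≥ N, ∀ l ≥ N,
      ∫ x in Ioo ε 1, |D k x - D l x| < η := by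
    intro η hη
    have hεn : 0 < ε ^ (n - 1) := by positivity
    obtain ⟨C, hC0, hC⟩ := integral_abs_sub_le (L := L) hn hκ hε hε1 H
      (δ := ε ^ (n - 1) * η / (4 * (1 + M + M))) (by positivity)
    have h1 : 0 < ε ^ (n - 1) * η / (4 * (C + 1)) := by positivity
    have h2 := hdefect.eventually (gt_mem_nhds h1)
    rw [prod_atTop_atTop_eq, eventually_atTop] at h2
    obtain ⟨⟨N₁, N₂⟩, hN⟩ := h2
    refine ⟨max N₁ N₂, fun k hk l hl => ?_⟩
    have h3 := hN (k, l) ⟨(le_max_left _ _).trans hk, (le_max_right _ _).trans hl⟩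
    have h4 := hC (D k) (D l) (hD k) (hD l)
    have h5 := hmid k l
    simp only at h3
    have h6 : ε ^ (n - 1) * η / (4 * (1 + M + M)) * (1 + bulkEnergy n κ h ε L (D k) +
        bulkEnergy n κ h ε L (D l)) ≤ ε ^ (n - 1) * η / 4 := by
      calc _ ≤ ε ^ (n - 1) * η / (4 * (1 + M + M)) * (1 + M + M) :=
            mul_le_mul_of_nonneg_left (by linarith [hM' k, hM' l]) (by positivity)
        _ = _ := by field_simp
    have h7 : C * ((1 - 1 / 2) * bulkEnergy n κ h ε L (D k) + 1 / 2 * bulkEnergy n κ h ε L (D l) -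
          bulkEnergy n κ h ε L (fun x => (1 - 1 / 2) * D k x + 1 / 2 * D l x)) ≤
        ε ^ (n - 1) * η / 4 := by
      calc _ ≤ C * (ε ^ (n - 1) * η / (4 * (C + 1))) :=
            mul_le_mul_of_nonneg_left (by linarith) hC0
        _ ≤ (C + 1) * (ε ^ (n - 1) * η / (4 * (C + 1))) :=
            mul_le_mul_of_nonneg_right (by linarith) h1.le
        _ = _ := by field_simp
    have h8 : ε ^ (n - 1) * ∫ x in Ioo ε 1, |D k x - D l x| < ε ^ (n - 1) * η := by
      have : 0 < ε ^ (n - 1) * η := by positivity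
      linarith
    exact lt_of_mul_lt_mul_left h8 hεn.le
  obtain ⟨d, hd, hlim, ψ, hψ, hae⟩ := exists_tendsto_of_cauchy_integral
    (fun k => (hD k).integrableOn) hcauchy
  have hψt := hψ.tendsto_atTop
  obtain ⟨hfe, hbE, hv⟩ := finiteEnergy_of_tendsto hn hκ hε hε1 H (D := fun k => D (ψ k))
    (fun k => hD _) hd (hlim.comp hψt) hae (hDb.comp hψt)
  have hva : vol n L d ε = a := tendsto_nhds_unique (hv ε ⟨le_rfl, hε1.le⟩) (hDa.comp hψt)
  refine ⟨d, hfe, by rwa [hva], fun d' hd' hK' => ?_⟩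
  have h1 : I ≤ redEnergy n κ h ε L d' := csInf_le hSb ⟨d', hd', hK', rfl⟩
  unfold redEnergy at h1 ⊢
  rw [hva]
  linarith

/-- By strict convexity of `h`, minimisers with the same value of `u(ε)` agree. -/
theorem ae_eq_of_isRedMin (hn : 2 ≤ n) (hκ : 0 < κ) (hε : 0 < ε) (hε1 : ε < 1)
    (H : IsBulkEnergy h) {K : Set ℝ} {d₁ d₂ : ℝ → ℝ}
    (h₁ : IsRedMin n κ h ε L K d₁) (h₂ : IsRedMin n κ h ε L K d₂)
    (hv : vol n L d₁ ε = vol n L d₂ ε) : d₁ =ᵐ[volume.restrict (Ioo ε 1)] d₂ := by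
  obtain ⟨hfe, hgi, hle⟩ := h₁.finiteEnergy.convexComb hn hκ hε hε1 H h₂.finiteEnergy
    (s := 1 / 2) (by norm_num) (by norm_num)
  have hvm := h₁.finiteEnergy.vol_convexComb hε1 h₂.finiteEnergy (1 / 2) (R := ε) ⟨le_rfl, hε1.le⟩
  have hm := hvm
  rw [← hv, show (1 - 1 / 2 : ℝ) * vol n L d₁ ε + 1 / 2 * vol n L d₁ ε = vol n L d₁ ε by ring] at hm
  have e1 := h₁.le _ hfe (by rw [hm]; exact h₁.mem)
  have e2 := h₂.le _ h₁.finiteEnergy h₁.mem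
  have e3 := h₁.le _ h₂.finiteEnergy h₂.mem
  unfold redEnergy at e1 e2 e3
  rw [hm] at e1
  rw [← hv] at e2 e3
  have hg0 : ∀ᵐ R ∂(volume.restrict (Ioo ε 1)), 0 ≤ R ^ (n - 1) * ((1 - 1 / 2) * h (d₁ R) +
      1 / 2 * h (d₂ R) - h ((1 - 1 / 2) * d₁ R + 1 / 2 * d₂ R)) := by
    filter_upwards [h₁.finiteEnergy.pos, h₂.finiteEnergy.pos, ae_restrict_mem measurableSet_Ioo]
      with R p1 p2 hR
    exact mul_nonneg (pow_nonneg (hε.trans hR.1).le _)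
      (H.gap_nonneg p1 p2 (by norm_num) (by norm_num))
  have hz := (integral_eq_zero_iff_of_nonneg_ae hg0 hgi).1
    (le_antisymm (by linarith) (integral_nonneg_of_ae hg0))
  filter_upwards [hz, h₁.finiteEnergy.pos, h₂.finiteEnergy.pos, ae_restrict_mem measurableSet_Ioo]
    with R h0 p1 p2 hR
  by_contra hne
  have h3 := mul_pos (pow_pos (hε.trans hR.1) (n - 1))
    (H.gap_pos p1 p2 hne (s := 1 / 2) (by norm_num) (by norm_num))
  rw [Pi.zero_apply] at h0
  linarith

end Existence

/-! ### The first variation -/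

section Variation

variable {n : ℕ} {κ ε L : ℝ} {h : ℝ → ℝ} {d η : ℝ → ℝ} {a b : ℝ}

/-- The derivative of the density at `(w, D)` in the direction `(U, η)`. -/
noncomputable def densVar (n : ℕ) (κ : ℝ) (h : ℝ → ℝ) (R w D U η : ℝ) : ℝ :=
  R ^ (n - 1) * (κ * (D * (R ^ n / w)) ^ (n - 1) + deriv h D) * η +
    R ^ (n - 1) * (κ * (n - 1) / n * (1 - (D * (R ^ n / w)) ^ n) / R ^ n) * U

theorem hasDerivAt_dens (hn : 2 ≤ n) (H : IsBulkEnergy h) {R u U d η t : ℝ} (hR : 0 < R)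
    (hw : 0 < u + t * U) (hD : 0 < d + t * η) :
    HasDerivAt (fun t => dens n κ h R (u + t * U) (d + t * η))
      (densVar n κ h R (u + t * U) (d + t * η) U η) t := by
  obtain ⟨m, rfl⟩ : ∃ m, n = m + 2 := ⟨n - 2, by omega⟩
  have hX : 0 < R ^ (m + 2) := by positivity
  have h1 : HasDerivAt (fun t => u + t * U) U t := by
    simpa using ((hasDerivAt_id t).mul_const U).const_add u
  have h2 : HasDerivAt (fun t => d + t * η) η t := by
    simpa using ((hasDerivAt_id t).mul_const η).const_add d
  have h3 := (H.hasDerivAt hD).comp t h2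
  have h4 := h2.pow (m + 2)
  have h5 := ((hasDerivAt_const t (R ^ (m + 2))).div h1 hw.ne').pow (m + 1)
  have h6 := h1.div_const (R ^ (m + 2))
  have h7 := ((((h4.mul h5).add (h6.const_mul (((m + 2 : ℕ) : ℝ) - 1))).const_mul
    (κ / ((m + 2 : ℕ) : ℝ))).add h3).const_mul (R ^ (m + 1))
  refine h7.congr_deriv ?_
  have hm0 : ((m + 2 : ℕ) : ℝ) ≠ 0 := by positivity
  unfold densVar
  simp only [Pi.pow_apply, Pi.div_apply, show m + 2 - 1 = m + 1 from rfl,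
    show m + 1 - 1 = m from rfl]
  generalize u + t * U = w at hw ⊢
  generalize d + t * η = D at hD ⊢
  generalize R ^ (m + 2) = X at hX ⊢
  push_cast
  push_cast at hm0
  simp only [mul_pow, div_pow, pow_succ (X : ℝ) (m + 1), pow_succ (w : ℝ) (m + 1),
    pow_succ (X : ℝ) m, pow_succ (w : ℝ) m]
  have hXm : X ^ m ≠ 0 := (pow_pos hX m).ne'
  have hwm : w ^ m ≠ 0 := (pow_pos hw m).ne'
  field_simp
  ring

/-- Admissible variations: bounded functions that are supported where `d` stays away from `0` and
`∞`. -/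
structure IsVariation (ε : ℝ) (d : ℝ → ℝ) (a b : ℝ) (η : ℝ → ℝ) : Prop where
  meas : AEStronglyMeasurable η (volume.restrict (Ioo ε 1))
  abs_le : ∀ R, |η R| ≤ 1
  mem : ∀ R, η R ≠ 0 → d R ∈ Icc a b

theorem IsVariation.integrableOn (hη : IsVariation ε d a b η) : IntegrableOn η (Ioo ε 1) :=
  Integrable.mono' (integrableOn_const (C := (1 : ℝ)) (by simp)) hη.meas
    (Eventually.of_forall hη.abs_le)

theorem vol_add_mul (hε1 : ε < 1) (hd : IntegrableOn d (Ioo ε 1)) (hη : IntegrableOn η (Ioo ε 1))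
    (t : ℝ) {R : ℝ} (hR : R ∈ Icc ε 1) :
    vol n L (fun x => d x + t * η x) R = vol n L d R + t * vol n 0 η R := by
  have := vol_comb (n := n) (L₁ := L) (L₂ := 0) hε1 hd hη 1 t hR
  simpa using this

/-- The quotient `d R^n / u`, which is `R r'/r` in terms of the deformation `r`. -/
noncomputable def strainRatio (n : ℕ) (L : ℝ) (d : ℝ → ℝ) (R : ℝ) : ℝ :=
  d R * (R ^ n / vol n L d R)

theorem FiniteEnergy.integrableOn_pow (hn : 2 ≤ n) (hκ : 0 < κ) (hε : 0 < ε) (hε1 : ε < 1)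
    (H : IsBulkEnergy h) (hd : FiniteEnergy n κ h ε L d) :
    IntegrableOn (fun R => d R ^ n) (Ioo ε 1) := by
  have hn0 : (0 : ℝ) < n := by exact_mod_cast (by omega : 0 < n)
  have hn1 : (0 : ℝ) ≤ n - 1 := by
    have : (2 : ℝ) ≤ n := by exact_mod_cast hn
    linarith
  have hL : 0 < L := by
    have := vol_pos hn hε hε1 hd.integrableOn hd.pos hd.bdry_nonneg (R := 1) ⟨hε1, le_rfl⟩
    rwa [vol_one] at this
  have hmono := (strictMonoOn_vol (L := L) hn hε hd.integrableOn hd.pos).monotoneOn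
  refine Integrable.mono' (hd.energy.const_mul
    ((ε ^ (n - 1) * (κ / n) * (ε ^ n / L) ^ (n - 1))⁻¹))
    (hd.integrableOn.aestronglyMeasurable.pow n) ?_
  filter_upwards [hd.pos, ae_restrict_mem measurableSet_Ioo] with R p hR
  have hR0 := hε.trans hR.1
  have hv := vol_pos hn hε hε1 hd.integrableOn hd.pos hd.bdry_nonneg ⟨hR.1, hR.2.le⟩
  have hvL : vol n L d R ≤ L := by
    have := hmono (Ioo_subset_Icc_self hR) ⟨hε1.le, le_rfl⟩ hR.2.le
    rwa [vol_one] at this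
  rw [Real.norm_of_nonneg (by positivity), ← div_eq_inv_mul, le_div_iff₀ (by positivity)]
  have h1 : ε ^ n / L ≤ R ^ n / vol n L d R :=
    div_le_div₀ (by positivity) (pow_le_pow_left₀ hε.le hR.1.le n) hv hvL
  have h2 : (ε ^ n / L) ^ (n - 1) ≤ (R ^ n / vol n L d R) ^ (n - 1) :=
    pow_le_pow_left₀ (by positivity) h1 _
  have h3 : ε ^ (n - 1) ≤ R ^ (n - 1) := pow_le_pow_left₀ hε.le hR.1.le _
  have h4 := H.nonneg _ p
  calc d R ^ n * (ε ^ (n - 1) * (κ / n) * (ε ^ n / L) ^ (n - 1))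
      ≤ d R ^ n * (R ^ (n - 1) * (κ / n) * (R ^ n / vol n L d R) ^ (n - 1)) := by gcongr
    _ ≤ dens n κ h R (vol n L d R) (d R) := by
        unfold dens
        have : 0 ≤ R ^ (n - 1) * (κ / n * ((n - 1) * (vol n L d R / R ^ n)) + h (d R)) := by
          positivity
        linarith

theorem FiniteEnergy.integrableOn_strainRatio_pow (hn : 2 ≤ n) (hκ : 0 < κ) (hε : 0 < ε)
    (hε1 : ε < 1) (H : IsBulkEnergy h) (hd : FiniteEnergy n κ h ε L d) (h0 : 0 < vol n L d ε) :
    IntegrableOn (fun R => strainRatio n L d R ^ n) (Ioo ε 1) := by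
  have hc : ContinuousOn (fun R => (R ^ n / vol n L d R) ^ n) (Icc ε 1) := by
    refine (ContinuousOn.div (by fun_prop) (continuousOn_vol hε1 hd.integrableOn) ?_).pow n
    intro R hR
    exact (h0.trans_le ((strictMonoOn_vol hn hε hd.integrableOn hd.pos).monotoneOn
      ⟨le_rfl, hε1.le⟩ hR hR.1)).ne'
  obtain ⟨C, hC⟩ := isCompact_Icc.exists_bound_of_continuousOn hc
  simp only [strainRatio, mul_pow]
  exact Integrable.mul_bdd (c := C) (hd.integrableOn_pow hn hκ hε hε1 H)
    ((hc.mono Ioo_subset_Icc_self).aestronglyMeasurable measurableSet_Ioo)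
    ((ae_restrict_mem measurableSet_Ioo).mono fun x hx => hC x (Ioo_subset_Icc_self hx))

/-- A uniform integrable bound for the derivative of the density along an admissible variation. -/
theorem exists_bound_densVar (hn : 2 ≤ n) (hκ : 0 < κ) (hε : 0 < ε) (hε1 : ε < 1)
    (H : IsBulkEnergy h) (hd : FiniteEnergy n κ h ε L d) (h0 : 0 < vol n L d ε) (ha : 0 < a)
    (hη : IsVariation ε d a b η) :
    ∃ τ : ℝ, 0 < τ ∧ ∃ A B : ℝ, ∀ᵐ R ∂(volume.restrict (Ioo ε 1)), ∀ t ∈ Ioo (-τ) τ,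
      0 < vol n L d R + t * vol n 0 η R ∧ 0 < d R + t * η R ∧
      |densVar n κ h R (vol n L d R + t * vol n 0 η R) (d R + t * η R) (vol n 0 η R) (η R)| ≤
        A + B * d R ^ n := by
  have hn0 : (0 : ℝ) < n := by exact_mod_cast (by omega : 0 < n)
  have hn1 : (0 : ℝ) ≤ n - 1 := by
    have : (2 : ℝ) ≤ n := by exact_mod_cast hn
    linarith
  obtain ⟨C, hC⟩ := isCompact_Icc.exists_bound_of_continuousOn
    (continuousOn_vol (n := n) (L := 0) hε1 hη.integrableOn)
  have hC0 : 0 ≤ C := (norm_nonneg _).trans (hC 1 ⟨hε1.le, le_rfl⟩)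
  set u₀ := vol n L d ε with hu₀
  obtain ⟨Ch, hCh⟩ := isCompact_Icc.exists_bound_of_continuousOn
    (H.continuousOn_deriv.mono fun x (hx : x ∈ Icc (a / 2) (2 * b)) =>
      (show 0 < x by linarith [hx.1]))
  have hmono := (strictMonoOn_vol (L := L) hn hε hd.integrableOn hd.pos).monotoneOn
  -- for such `t`, the volume coordinate stays above `u₀ / 2`, and `d + t η` stays above `a / 2`
  -- where `η` does not vanish
  refine ⟨min (a / 2) (u₀ / (2 * (C + 1))), by positivity,
    κ * (4 * |b| / u₀) ^ (n - 1) + |Ch| + κ * (n - 1) / n * C / ε ^ n,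
    κ * (n - 1) / n * C / ε ^ n * (4 / u₀) ^ n, ?_⟩
  filter_upwards [hd.pos, ae_restrict_mem measurableSet_Ioo] with R p hR t ht
  have hR0 := hε.trans hR.1
  have hRI := Ioo_subset_Icc_self hR
  have ht1 : |t| < a / 2 := (abs_lt.2 ht).trans_le (min_le_left _ _)
  have ht2 : |t| < u₀ / (2 * (C + 1)) := (abs_lt.2 ht).trans_le (min_le_right _ _)
  have hu : u₀ ≤ vol n L d R := hmono ⟨le_rfl, hε1.le⟩ hRI hR.1.le
  have hU := hC R hRI
  rw [Real.norm_eq_abs] at hU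
  have htU : |t * vol n 0 η R| ≤ u₀ / 2 := by
    rw [abs_mul]
    calc |t| * |vol n 0 η R| ≤ u₀ / (2 * (C + 1)) * (C + 1) :=
          mul_le_mul ht2.le (by linarith) (abs_nonneg _) (by positivity)
      _ = u₀ / 2 := by field_simp
  have hw : u₀ / 2 ≤ vol n L d R + t * vol n 0 η R := by
    linarith [(abs_le.1 htU).1]
  have htη : |t * η R| ≤ a / 2 := by
    rw [abs_mul]
    calc |t| * |η R| ≤ a / 2 * 1 := mul_le_mul ht1.le (hη.abs_le R) (abs_nonneg _) (by positivity)
      _ = a / 2 := mul_one _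
  have hD : 0 < d R + t * η R ∧ d R + t * η R ≤ 2 * d R := by
    by_cases hηR : η R = 0
    · rw [hηR, mul_zero, add_zero]; exact ⟨p, by linarith⟩
    · have := hη.mem R hηR
      have := abs_le.1 htη
      constructor <;> linarith [this.1, this.2, (hη.mem R hηR).1]
  have hw0 : 0 < vol n L d R + t * vol n 0 η R := by linarith
  refine ⟨hw0, hD.1, ?_⟩
  have hR1 : R ^ (n - 1) ≤ 1 := pow_le_one₀ hR0.le hR.2.le
  have hX1 : R ^ n ≤ 1 := pow_le_one₀ hR0.le hR.2.le
  have hq : R ^ n / (vol n L d R + t * vol n 0 η R) ≤ 2 / u₀ := by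
    rw [div_le_div_iff₀ hw0 h0]
    nlinarith
  have hq0 : 0 < R ^ n / (vol n L d R + t * vol n 0 η R) := by positivity
  unfold densVar
  generalize R ^ n / (vol n L d R + t * vol n 0 η R) = q at hq hq0 ⊢
  have hp : ((d R + t * η R) * q) ^ n ≤ (4 / u₀) ^ n * d R ^ n := by
    rw [← mul_pow]
    refine pow_le_pow_left₀ (by have := hD.1; positivity) ?_ n
    calc (d R + t * η R) * q ≤ (2 * d R) * (2 / u₀) :=
          mul_le_mul hD.2 hq hq0.le (by linarith)
      _ = _ := by ring
  have e1 : |R ^ (n - 1) * (κ * ((d R + t * η R) * q) ^ (n - 1) + deriv h (d R + t * η R)) *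
      η R| ≤ κ * (4 * |b| / u₀) ^ (n - 1) + |Ch| := by
    by_cases hηR : η R = 0
    · rw [hηR, mul_zero, abs_zero]; positivity
    · have hm := hη.mem R hηR
      have h2 := abs_le.1 htη
      have h3 : |deriv h (d R + t * η R)| ≤ |Ch| :=
        (hCh _ ⟨by linarith [hm.1], by linarith [hm.2, hm.1]⟩).trans (le_abs_self _)
      have h4 : ((d R + t * η R) * q) ^ (n - 1) ≤ (4 * |b| / u₀) ^ (n - 1) := by
        refine pow_le_pow_left₀ (by have := hD.1; positivity) ?_ _
        calc (d R + t * η R) * q ≤ (2 * |b|) * (2 / u₀) :=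
              mul_le_mul (by linarith [hD.2, hm.2, le_abs_self b]) hq hq0.le (by positivity)
          _ = _ := by ring
      have h5 : |κ * ((d R + t * η R) * q) ^ (n - 1) + deriv h (d R + t * η R)| ≤
          κ * (4 * |b| / u₀) ^ (n - 1) + |Ch| := by
        refine (abs_add_le _ _).trans (add_le_add ?_ h3)
        rw [abs_of_nonneg (by have := hD.1; positivity)]
        exact mul_le_mul_of_nonneg_left h4 hκ.le
      rw [abs_mul, abs_mul, abs_of_nonneg (show 0 ≤ R ^ (n - 1) by positivity)]
      calc _ ≤ 1 * (κ * (4 * |b| / u₀) ^ (n - 1) + |Ch|) * 1 :=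
            mul_le_mul (mul_le_mul hR1 h5 (abs_nonneg _) zero_le_one) (hη.abs_le R) (abs_nonneg _)
              (by positivity)
        _ = _ := by ring
  have e2 : |R ^ (n - 1) * (κ * (n - 1) / n * (1 - ((d R + t * η R) * q) ^ n) / R ^ n) *
      vol n 0 η R| ≤ κ * (n - 1) / n * C / ε ^ n + κ * (n - 1) / n * C / ε ^ n * (4 / u₀) ^ n *
        d R ^ n := by
    have h6 : |1 - ((d R + t * η R) * q) ^ n| ≤ 1 + (4 / u₀) ^ n * d R ^ n := by
      refine (abs_sub _ _).trans ?_
      rw [abs_one, abs_of_nonneg (by have := hD.1; positivity)]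
      linarith
    have hc : 0 ≤ κ * (n - 1) / n := by positivity
    have hεn : ε ^ n ≤ R ^ n := pow_le_pow_left₀ hε.le hR.1.le n
    have hεn0 : 0 < ε ^ n := by positivity
    have h7 : |κ * (n - 1) / n * (1 - ((d R + t * η R) * q) ^ n) / R ^ n| ≤
        κ * (n - 1) / n * (1 + (4 / u₀) ^ n * d R ^ n) / ε ^ n := by
      rw [abs_div, abs_mul, abs_of_nonneg hc, abs_of_nonneg (hεn0.le.trans hεn)]
      exact div_le_div₀ (by positivity) (mul_le_mul_of_nonneg_left h6 hc) hεn0 hεn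
    rw [abs_mul, abs_mul, abs_of_nonneg (show 0 ≤ R ^ (n - 1) by positivity)]
    calc _ ≤ 1 * (κ * (n - 1) / n * (1 + (4 / u₀) ^ n * d R ^ n) / ε ^ n) * C :=
          mul_le_mul (mul_le_mul hR1 h7 (abs_nonneg _) zero_le_one) hU (abs_nonneg _)
            (by positivity)
      _ = _ := by ring
  refine (abs_add_le _ _).trans ?_
  linarith

/-- Differentiability of the bulk energy along admissible variations. -/
theorem hasDerivAt_bulkEnergy (hn : 2 ≤ n) (hκ : 0 < κ) (hε : 0 < ε) (hε1 : ε < 1)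
    (H : IsBulkEnergy h) (hd : FiniteEnergy n κ h ε L d) (h0 : 0 < vol n L d ε) (ha : 0 < a)
    (hη : IsVariation ε d a b η) :
    (∀ᶠ t in 𝓝 (0 : ℝ), FiniteEnergy n κ h ε L (fun R => d R + t * η R)) ∧
    IntegrableOn (fun R => densVar n κ h R (vol n L d R) (d R) (vol n 0 η R) (η R)) (Ioo ε 1) ∧
    HasDerivAt (fun t : ℝ => bulkEnergy n κ h ε L (fun R => d R + t * η R))
      (∫ R in Ioo ε 1, densVar n κ h R (vol n L d R) (d R) (vol n 0 η R) (η R)) 0 := by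
  obtain ⟨τ, hτ, A, B, hbd⟩ := exists_bound_densVar hn hκ hε hε1 H hd h0 ha hη
  have hs : Ioo (-τ) τ ∈ 𝓝 (0 : ℝ) := Ioo_mem_nhds (by linarith) hτ
  have hηi := hη.integrableOn
  have hint : ∀ t : ℝ, IntegrableOn (fun R => d R + t * η R) (Ioo ε 1) := fun t =>
    hd.integrableOn.add (hηi.const_mul t)
  have hposv : ∀ t ∈ Ioo (-τ) τ, ∀ᵐ R ∂(volume.restrict (Ioo ε 1)), 0 < d R + t * η R :=
    fun t ht => hbd.mono fun R hR => (hR t ht).2.1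
  have hum : AEStronglyMeasurable (vol n L d) (volume.restrict (Ioo ε 1)) :=
    ((continuousOn_vol hε1 hd.integrableOn).mono
      Ioo_subset_Icc_self).aestronglyMeasurable measurableSet_Ioo
  have hUm : AEStronglyMeasurable (vol n 0 η) (volume.restrict (Ioo ε 1)) :=
    ((continuousOn_vol hε1 hηi).mono
      Ioo_subset_Icc_self).aestronglyMeasurable measurableSet_Ioo
  have hBi : IntegrableOn (fun R => A + B * d R ^ n) (Ioo ε 1) :=
    (integrableOn_const (C := A) (by simp)).add ((hd.integrableOn_pow hn hκ hε hε1 H).const_mul B)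
  let F : ℝ → ℝ → ℝ := fun t R => dens n κ h R (vol n L d R + t * vol n 0 η R) (d R + t * η R)
  let F' : ℝ → ℝ → ℝ := fun t R =>
    densVar n κ h R (vol n L d R + t * vol n 0 η R) (d R + t * η R) (vol n 0 η R) (η R)
  have hFm : ∀ t ∈ Ioo (-τ) τ, AEStronglyMeasurable (F t) (volume.restrict (Ioo ε 1)) :=
    fun t ht => aestronglyMeasurable_dens H (hum.add (hUm.const_mul t))
      (hint t).aestronglyMeasurable (hposv t ht)
  have hF0 : F 0 = fun R => dens n κ h R (vol n L d R) (d R) := by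
    ext R; simp [F]
  have hF'0 : F' 0 = fun R => densVar n κ h R (vol n L d R) (d R) (vol n 0 η R) (η R) := by
    ext R; simp [F']
  have hF'm : AEStronglyMeasurable (F' 0) (volume.restrict (Ioo ε 1)) := by
    have m1 := (aestronglyMeasurable_comp_of_pos H.continuousOn_deriv
      hd.integrableOn.aestronglyMeasurable hd.pos).aemeasurable
    have m2 := hum.aemeasurable
    have m3 := hUm.aemeasurable
    have m4 := hd.integrableOn.aestronglyMeasurable.aemeasurable
    have m5 := hη.meas.aemeasurable
    have key : ∀ g : ℝ → ℝ, AEMeasurable g (volume.restrict (Ioo ε 1)) →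
        AEMeasurable (fun R => R ^ (n - 1) * (κ * (d R * (R ^ n / vol n L d R)) ^ (n - 1) + g R)
          * η R + R ^ (n - 1) * (κ * (n - 1) / n * (1 - (d R * (R ^ n / vol n L d R)) ^ n) /
            R ^ n) * vol n 0 η R) (volume.restrict (Ioo ε 1)) := by
      intro g hg
      fun_prop
    rw [hF'0]
    exact (key _ m1).aestronglyMeasurable
  have hdiff : ∀ᵐ R ∂(volume.restrict (Ioo ε 1)), ∀ t ∈ Ioo (-τ) τ,
      HasDerivAt (F · R) (F' t R) t := by
    filter_upwards [hbd, ae_restrict_mem measurableSet_Ioo] with R h1 hR t ht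
    exact hasDerivAt_dens hn H (hε.trans hR.1) (h1 t ht).1 (h1 t ht).2.1
  have hbd' : ∀ᵐ R ∂(volume.restrict (Ioo ε 1)), ∀ t ∈ Ioo (-τ) τ, ‖F' t R‖ ≤ A + B * d R ^ n :=
    hbd.mono fun R h1 t ht => (h1 t ht).2.2
  have hmain := hasDerivAt_integral_of_dominated_loc_of_deriv_le (μ := volume.restrict (Ioo ε 1))
    (F := F) (F' := F') (x₀ := (0 : ℝ)) (bound := fun R => A + B * d R ^ n) hs
    (by filter_upwards [hs] with t ht using hFm t ht) (by rw [hF0]; exact hd.energy) hF'm hbd' hBi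
    hdiff
  have hvol : ∀ t, ∀ R ∈ Icc ε 1, vol n L (fun R => d R + t * η R) R =
      vol n L d R + t * vol n 0 η R := fun t R hR => vol_add_mul hε1 hd.integrableOn hηi t hR
  have hdens : ∀ t, (fun R => dens n κ h R (vol n L (fun R => d R + t * η R) R) (d R + t * η R))
      =ᵐ[volume.restrict (Ioo ε 1)] F t := fun t => by
    filter_upwards [ae_restrict_mem measurableSet_Ioo] with R hR
    rw [hvol t R (Ioo_subset_Icc_self hR)]
  refine ⟨?_, ?_, ?_⟩
  · have hcont : ContinuousAt (fun t : ℝ => vol n L d ε + t * vol n 0 η ε) 0 := by fun_prop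
    have h1 : ∀ᶠ t in 𝓝 (0 : ℝ), 0 < vol n L d ε + t * vol n 0 η ε :=
      hcont.eventually (lt_mem_nhds (by simpa using h0))
    filter_upwards [hs, h1] with t ht h2
    refine ⟨hint t, hposv t ht, by rw [hvol t ε ⟨le_rfl, hε1.le⟩]; exact h2.le, ?_⟩
    refine Integrable.congr ?_ (hdens t).symm
    have h3 : IntegrableOn (fun R => F t R - F 0 R) (Ioo ε 1) := by
      refine Integrable.mono' (hBi.norm.mul_const |t|) ((hFm t ht).sub (hFm 0 (mem_of_mem_nhds hs)))
        ?_
      filter_upwards [hdiff, hbd'] with R h4 h5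
      have h6 := (convex_Ioo (-τ) τ).norm_image_sub_le_of_norm_hasDerivWithin_le
        (f := fun t => F t R) (fun s hs' => (h4 s hs').hasDerivWithinAt)
        (fun s hs' => (h5 s hs').trans (le_abs_self _)) (mem_of_mem_nhds hs) ht
      simpa using h6
    have h7 : IntegrableOn (F 0) (Ioo ε 1) := by rw [hF0]; exact hd.energy
    refine (h3.add h7).congr (Eventually.of_forall fun R => ?_)
    simp
  · rw [← hF'0]; exact hmain.1
  · rw [← hF'0]
    refine hmain.2.congr_of_eventuallyEq (Eventually.of_forall fun t => ?_)
    exact integral_congr_ae (hdens t)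

end Variation

/-! ### Critical points and the integrated Euler-Lagrange equation -/

section Critical

variable {n : ℕ} {κ ε L : ℝ} {h : ℝ → ℝ} {d : ℝ → ℝ}

/-- The derivative of the boundary term. -/
noncomputable def bdrySlope (n : ℕ) (κ ε x : ℝ) : ℝ :=
  κ * (n - 1) / n ^ 2 * (Real.log (x / ε ^ n) + 1)

theorem hasDerivAt_bdry (hε : 0 < ε) {x : ℝ} (hx : 0 < x) :
    HasDerivAt (bdry n κ ε) (bdrySlope n κ ε x) x := by
  have hεn : 0 < ε ^ n := by positivity
  have h1 : HasDerivAt (fun x : ℝ => x / ε ^ n) (1 / ε ^ n) x := (hasDerivAt_id x).div_const _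
  have h2 := h1.log (by positivity)
  have h3 := ((hasDerivAt_id x).mul h2).const_mul (κ * (n - 1) / n ^ 2)
  refine h3.congr_deriv ?_
  unfold bdrySlope
  simp only [id]
  field_simp

/-- Critical points of the reduced energy with a nondegenerate cavity: the first variation of the
bulk energy balances that of the boundary term. -/
structure IsCritical (n : ℕ) (κ : ℝ) (h : ℝ → ℝ) (ε L : ℝ) (d : ℝ → ℝ) : Prop where
  finiteEnergy : FiniteEnergy n κ h ε L d
  bdry_pos : 0 < vol n L d ε
  stationary : ∀ (a b : ℝ) (η : ℝ → ℝ), 0 < a → IsVariation ε d a b η →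
    ∫ R in Ioo ε 1, densVar n κ h R (vol n L d R) (d R) (vol n 0 η R) (η R) =
      bdrySlope n κ ε (vol n L d ε) * vol n 0 η ε

/-- Criticality may be tested with any function `g` that has the derivative of minus the boundary
term, instead of the boundary term along the variation itself. -/
theorem isCritical_of_isLocalMin (hn : 2 ≤ n) (hκ : 0 < κ) (hε : 0 < ε) (hε1 : ε < 1)
    (H : IsBulkEnergy h) (hd : FiniteEnergy n κ h ε L d) (h0 : 0 < vol n L d ε)
    (hmin : ∀ (a b : ℝ) (η : ℝ → ℝ), 0 < a → IsVariation ε d a b η → ∃ g : ℝ → ℝ,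
      HasDerivAt g (-(bdrySlope n κ ε (vol n L d ε) * vol n 0 η ε)) 0 ∧
      IsLocalMin (fun t : ℝ => bulkEnergy n κ h ε L (fun R => d R + t * η R) + g t) 0) :
    IsCritical n κ h ε L d := by
  refine ⟨hd, h0, fun a b η ha hη => ?_⟩
  obtain ⟨g, hg, hm⟩ := hmin a b η ha hη
  obtain ⟨-, -, hD⟩ := hasDerivAt_bulkEnergy hn hκ hε hε1 H hd h0 ha hη
  have := hm.hasDerivAt_eq_zero (hD.add hg)
  linarith

theorem IsRedMin.isCritical (hn : 2 ≤ n) (hκ : 0 < κ) (hε : 0 < ε) (hε1 : ε < 1)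
    (H : IsBulkEnergy h) (hd : IsRedMin n κ h ε L univ d) (h0 : 0 < vol n L d ε) :
    IsCritical n κ h ε L d := by
  have hfe := hd.finiteEnergy
  refine isCritical_of_isLocalMin hn hκ hε hε1 H hfe h0 fun a b η ha hη => ?_
  obtain ⟨hev, -, -⟩ := hasDerivAt_bulkEnergy hn hκ hε hε1 H hfe h0 ha hη
  have hlin : HasDerivAt (fun t : ℝ => vol n L d ε + t * vol n 0 η ε) (vol n 0 η ε) 0 := by
    simpa using ((hasDerivAt_id (0 : ℝ)).mul_const (vol n 0 η ε)).const_add (vol n L d ε)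
  refine ⟨fun t => - bdry n κ ε (vol n L d ε + t * vol n 0 η ε), ?_, ?_⟩
  · have h1 : HasDerivAt (bdry n κ ε) (bdrySlope n κ ε (vol n L d ε))
        (vol n L d ε + 0 * vol n 0 η ε) := by
      rw [zero_mul, add_zero]; exact hasDerivAt_bdry hε h0
    exact (h1.comp (0 : ℝ) hlin).neg
  · filter_upwards [hev] with t ht
    have h1 := hd.le _ ht (mem_univ _)
    unfold redEnergy at h1
    rw [vol_add_mul hε1 hfe.integrableOn hη.integrableOn t ⟨le_rfl, hε1.le⟩] at h1
    simp only [zero_mul, add_zero]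
    linarith

/-- The right-hand side of the integrated Euler-Lagrange equation. -/
noncomputable def fluxOf (n : ℕ) (κ ε L : ℝ) (d : ℝ → ℝ) (R : ℝ) : ℝ :=
  (∫ S in ε..R, κ * (n - 1) * (1 - strainRatio n L d S ^ n) / S) -
    n * bdrySlope n κ ε (vol n L d ε)

theorem IsCritical.integrableOn_flux (hn : 2 ≤ n) (hκ : 0 < κ) (hε : 0 < ε) (hε1 : ε < 1)
    (H : IsBulkEnergy h) (hd : IsCritical n κ h ε L d) :
    IntegrableOn (fun S => κ * (n - 1) * (1 - strainRatio n L d S ^ n) / S) (Ioo ε 1) := by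
  have hp := hd.finiteEnergy.integrableOn_strainRatio_pow hn hκ hε hε1 H hd.bdry_pos
  have h1 : IntegrableOn (fun S => κ * (n - 1) * (1 - strainRatio n L d S ^ n)) (Ioo ε 1) :=
    ((integrableOn_const (C := (1 : ℝ)) (by simp)).sub hp).const_mul _
  have hc : ContinuousOn (fun S : ℝ => S⁻¹) (Icc ε 1) :=
    continuousOn_id.inv₀ fun x hx => (hε.trans_le hx.1).ne'
  obtain ⟨C, hC⟩ := isCompact_Icc.exists_bound_of_continuousOn hc
  exact Integrable.mul_bdd (c := C) h1
    ((hc.mono Ioo_subset_Icc_self).aestronglyMeasurable measurableSet_Ioo)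
    ((ae_restrict_mem measurableSet_Ioo).mono fun x hx => hC x (Ioo_subset_Icc_self hx))

/-- The Euler-Lagrange equation in integrated form, including the natural boundary condition, which
fixes the constant of integration. -/
theorem IsCritical.eulerLagrange (hn : 2 ≤ n) (hκ : 0 < κ) (hε : 0 < ε) (hε1 : ε < 1)
    (H : IsBulkEnergy h) (hd : IsCritical n κ h ε L d) :
    ∀ᵐ R ∂(volume.restrict (Ioo ε 1)),
      κ * strainRatio n L d R ^ (n - 1) + deriv h (d R) = fluxOf n κ ε L d R := by
  have hn0 : (0 : ℝ) < n := by exact_mod_cast (by omega : 0 < n)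
  have hfe := hd.finiteEnergy
  set β := bdrySlope n κ ε (vol n L d ε) with hβ
  set m : ℝ → ℝ := fun S => κ * (n - 1) * (1 - strainRatio n L d S ^ n) / S with hm
  have hmi : IntegrableOn m (Ioo ε 1) := hd.integrableOn_flux hn hκ hε hε1 H
  set M : ℝ → ℝ := fun R => ∫ S in ε..R, m S with hM
  have hMp : IsPrim ε 1 M m := by
    have hii : IntervalIntegrable m volume ε 1 :=
      (intervalIntegrable_iff_integrableOn_Ioo_of_le hε1.le).2 hmi
    refine ⟨hmi, fun x hx => ?_⟩
    have h1 : IntervalIntegrable m volume ε x := hii.mono_set (by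
      rw [uIcc_of_le hε1.le, uIcc_of_le hx.1]; exact Icc_subset_Icc le_rfl hx.2)
    have h2 : IntervalIntegrable m volume x 1 := hii.mono_set (by
      rw [uIcc_of_le hε1.le, uIcc_of_le hx.2]; exact Icc_subset_Icc hx.1 le_rfl)
    simp only [hM]
    rw [← intervalIntegral.integral_add_adjacent_intervals h1 h2]
    ring
  -- the defect in the equation, weighted by `R^{n-1}`
  let f : ℝ → ℝ := fun R => R ^ (n - 1) *
    (κ * strainRatio n L d R ^ (n - 1) + deriv h (d R) - (M R - n * β))
  have hfm : AEStronglyMeasurable f (volume.restrict (Ioo ε 1)) := by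
    have m1 := (aestronglyMeasurable_comp_of_pos H.continuousOn_deriv
      hfe.integrableOn.aestronglyMeasurable hfe.pos).aemeasurable
    have m2 : AEMeasurable (vol n L d) (volume.restrict (Ioo ε 1)) :=
      (((continuousOn_vol hε1 hfe.integrableOn).mono
      Ioo_subset_Icc_self).aestronglyMeasurable measurableSet_Ioo).aemeasurable
    have m3 : AEMeasurable M (volume.restrict (Ioo ε 1)) :=
      (((hMp.continuousOn hε1.le).mono
      Ioo_subset_Icc_self).aestronglyMeasurable measurableSet_Ioo).aemeasurable
    have m4 := hfe.integrableOn.aestronglyMeasurable.aemeasurable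
    have key : ∀ g : ℝ → ℝ, AEMeasurable g (volume.restrict (Ioo ε 1)) →
        AEMeasurable (fun R => R ^ (n - 1) * (κ * (d R * (R ^ n / vol n L d R)) ^ (n - 1) + g R
          - (M R - n * β))) (volume.restrict (Ioo ε 1)) := by
      intro g hg
      fun_prop
    exact (key _ m1).aestronglyMeasurable
  -- testing with `η` and integrating by parts gives `∫ f η = 0`
  have key : ∀ (a b : ℝ) (η : ℝ → ℝ), 0 < a → IsVariation ε d a b η →
      IntegrableOn (fun R => f R * η R) (Ioo ε 1) ∧ ∫ R in Ioo ε 1, f R * η R = 0 := by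
    intro a b η ha hη
    obtain ⟨-, hi, -⟩ := hasDerivAt_bulkEnergy hn hκ hε hε1 H hfe hd.bdry_pos ha hη
    have hstat := hd.stationary a b η ha hη
    have hU := isPrim_vol (n := n) (L := 0) hη.integrableOn
    have hMU := hMp.mul hU hε1.le
    have h1 := hMU.setIntegral_eq hε1.le
    have hMε : M ε = 0 := by simp [hM]
    rw [vol_one, hMε, mul_zero, zero_mul, sub_zero] at h1
    have h2 := hU.setIntegral_eq hε1.le
    rw [vol_one, zero_sub] at h2
    have heq : (fun R => f R * η R) =ᵐ[volume.restrict (Ioo ε 1)] fun R =>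
        (densVar n κ h R (vol n L d R) (d R) (vol n 0 η R) (η R) +
          β * (n * R ^ (n - 1) * η R)) -
        1 / n * (m R * vol n 0 η R + M R * (n * R ^ (n - 1) * η R)) := by
      filter_upwards [ae_restrict_mem measurableSet_Ioo] with R hR
      have hR0 : 0 < R := hε.trans hR.1
      have h3 : R ^ n = R ^ (n - 1) * R := by rw [← pow_succ]; congr 1; omega
      have h4 : R ^ (n - 1) * (κ * (n - 1) / n * (1 - (d R * (R ^ n / vol n L d R)) ^ n) / R ^ n) =
          1 / n * m R := by
        change _ = 1 / n * (κ * (n - 1) * (1 - (d R * (R ^ n / vol n L d R)) ^ n) / R)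
        generalize (d R * (R ^ n / vol n L d R)) ^ n = c
        rw [h3]
        have := pow_pos hR0 (n - 1)
        field_simp
      unfold densVar
      rw [h4]
      simp only [f, strainRatio]
      field_simp
      ring
    have hi2 : IntegrableOn (fun R => densVar n κ h R (vol n L d R) (d R) (vol n 0 η R) (η R) +
          β * (n * R ^ (n - 1) * η R)) (Ioo ε 1) := hi.add (hU.integrableOn.const_mul β)
    have hi3 := hMU.integrableOn.const_mul (1 / n : ℝ)
    refine ⟨(hi2.sub hi3).congr heq.symm, ?_⟩
    rw [integral_congr_ae heq, integral_sub hi2 hi3, integral_add hi (hU.integrableOn.const_mul β),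
      integral_const_mul, integral_const_mul, h1, h2, hstat]
    ring
  -- hence `f = 0` where `d` is bounded and bounded away from `0`
  have hloc : ∀ k : ℕ, ∀ᵐ R ∂(volume.restrict (Ioo ε 1)),
      d R ∈ Icc (1 / ((k : ℝ) + 1)) (k + 1) → f R = 0 := by
    intro k
    set dm := hfe.integrableOn.aestronglyMeasurable.mk d with hdm
    have hdmm : Measurable dm :=
      hfe.integrableOn.aestronglyMeasurable.stronglyMeasurable_mk.measurable
    have hdae : d =ᵐ[volume.restrict (Ioo ε 1)] dm := hfe.integrableOn.aestronglyMeasurable.ae_eq_mk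
    classical
    let η : ℝ → ℝ := fun R => if d R ∈ Icc (1 / ((k : ℝ) + 1)) (k + 1) then f R / (1 + |f R|) else 0
    have hη : IsVariation ε d (1 / ((k : ℝ) + 1)) (k + 1) η := by
      refine ⟨?_, fun R => ?_, fun R hR => ?_⟩
      · have h1 : AEStronglyMeasurable
            ((dm ⁻¹' Icc (1 / ((k : ℝ) + 1)) (k + 1)).indicator fun R => f R / (1 + |f R|))
            (volume.restrict (Ioo ε 1)) := by
          refine AEStronglyMeasurable.indicator ?_ (hdmm measurableSet_Icc)
          have := hfm.aemeasurable
          refine AEMeasurable.aestronglyMeasurable ?_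
          exact this.div (aemeasurable_const.add this.abs)
        refine h1.congr ?_
        filter_upwards [hdae] with R hR
        simp only [η, indicator, mem_preimage, hR]
      · simp only [η]
        split_ifs
        · rw [abs_div, abs_of_pos (show 0 < 1 + |f R| by positivity), div_le_one (by positivity)]
          linarith
        · simp
      · by_contra hn
        exact hR (by simp only [η, if_neg hn])
    obtain ⟨i1, i2⟩ := key _ _ η (by positivity) hη
    have hnn : ∀ R, 0 ≤ f R * η R := by
      intro R
      simp only [η]
      split_ifs
      · have : f R * (f R / (1 + |f R|)) = f R ^ 2 / (1 + |f R|) := by ring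
        rw [this]; positivity
      · simp
    have hz := (integral_eq_zero_iff_of_nonneg hnn i1).1 i2
    filter_upwards [hz] with R hR hmem
    simp only [η, if_pos hmem, Pi.zero_apply] at hR
    have : 1 + |f R| ≠ 0 := by positivity
    field_simp at hR
    simpa using hR
  filter_upwards [ae_all_iff.2 hloc, hfe.pos, ae_restrict_mem measurableSet_Ioo] with R h1 p hR
  obtain ⟨k₁, hk₁⟩ := exists_nat_ge (d R)
  obtain ⟨k₂, hk₂⟩ := exists_nat_ge (1 / d R)
  have hk : d R ∈ Icc (1 / (((max k₁ k₂ : ℕ) : ℝ) + 1)) (((max k₁ k₂ : ℕ) : ℝ) + 1) := by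
    have e1 : (k₁ : ℝ) ≤ ((max k₁ k₂ : ℕ) : ℝ) := by exact_mod_cast le_max_left _ _
    have e2 : (k₂ : ℝ) ≤ ((max k₁ k₂ : ℕ) : ℝ) := by exact_mod_cast le_max_right _ _
    constructor
    · rw [div_le_iff₀ (by positivity)]
      rw [div_le_iff₀ p] at hk₂
      nlinarith
    · linarith
  have h2 := h1 _ hk
  have hR0 : R ^ (n - 1) ≠ 0 := (pow_pos (hε.trans hR.1) _).ne'
  have h3 := (mul_eq_zero.1 h2).resolve_left hR0
  unfold fluxOf
  linarith

end Critical

/-! ### Regularity of critical points -/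

section Regularity

variable {n : ℕ} {κ ε L : ℝ} {h : ℝ → ℝ} {d : ℝ → ℝ} {a b : ℝ} {f g : ℝ → ℝ}

theorem IsPrim.hasDerivWithinAt (hf : IsPrim a b f g) (hg : ContinuousOn g (Icc a b)) {x : ℝ}
    (hx : x ∈ Icc a b) : HasDerivWithinAt f (g x) (Icc a b) x := by
  have hab : a ≤ b := hx.1.trans hx.2
  let G : ℝ → ℝ := IccExtend hab ((Icc a b).domRestrict g)
  have hG : Continuous G := (continuousOn_iff_continuous_domRestrict.1 hg).Icc_extend'
  have hGg : ∀ y ∈ Icc a b, G y = g y := fun y hy => by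
    simp only [G, IccExtend_of_mem hab _ hy, domRestrict_apply]
  have h1 : HasDerivAt (fun y => f b + ∫ t in b..y, G t) (G x) x :=
    (intervalIntegral.integral_hasDerivAt_right (hG.intervalIntegrable _ _)
      (hG.stronglyMeasurableAtFilter _ _) hG.continuousAt).const_add _
  rw [hGg x hx] at h1
  have h2 : ∀ y ∈ Icc a b, f y = f b + ∫ t in b..y, G t := by
    intro y hy
    rw [hf.eq_sub y hy, intervalIntegral.integral_symm, sub_neg_eq_add]
    congr 1
    refine intervalIntegral.integral_congr fun t ht => (hGg t ?_).symm
    rw [uIcc_of_ge hy.2] at ht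
    exact ⟨hy.1.trans ht.1, ht.2⟩
  exact h1.hasDerivWithinAt.congr h2 (h2 x hx)

theorem contDiffOn_succ_of_hasDerivWithinAt (hab : a < b) {k : ℕ}
    (hf : ∀ x ∈ Icc a b, HasDerivWithinAt f (g x) (Icc a b) x) (hg : ContDiffOn ℝ k g (Icc a b)) :
    ContDiffOn ℝ (k + 1) f (Icc a b) := by
  rw [contDiffOn_succ_iff_derivWithin (uniqueDiffOn_Icc hab)]
  refine ⟨fun x hx => (hf x hx).differentiableWithinAt, by simp, hg.congr fun x hx => ?_⟩
  exact (hf x hx).derivWithin (uniqueDiffOn_Icc hab x hx)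

/-- The unique positive solution `p` of `κ p^{n-1} + h'(p y) = q`. -/
noncomputable def strainOf (n : ℕ) (κ : ℝ) (h : ℝ → ℝ) (y q : ℝ) : ℝ :=
  Classical.epsilon fun p => 0 < p ∧ κ * p ^ (n - 1) + deriv h (p * y) = q

theorem strictMonoOn_flux (hκ : 0 < κ) (H : IsBulkEnergy h) {y : ℝ} (hy : 0 < y) :
    StrictMonoOn (fun p => κ * p ^ (n - 1) + deriv h (p * y)) (Ioi 0) := by
  intro p hp p' hp' hpp
  have hp0 : 0 < p := hp
  have h1 : p ^ (n - 1) ≤ p' ^ (n - 1) := pow_le_pow_left₀ hp0.le hpp.le _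
  have h2 := H.strictMonoOn_deriv (mul_pos hp hy) (mul_pos hp' hy)
    (mul_lt_mul_of_pos_right hpp hy)
  have h3 := mul_le_mul_of_nonneg_left h1 hκ.le
  simp only
  linarith

theorem strainOf_spec (hκ : 0 < κ) (H : IsBulkEnergy h) {y : ℝ} (hy : 0 < y) (q : ℝ) :
    0 < strainOf n κ h y q ∧
      κ * strainOf n κ h y q ^ (n - 1) + deriv h (strainOf n κ h y q * y) = q := by
  refine Classical.epsilon_spec (p := fun p => 0 < p ∧ κ * p ^ (n - 1) + deriv h (p * y) = q) ?_
  have h1 : Tendsto (fun p : ℝ => p * y) (𝓝[>] 0) (𝓝[>] 0) := by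
    refine tendsto_nhdsWithin_iff.2 ⟨?_, ?_⟩
    · have : Continuous fun p : ℝ => p * y := by fun_prop
      simpa using (this.tendsto 0).mono_left (nhdsWithin_le_nhds (s := Ioi 0))
    · filter_upwards [self_mem_nhdsWithin] with p hp
      exact mul_pos hp hy
  have h2 := (H.deriv_zero.comp h1).eventually_lt_atBot (q - κ)
  have h2' : ∀ᶠ p : ℝ in 𝓝[>] 0, p ∈ Ioo (0 : ℝ) 1 := Ioo_mem_nhdsGT one_pos
  obtain ⟨p₁, hp₁, hp₁I⟩ := (h2.and h2').exists
  have h3 := (H.deriv_top.comp (tendsto_id.atTop_mul_const hy)).eventually_gt_atTop q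
  obtain ⟨p₂, hp₂, hp₂I⟩ := (h3.and (eventually_ge_atTop 1)).exists
  have hp₂0 : 0 < p₂ := by linarith
  simp only [Function.comp, id] at hp₁ hp₂
  have hc : ContinuousOn (fun p => κ * p ^ (n - 1) + deriv h (p * y)) (Icc p₁ p₂) := by
    refine (by fun_prop : ContinuousOn (fun p => κ * p ^ (n - 1)) (Icc p₁ p₂)).add ?_
    exact H.continuousOn_deriv.comp (by fun_prop) fun p hp => mul_pos (hp₁I.1.trans_le hp.1) hy
  have h4 : q ∈ Icc (κ * p₁ ^ (n - 1) + deriv h (p₁ * y))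
      (κ * p₂ ^ (n - 1) + deriv h (p₂ * y)) := by
    have e1 : p₁ ^ (n - 1) ≤ 1 := pow_le_one₀ hp₁I.1.le hp₁I.2.le
    have e2 : 0 ≤ κ * p₂ ^ (n - 1) := by positivity
    have e3 := mul_le_mul_of_nonneg_left e1 hκ.le
    constructor <;> linarith
  obtain ⟨p, hp, hpq⟩ := intermediate_value_Icc (by linarith [hp₁I.2]) hc h4
  exact ⟨p, hp₁I.1.trans_le hp.1, hpq⟩

theorem strainOf_eq (hκ : 0 < κ) (H : IsBulkEnergy h) {y p q : ℝ} (hy : 0 < y) (hp : 0 < p)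
    (hpq : κ * p ^ (n - 1) + deriv h (p * y) = q) : strainOf n κ h y q = p := by
  obtain ⟨h1, h2⟩ := strainOf_spec (n := n) hκ H hy q
  exact (strictMonoOn_flux (n := n) hκ H hy).injOn h1 hp (h2.trans hpq.symm)

/-- The solution `p` depends on `(y, q)` in a continuously differentiable way. -/
theorem contDiffAt_strainOf (hκ : 0 < κ) (H : IsBulkEnergy h) {y q : ℝ} (hy : 0 < y) :
    ContDiffAt ℝ 1 (fun x : ℝ × ℝ => strainOf n κ h x.1 x.2) (y, q) := by
  obtain ⟨hp, hpq⟩ := strainOf_spec (n := n) hκ H hy q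
  set p := strainOf n κ h y q with hp_def
  let f : (ℝ × ℝ) × ℝ → ℝ := fun z => κ * z.2 ^ (n - 1) + deriv h (z.2 * z.1.1) - z.1.2
  have cdf : ContDiffAt ℝ 1 f ((y, q), p) := by
    have h1 : ContDiffAt ℝ 1 (deriv h) (p * y) :=
      H.contDiffOn_deriv.contDiffAt (Ioi_mem_nhds (mul_pos hp hy))
    have h2 : ContDiffAt ℝ 1 (fun z : (ℝ × ℝ) × ℝ => z.2 * z.1.1) ((y, q), p) := by fun_prop
    have h3 : ContDiffAt ℝ 1 (fun z : (ℝ × ℝ) × ℝ => deriv h (z.2 * z.1.1)) ((y, q), p) :=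
      ContDiffAt.comp _ (g := deriv h) h1 h2
    exact ((contDiffAt_const.mul (contDiffAt_snd.pow _)).add h3).sub (by fun_prop)
  have hinv : (fderiv ℝ f ((y, q), p) ∘L .inr ℝ (ℝ × ℝ) ℝ).IsInvertible := by
    set c := κ * (((n - 1 : ℕ) : ℝ) * p ^ (n - 1 - 1)) + deriv (deriv h) (p * y) * y with hc
    have hc0 : 0 < c := by
      have := H.convex _ (mul_pos hp hy)
      positivity
    refine ⟨ContinuousLinearEquiv.unitsEquivAut ℝ (Units.mk0 c hc0.ne'), ?_⟩
    ext
    have e1 : HasDerivAt (fun s : ℝ => (((y, q), s) : (ℝ × ℝ) × ℝ)) ((0, 1) : (ℝ × ℝ) × ℝ) p :=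
      (hasDerivAt_const p (y, q)).prodMk (hasDerivAt_id p)
    have e2 := ((cdf.differentiableAt (by norm_num)).hasFDerivAt).comp_hasDerivAt p e1
    have e3 : HasDerivAt (fun s : ℝ => κ * s ^ (n - 1) + deriv h (s * y) - q) c p := by
      have e4 : HasDerivAt (fun s : ℝ => s * y) y p := by
        simpa using (hasDerivAt_id p).mul_const y
      have e5 := (H.hasDerivAt_deriv (mul_pos hp hy)).comp p e4
      exact (((hasDerivAt_pow (n - 1) p).const_mul κ).add e5).sub_const q
    have e6 := e2.unique e3
    simpa using e6.symm
  have hself := cdf.implicitFunction_apply_self one_ne_zero hinv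
  have hev := cdf.eventually_apply_implicitFunction one_ne_zero hinv
  have hcd := cdf.contDiffAt_implicitFunction one_ne_zero hinv
  refine hcd.congr_of_eventuallyEq ?_
  have hpos : ∀ᶠ x in 𝓝 ((y, q) : ℝ × ℝ), 0 < cdf.implicitFunction one_ne_zero hinv x := by
    refine hcd.continuousAt.eventually (lt_mem_nhds ?_)
    simp only at hself
    rw [hself]; exact hp
  have hypos : ∀ᶠ x in 𝓝 ((y, q) : ℝ × ℝ), 0 < x.1 :=
    continuousAt_fst.eventually (lt_mem_nhds hy)
  filter_upwards [hev, hpos, hypos] with x h1 h2 h3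
  refine strainOf_eq hκ H h3 h2 ?_
  simp only [f] at h1
  linarith

/-- Solutions of the Euler-Lagrange equation in terms of the ratios `v = r/R` and `p = R r'/r`, in
which it becomes an autonomous system with respect to `log R`. -/
structure IsRadialSolution (n : ℕ) (κ : ℝ) (h : ℝ → ℝ) (a b : ℝ) (v p : ℝ → ℝ) : Prop where
  v_pos : ∀ R ∈ Icc a b, 0 < v R
  p_pos : ∀ R ∈ Icc a b, 0 < p R
  p_smooth : ContDiffOn ℝ 1 p (Icc a b)
  v_deriv : ∀ R ∈ Icc a b, HasDerivWithinAt v (v R * (p R - 1) / R) (Icc a b) R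
  flux_deriv : ∀ R ∈ Icc a b,
    HasDerivWithinAt (fun S => κ * p S ^ (n - 1) + deriv h (p S * v S ^ n))
      (κ * (n - 1) * (1 - p R ^ n) / R) (Icc a b) R

/-- The Cauchy stress in terms of `p = R r'/r` and `v = r/R`. -/
noncomputable def stress (n : ℕ) (κ : ℝ) (h : ℝ → ℝ) (p v : ℝ) : ℝ :=
  κ * p ^ (n - 1) + deriv h (p * v ^ n) + κ * (n - 1) * (Real.log v + 1 / n)

/-- Critical points are classical solutions with vanishing stress at the inner boundary. -/
theorem IsCritical.isRadialSolution (hn : 2 ≤ n) (hκ : 0 < κ) (hε : 0 < ε) (hε1 : ε < 1)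
    (H : IsBulkEnergy h) (hd : IsCritical n κ h ε L d) :
    ∃ p : ℝ → ℝ, IsRadialSolution n κ h ε 1 (fun R => defOfJac n L d R / R) p ∧
      (∀ R ∈ Icc ε 1,
        HasDerivWithinAt (defOfJac n L d) (p R * (defOfJac n L d R / R)) (Icc ε 1) R) ∧
      stress n κ h (p ε) (defOfJac n L d ε / ε) = 0 := by
  have hn0 : (0 : ℝ) < n := by exact_mod_cast (by omega : 0 < n)
  have hfe := hd.finiteEnergy
  have hεI : ε ∈ Icc ε 1 := ⟨le_rfl, hε1.le⟩
  set u := vol n L d with hu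
  have hupos : ∀ R ∈ Icc ε 1, 0 < u R := fun R hR => hd.bdry_pos.trans_le
    ((strictMonoOn_vol hn hε hfe.integrableOn hfe.pos).monotoneOn hεI hR hR.1)
  have hRpos : ∀ R ∈ Icc ε 1, 0 < R := fun R hR => hε.trans_le hR.1
  have hup := isPrim_vol (n := n) (L := L) hfe.integrableOn
  have hmi := hd.integrableOn_flux hn hκ hε hε1 H
  have hfp : IsPrim ε 1 (fluxOf n κ ε L d)
      (fun S => κ * (n - 1) * (1 - strainRatio n L d S ^ n) / S) := by
    have hii : IntervalIntegrable (fun S => κ * (n - 1) * (1 - strainRatio n L d S ^ n) / S)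
        volume ε 1 := (intervalIntegrable_iff_integrableOn_Ioo_of_le hε1.le).2 hmi
    refine ⟨hmi, fun x hx => ?_⟩
    have h1 := hii.mono_set (c := ε) (d := x) (by
      rw [uIcc_of_le hε1.le, uIcc_of_le hx.1]; exact Icc_subset_Icc le_rfl hx.2)
    have h2 := hii.mono_set (c := x) (d := 1) (by
      rw [uIcc_of_le hε1.le, uIcc_of_le hx.2]; exact Icc_subset_Icc hx.1 le_rfl)
    simp only [fluxOf]
    rw [← intervalIntegral.integral_add_adjacent_intervals h1 h2]
    ring
  let y : ℝ → ℝ := fun R => u R / R ^ n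
  have hypos : ∀ R ∈ Icc ε 1, 0 < y R := fun R hR =>
    div_pos (hupos R hR) (pow_pos (hRpos R hR) n)
  -- the integrated equation determines `p = R r'/r` as a smooth function of the continuous
  -- quantities `y = (r/R)^n` and `q`, whose derivatives are in turn continuous functions of `p`
  let q := fluxOf n κ ε L d
  let p : ℝ → ℝ := fun R => strainOf n κ h (y R) (q R)
  have hpspec : ∀ R ∈ Icc ε 1, 0 < p R ∧ κ * p R ^ (n - 1) + deriv h (p R * y R) = q R :=
    fun R hR => strainOf_spec hκ H (hypos R hR) _
  have hqc : ContinuousOn q (Icc ε 1) := hfp.continuousOn hε1.le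
  have huc : ContinuousOn u (Icc ε 1) := hup.continuousOn hε1.le
  have hyc : ContinuousOn y (Icc ε 1) :=
    huc.div (by fun_prop) fun R hR => (pow_pos (hRpos R hR) n).ne'
  have hpc : ContinuousOn p (Icc ε 1) := fun R hR =>
    (contDiffAt_strainOf hκ H (hypos R hR)).continuousAt.comp_continuousWithinAt
      (f := fun R => (y R, q R)) ((hyc R hR).prodMk (hqc R hR))
  have hpae : ∀ᵐ R ∂(volume.restrict (Ioo ε 1)), strainRatio n L d R = p R := by
    filter_upwards [hd.eulerLagrange hn hκ hε hε1 H, hfe.pos, ae_restrict_mem measurableSet_Ioo]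
      with R h1 h2 hR
    have hRI := Ioo_subset_Icc_self hR
    have h3 := hupos R hRI
    have h4 := hRpos R hRI
    refine (strainOf_eq hκ H (hypos R hRI) ?_ ?_).symm
    · unfold strainRatio
      positivity
    · change _ = fluxOf n κ ε L d R
      rw [← h1]
      congr 2
      simp only [strainRatio, y, ← hu]
      field_simp
  have hdae : ∀ᵐ R ∂(volume.restrict (Ioo ε 1)), d R = p R * y R := by
    filter_upwards [hpae, ae_restrict_mem measurableSet_Ioo] with R h1 hR
    have hRI := Ioo_subset_Icc_self hR
    have h3 := hupos R hRI
    have h4 := hRpos R hRI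
    rw [← h1]
    simp only [strainRatio, y, ← hu]
    field_simp
  have hud : ∀ R ∈ Icc ε 1, HasDerivWithinAt u (n * R ^ (n - 1) * (p R * y R)) (Icc ε 1) R := by
    intro R hR
    refine (hup.congr (f' := u) (g' := fun R => n * R ^ (n - 1) * (p R * y R))
      (fun _ _ => rfl) ?_).hasDerivWithinAt ?_ hR
    · filter_upwards [hdae] with R h1
      rw [h1]
    · fun_prop
  have hinvc : ContinuousOn (fun R : ℝ => R⁻¹) (Icc ε 1) :=
    continuousOn_id.inv₀ fun x hx => (hRpos x hx).ne'
  have hqd : ∀ R ∈ Icc ε 1, HasDerivWithinAt q (κ * (n - 1) * (1 - p R ^ n) / R) (Icc ε 1) R := by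
    intro R hR
    refine (hfp.congr (f' := q) (g' := fun R => κ * (n - 1) * (1 - p R ^ n) / R)
      (fun _ _ => rfl) ?_).hasDerivWithinAt ?_ hR
    · filter_upwards [hpae] with R h1
      rw [h1]
    · simp only [div_eq_mul_inv]
      fun_prop
  have hu1 : ContDiffOn ℝ 1 u (Icc ε 1) := by
    have := contDiffOn_succ_of_hasDerivWithinAt hε1 (k := 0) hud (by
      rw [Nat.cast_zero, contDiffOn_zero]; fun_prop)
    simpa using this
  have hq1 : ContDiffOn ℝ 1 q (Icc ε 1) := by
    have := contDiffOn_succ_of_hasDerivWithinAt hε1 (k := 0) hqd (by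
      rw [Nat.cast_zero, contDiffOn_zero]; simp only [div_eq_mul_inv]; fun_prop)
    simpa using this
  have hy1 : ContDiffOn ℝ 1 y (Icc ε 1) :=
    hu1.div (by fun_prop) fun R hR => (pow_pos (hRpos R hR) n).ne'
  have hp1 : ContDiffOn ℝ 1 p (Icc ε 1) := fun R hR =>
    (contDiffAt_strainOf hκ H (hypos R hR)).comp_contDiffWithinAt R
      (f := fun R => (y R, q R)) ((hy1 R hR).prodMk (hq1 R hR))
  set r := defOfJac n L d with hr
  have hrpos : ∀ R ∈ Icc ε 1, 0 < r R := fun R hR => Real.rpow_pos_of_pos (hupos R hR) _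
  have hrn : ∀ R ∈ Icc ε 1, r R ^ n = u R := fun R hR => defOfJac_pow hn (hupos R hR).le
  have hvn : ∀ R ∈ Icc ε 1, (r R / R) ^ n = y R := fun R hR => by
    rw [div_pow, hrn R hR]
  have hrd : ∀ R ∈ Icc ε 1, HasDerivWithinAt r (p R * (r R / R)) (Icc ε 1) R := by
    intro R hR
    have h1 := (hud R hR).rpow_const (p := (n : ℝ)⁻¹) (Or.inl (hupos R hR).ne')
    have h2 : u R ^ ((n : ℝ)⁻¹ - 1) = r R / u R := by
      rw [Real.rpow_sub (hupos R hR), Real.rpow_one]; rfl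
    rw [h2] at h1
    refine h1.congr_deriv ?_
    have h3 := (hupos R hR).ne'
    have h4 := hRpos R hR
    have h5 : R ^ n = R ^ (n - 1) * R := by rw [← pow_succ]; congr 1; omega
    simp only [y]
    rw [h5]
    field_simp
  refine ⟨p, ⟨fun R hR => div_pos (hrpos R hR) (hRpos R hR), fun R hR => (hpspec R hR).1, hp1,
    fun R hR => ?_, fun R hR => ?_⟩, hrd, ?_⟩
  · have h4 := hRpos R hR
    refine ((hrd R hR).div (hasDerivWithinAt_id R _) h4.ne').congr_deriv ?_
    simp only [id]
    field_simp
  · refine (hqd R hR).congr (fun S hS => ?_) ?_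
    · rw [hvn S hS]; exact (hpspec S hS).2
    · rw [hvn R hR]; exact (hpspec R hR).2
  · unfold stress
    rw [hvn ε hεI, (hpspec ε hεI).2]
    simp only [q, fluxOf, intervalIntegral.integral_same, bdrySlope]
    have h6 : Real.log (u ε / ε ^ n) = n * Real.log (r ε / ε) := by
      rw [← hrn ε hεI, ← div_pow, Real.log_pow]
    rw [h6]
    field_simp
    ring

end Regularity

/-! ### Comparison of solutions of the Euler-Lagrange equation -/

section Comparison

variable {n : ℕ} {κ a b : ℝ} {h : ℝ → ℝ} {v p w q : ℝ → ℝ}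

theorem monotoneOn_of_hasDerivWithinAt_nonneg {f f' : ℝ → ℝ}
    (hf : ∀ x ∈ Icc a b, HasDerivWithinAt f (f' x) (Icc a b) x)
    (hf' : ∀ x ∈ Icc a b, 0 ≤ f' x) : MonotoneOn f (Icc a b) := by
  refine monotoneOn_of_deriv_nonneg (convex_Icc a b) (fun x hx => (hf x hx).continuousWithinAt)
    (fun x hx => ?_) fun x hx => ?_ <;> rw [interior_Icc] at hx
  · exact ((hf x (Ioo_subset_Icc_self hx)).hasDerivAt
      (Icc_mem_nhds hx.1 hx.2)).differentiableAt.differentiableWithinAt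
  · rw [((hf x (Ioo_subset_Icc_self hx)).hasDerivAt (Icc_mem_nhds hx.1 hx.2)).deriv]
    exact hf' x (Ioo_subset_Icc_self hx)

theorem lt_of_hasDerivWithinAt_nonneg {f f' : ℝ → ℝ}
    (hf : ∀ x ∈ Icc a b, HasDerivWithinAt f (f' x) (Icc a b) x)
    (hf' : ∀ x ∈ Icc a b, 0 ≤ f' x) (ha : 0 < f' a) {x : ℝ} (hx : x ∈ Ioc a b) : f a < f x := by
  have hmono := monotoneOn_of_hasDerivWithinAt_nonneg hf hf'
  have hab : a ≤ b := hx.1.le.trans hx.2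
  have haI : a ∈ Icc a b := ⟨le_rfl, hab⟩
  refine lt_of_le_of_ne (hmono haI ⟨hx.1.le, hx.2⟩ hx.1.le) fun heq => ha.ne' ?_
  have h1 : HasDerivWithinAt f (f' a) (Icc a x) a := (hf a haI).mono (Icc_subset_Icc le_rfl hx.2)
  have h2 : HasDerivWithinAt f 0 (Icc a x) a := by
    refine (hasDerivWithinAt_const a (Icc a x) (f a)).congr (fun y hy => ?_) rfl
    exact le_antisymm ((hmono ⟨hy.1, hy.2.trans hx.2⟩ ⟨hx.1.le, hx.2⟩ hy.2).trans heq.ge)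
      (hmono haI ⟨hy.1, hy.2.trans hx.2⟩ hy.1)
  exact (uniqueDiffOn_Icc hx.1 a ⟨le_rfl, hx.1.le⟩).eq_deriv _ h1 h2

/-- The quantity `κ p^{n-1} + h'(p vⁿ)`, whose derivative is prescribed by the Euler-Lagrange
equation. -/
noncomputable def flux (n : ℕ) (κ : ℝ) (h : ℝ → ℝ) (p v : ℝ) : ℝ :=
  κ * p ^ (n - 1) + deriv h (p * v ^ n)

theorem flux_strictMono (hκ : 0 < κ) (H : IsBulkEnergy h) {y p q : ℝ} (hy : 0 < y) (hp : 0 < p)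
    (hpq : p < q) : flux n κ h p y < flux n κ h q y :=
  strictMonoOn_flux hκ H (pow_pos hy n) hp (hp.trans hpq) hpq

namespace IsRadialSolution

theorem mono (hv : IsRadialSolution n κ h a b v p) {c d : ℝ} (hac : a ≤ c) (hdb : d ≤ b) :
    IsRadialSolution n κ h c d v p := by
  have hs : Icc c d ⊆ Icc a b := Icc_subset_Icc hac hdb
  exact ⟨fun R hR => hv.v_pos R (hs hR), fun R hR => hv.p_pos R (hs hR), hv.p_smooth.mono hs,
    fun R hR => (hv.v_deriv R (hs hR)).mono hs, fun R hR => (hv.flux_deriv R (hs hR)).mono hs⟩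

/-- The system is autonomous in `log R`. -/
theorem comp_mul (hv : IsRadialSolution n κ h a b v p) {c : ℝ} (hc : 0 < c) :
    IsRadialSolution n κ h (a / c) (b / c) (fun R => v (c * R)) fun R => p (c * R) := by
  have hs : MapsTo (fun R => c * R) (Icc (a / c) (b / c)) (Icc a b) := fun R hR =>
    ⟨(div_le_iff₀' hc).1 hR.1, (le_div_iff₀' hc).1 hR.2⟩
  have hd : ∀ R, HasDerivWithinAt (fun R : ℝ => c * R) c (Icc (a / c) (b / c)) R := fun R => by
    simpa using ((hasDerivAt_id R).const_mul c).hasDerivWithinAt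
  refine ⟨fun R hR => hv.v_pos _ (hs hR), fun R hR => hv.p_pos _ (hs hR),
    hv.p_smooth.comp (by fun_prop) hs, fun R hR => ?_, fun R hR => ?_⟩
  · refine ((hv.v_deriv _ (hs hR)).comp R (hd R) hs).congr_deriv ?_
    rcases eq_or_ne R 0 with rfl | hR0
    · simp
    · field_simp
  · refine ((hv.flux_deriv _ (hs hR)).comp R (hd R) hs).congr_deriv ?_
    rcases eq_or_ne R 0 with rfl | hR0
    · simp
    · field_simp

theorem continuousOn_flux (hv : IsRadialSolution n κ h a b v p) :
    ContinuousOn (fun R => flux n κ h (p R) (v R)) (Icc a b) :=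
  fun R hR => (hv.flux_deriv R hR).continuousWithinAt

theorem continuousOn (hv : IsRadialSolution n κ h a b v p) : ContinuousOn v (Icc a b) :=
  fun R hR => (hv.v_deriv R hR).continuousWithinAt

theorem hasDerivWithinAt_pow (hn : 2 ≤ n) (ha : 0 < a) (hv : IsRadialSolution n κ h a b v p) {R : ℝ}
    (hR : R ∈ Icc a b) : HasDerivWithinAt (fun S => v S ^ n * S ^ n)
      (n * (v R ^ n * R ^ n) * p R / R) (Icc a b) R := by
  have hR0 : 0 < R := ha.trans_le hR.1
  refine (((hv.v_deriv R hR).pow n).mul (hasDerivAt_pow n R).hasDerivWithinAt).congr_deriv ?_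
  obtain ⟨m, rfl⟩ : ∃ m, n = m + 1 := ⟨n - 1, by omega⟩
  simp only [Nat.add_sub_cancel, pow_succ, Pi.pow_apply]
  field_simp
  ring

/-- The Euler-Lagrange equation is monotone in the volume coordinate: the energy is convex there. -/
theorem monotoneOn_mul (hn : 2 ≤ n) (hκ : 0 < κ) (ha : 0 < a) (H : IsBulkEnergy h)
    (hv : IsRadialSolution n κ h a b v p) (hw : IsRadialSolution n κ h a b w q) :
    MonotoneOn (fun R => (flux n κ h (p R) (v R) - flux n κ h (q R) (w R)) *
      (v R ^ n * R ^ n - w R ^ n * R ^ n)) (Icc a b) := by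
  refine monotoneOn_of_hasDerivWithinAt_nonneg (fun R hR =>
    ((hv.flux_deriv R hR).sub (hw.flux_deriv R hR)).mul
      ((hv.hasDerivWithinAt_pow hn ha hR).sub (hw.hasDerivWithinAt_pow hn ha hR))) fun R hR => ?_
  have hR0 : 0 < R := ha.trans_le hR.1
  have hp := hv.p_pos R hR
  have hq := hw.p_pos R hR
  have hvn := pow_pos (hv.v_pos R hR) n
  have hwn := pow_pos (hw.v_pos R hR) n
  have hRn := pow_pos hR0 n
  have hm : 0 ≤ (deriv h (p R * v R ^ n) - deriv h (q R * w R ^ n)) *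
      (p R * v R ^ n - q R * w R ^ n) := by
    rcases lt_trichotomy (p R * v R ^ n) (q R * w R ^ n) with h1 | h1 | h1
    · have := H.strictMonoOn_deriv (mul_pos hp hvn) (mul_pos hq hwn) h1
      exact mul_nonneg_of_nonpos_of_nonpos (by linarith) (by linarith)
    · rw [h1]; simp
    · have := H.strictMonoOn_deriv (mul_pos hq hwn) (mul_pos hp hvn) h1
      exact mul_nonneg (by linarith) (by linarith)
  obtain ⟨m, rfl⟩ : ∃ m, n = m + 1 := ⟨n - 1, by omega⟩
  have y1 := mul_nonneg (mul_pos hvn hRn).le (sub_nonneg.2 (young_pow m hp.le hq.le))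
  have y2 := mul_nonneg (mul_pos hwn hRn).le (sub_nonneg.2 (young_pow m hq.le hp.le))
  have key := add_nonneg (mul_nonneg (div_pos hκ hR0).le (add_nonneg y1 y2))
    (mul_nonneg (div_pos (mul_pos (Nat.cast_pos.2 m.succ_pos : (0 : ℝ) < (m.succ : ℕ)) hRn)
      hR0).le hm)
  refine key.trans_eq ?_
  simp only [Nat.add_sub_cancel, Pi.sub_apply, Nat.succ_eq_add_one]
  generalize deriv h (p R * v R ^ (m + 1)) = A
  generalize deriv h (q R * w R ^ (m + 1)) = B
  push_cast
  field_simp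
  ring

/-- Two solutions with the same boundary values have the same initial slope. -/
theorem strain_eq (hn : 2 ≤ n) (hκ : 0 < κ) (ha : 0 < a) (hab : a < b) (H : IsBulkEnergy h)
    (hv : IsRadialSolution n κ h a b v p) (hw : IsRadialSolution n κ h a b w q)
    (h0 : v a = w a) (h1 : v b = w b) : p a = q a := by
  have haI : a ∈ Icc a b := ⟨le_rfl, hab.le⟩
  have hbI : b ∈ Icc a b := ⟨hab.le, le_rfl⟩
  by_contra hne
  have hF : flux n κ h (p a) (v a) - flux n κ h (q a) (w a) ≠ 0 := by
    rw [← h0, sub_ne_zero]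
    rcases lt_or_gt_of_ne hne with h2 | h2
    · exact (flux_strictMono hκ H (hv.v_pos a haI) (hv.p_pos a haI) h2).ne
    · exact (flux_strictMono hκ H (hv.v_pos a haI) (hw.p_pos a haI) h2).ne'
  have hmono := monotoneOn_mul hn hκ ha H hv hw
  have hz : ∀ R ∈ Icc a b, (flux n κ h (p R) (v R) - flux n κ h (q R) (w R)) *
      (v R ^ n * R ^ n - w R ^ n * R ^ n) = 0 := fun R hR => by
    have e1 := hmono haI hR hR.1
    have e2 := hmono hR hbI hR.2
    simp only [h0, h1, sub_self, mul_zero] at e1 e2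
    exact le_antisymm e2 e1
  have hev : ∀ᶠ R in 𝓝[Icc a b] a, flux n κ h (p R) (v R) - flux n κ h (q R) (w R) ≠ 0 :=
    ((hv.continuousOn_flux.sub hw.continuousOn_flux) a haI).eventually_ne hF
  have heq : (fun R => v R ^ n * R ^ n) =ᶠ[𝓝[Icc a b] a] fun R => w R ^ n * R ^ n := by
    filter_upwards [hev, self_mem_nhdsWithin] with R h2 h3
    exact sub_eq_zero.1 ((mul_eq_zero.1 (hz R h3)).resolve_left h2)
  have hd := (uniqueDiffOn_Icc hab a haI).eq_deriv _ (hv.hasDerivWithinAt_pow hn ha haI)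
    ((hw.hasDerivWithinAt_pow hn ha haI).congr_of_eventuallyEq heq (heq.eq_of_nhdsWithin haI))
  have h4 := pow_pos (hw.v_pos a haI) n
  have h5 := pow_pos ha n
  have hn0 : (0 : ℝ) < n := by exact_mod_cast (by omega : 0 < n)
  rw [h0] at hd
  field_simp at hd
  exact hne hd

/-- Of two solutions with the same initial value, the one with the larger initial slope stays above:
at a later meeting point `strain_eq` would force the slopes to agree. -/
theorem lt_of_strain_lt (hn : 2 ≤ n) (hκ : 0 < κ) (ha : 0 < a) (hab : a < b) (H : IsBulkEnergy h)
    (hv : IsRadialSolution n κ h a b v p) (hw : IsRadialSolution n κ h a b w q)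
    (h0 : v a = w a) (hpq : p a < q a) : v b < w b := by
  have haI : a ∈ Icc a b := ⟨le_rfl, hab.le⟩
  have hbI : b ∈ Icc a b := ⟨hab.le, le_rfl⟩
  by_contra! hle
  have hF : flux n κ h (p a) (v a) - flux n κ h (q a) (w a) < 0 := by
    rw [← h0, sub_neg]
    exact flux_strictMono hκ H (hv.v_pos a haI) (hv.p_pos a haI) hpq
  have hmono := monotoneOn_mul hn hκ ha H hv hw
  have hev : ∀ᶠ R in 𝓝[Icc a b] a, flux n κ h (p R) (v R) - flux n κ h (q R) (w R) < 0 :=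
    ((hv.continuousOn_flux.sub hw.continuousOn_flux) a haI).eventually (gt_mem_nhds hF)
  have hev' : ∀ᶠ R in 𝓝[>] a, R ∈ Ioo a b := Ioo_mem_nhdsGT hab
  have hle' : 𝓝[>] a ≤ 𝓝[Icc a b] a := by
    rw [← nhdsWithin_Ioo_eq_nhdsGT hab]
    exact nhdsWithin_mono _ Ioo_subset_Icc_self
  obtain ⟨c, hc1, hc⟩ := ((hev.filter_mono hle').and hev').exists
  have hcI := Ioo_subset_Icc_self hc
  have hcle : v c ≤ w c := by
    have e1 := hmono haI hcI hc.1.le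
    simp only [h0, sub_self, mul_zero] at e1
    have e2 : v c ^ n * c ^ n - w c ^ n * c ^ n ≤ 0 := by
      by_contra! h2
      nlinarith
    have e3 : v c ^ n ≤ w c ^ n :=
      le_of_mul_le_mul_right (sub_nonpos.1 e2) (pow_pos (ha.trans hc.1) n)
    exact le_of_pow_le_pow_left₀ (by omega) (hw.v_pos c hcI).le e3
  obtain ⟨e, he, hve⟩ := isPreconnected_Icc.intermediate_value₂ (left_mem_Icc.2 hc.2.le)
    (right_mem_Icc.2 hc.2.le) (hv.continuousOn.mono (Icc_subset_Icc hc.1.le le_rfl))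
    (hw.continuousOn.mono (Icc_subset_Icc hc.1.le le_rfl)) hcle hle
  exact hpq.ne (strain_eq hn hκ ha (hc.1.trans_le he.1) H (hv.mono le_rfl he.2)
    (hw.mono le_rfl he.2) h0 hve)

/-- The distance of `p` from `1` decreases; in particular `p - 1` cannot change sign. -/
theorem antitoneOn_sq (hn : 2 ≤ n) (hκ : 0 < κ) (ha : 0 < a) (H : IsBulkEnergy h)
    (hv : IsRadialSolution n κ h a b v p) : AntitoneOn (fun R => (p R - 1) ^ 2) (Icc a b) := by
  rcases lt_or_ge a b with hab | hab
  swap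
  · intro x hx y hy _
    rw [le_antisymm (hx.2.trans hab) hx.1, le_antisymm (hy.2.trans hab) hy.1]
  have hpd : ∀ R ∈ Icc a b, HasDerivWithinAt p (derivWithin p (Icc a b) R) (Icc a b) R :=
    fun R hR => ((hv.p_smooth.differentiableOn one_ne_zero) R hR).hasDerivWithinAt
  have hsq : ∀ R ∈ Icc a b, HasDerivWithinAt (fun R => -(p R - 1) ^ 2)
      (-(2 * (p R - 1) * derivWithin p (Icc a b) R)) (Icc a b) R := fun R hR =>
    (((hpd R hR).sub_const 1).pow 2).neg.congr_deriv (by simp)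
  have := monotoneOn_of_hasDerivWithinAt_nonneg hsq fun R hR => ?_
  · intro x hx y hy hxy
    have := this hx hy hxy
    simp only at this ⊢
    linarith
  have hR0 : 0 < R := ha.trans_le hR.1
  have hp := hv.p_pos R hR
  have hV := hv.v_pos R hR
  have hVn := pow_pos hV n
  have hd := mul_pos hp hVn
  have hchain := (((hpd R hR).pow (n - 1)).const_mul κ).add
    ((H.hasDerivAt_deriv hd).comp_hasDerivWithinAt R ((hpd R hR).mul ((hv.v_deriv R hR).pow n)))
  have heq := (uniqueDiffOn_Icc hab R hR).eq_deriv _ hchain (hv.flux_deriv R hR)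
  have hconv := H.convex _ hd
  have hpow : (1 - p R ^ n) * (p R - 1) ≤ 0 := by
    rcases le_total (p R) 1 with h1 | h1
    · have := pow_le_one₀ hp.le h1 (n := n)
      exact mul_nonpos_of_nonneg_of_nonpos (by linarith) (by linarith)
    · have := one_le_pow₀ h1 (n := n)
      exact mul_nonpos_of_nonpos_of_nonneg (by linarith) (by linarith)
  obtain ⟨m, rfl⟩ : ∃ m, n = m + 2 := ⟨n - 2, by omega⟩
  simp only [Nat.add_succ_sub_one, Pi.pow_apply] at heq
  have hVm : v R ^ (m + 1) * v R = v R ^ (m + 2) := (pow_succ _ _).symm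
  generalize deriv (deriv h) (p R * v R ^ (m + 2)) = A at *
  generalize derivWithin p (Icc a b) R = P at *
  have hC : 0 < κ * (m + 1) * p R ^ m + A * v R ^ (m + 2) := by positivity
  -- differentiating the flux expresses `p' = P` through `p` and `v`: a positive multiple of `P` has
  -- the sign of `1 - p`
  have key : (κ * (m + 1) * p R ^ m + A * v R ^ (m + 2)) * ((p R - 1) * P) =
      κ * (m + 1) / R * ((1 - p R ^ (m + 2)) * (p R - 1)) -
        A * (p R * v R ^ (m + 2)) * (m + 2) / R * (p R - 1) ^ 2 := by
    rw [← hVm] at heq ⊢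
    push_cast at heq
    field_simp at heq ⊢
    linear_combination (p R - 1) * heq
  have h1 : (p R - 1) * P ≤ 0 := by
    by_contra! h2
    have h3 := mul_pos hC h2
    have h4 : 0 ≤ A * (p R * v R ^ (m + 2)) * (m + 2) / R * (p R - 1) ^ 2 := by positivity
    have h5 := mul_nonpos_of_nonneg_of_nonpos (by positivity : 0 ≤ κ * (m + 1) / R) hpow
    linarith
  linarith

theorem one_le_strain (hn : 2 ≤ n) (hκ : 0 < κ) (ha : 0 < a) (H : IsBulkEnergy h)
    (hv : IsRadialSolution n κ h a b v p) (h1 : 1 ≤ p a) {R : ℝ} (hR : R ∈ Icc a b) : 1 ≤ p R := by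
  by_contra! h2
  obtain ⟨c, hc, hc1⟩ := intermediate_value_Icc' hR.1
    (hv.p_smooth.continuousOn.mono (Icc_subset_Icc le_rfl hR.2)) ⟨h2.le, h1⟩
  have h3 := hv.antitoneOn_sq hn hκ ha H ⟨hc.1, hc.2.trans hR.2⟩ hR hc.2
  simp only [hc1, sub_self] at h3
  nlinarith

theorem strain_le_one (hn : 2 ≤ n) (hκ : 0 < κ) (ha : 0 < a) (H : IsBulkEnergy h)
    (hv : IsRadialSolution n κ h a b v p) (h1 : p a ≤ 1) {R : ℝ} (hR : R ∈ Icc a b) : p R ≤ 1 := by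
  by_contra! h2
  obtain ⟨c, hc, hc1⟩ := intermediate_value_Icc hR.1
    (hv.p_smooth.continuousOn.mono (Icc_subset_Icc le_rfl hR.2)) ⟨h1, h2.le⟩
  have h3 := hv.antitoneOn_sq hn hκ ha H ⟨hc.1, hc.2.trans hR.2⟩ hR hc.2
  simp only [hc1, sub_self] at h3
  nlinarith

theorem hasDerivWithinAt_stress (ha : 0 < a) (hv : IsRadialSolution n κ h a b v p) {R : ℝ}
    (hR : R ∈ Icc a b) : HasDerivWithinAt (fun S => stress n κ h (p S) (v S))
      (κ * (n - 1) * (p R - p R ^ n) / R) (Icc a b) R := by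
  have hR0 : 0 < R := ha.trans_le hR.1
  have hV := hv.v_pos R hR
  refine ((hv.flux_deriv R hR).add ((((hv.v_deriv R hR).log hV.ne').add_const
    (1 / (n : ℝ))).const_mul (κ * (n - 1)))).congr_deriv ?_
  field_simp
  ring

end IsRadialSolution

theorem stress_lt_stress (hn : 2 ≤ n) (hκ : 0 < κ) (H : IsBulkEnergy h) {p q v w : ℝ} (hp : 0 < p)
    (hv : 0 < v) (hpq : p ≤ q) (hvw : v < w) : stress n κ h p v < stress n κ h q w := by
  have h1 := Real.log_lt_log hv hvw
  have hn1 : (0 : ℝ) < n - 1 := by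
    have : (2 : ℝ) ≤ n := by exact_mod_cast hn
    linarith
  have h2 := mul_lt_mul_of_pos_left h1 (mul_pos hκ hn1)
  have h3 := mul_le_mul_of_nonneg_left (pow_le_pow_left₀ hp.le hpq (n - 1)) hκ.le
  have h4 := H.strictMonoOn_deriv.monotoneOn (mul_pos hp (pow_pos hv n))
    (mul_pos (hp.trans_le hpq) (pow_pos (hv.trans hvw) n))
    (mul_le_mul hpq (pow_le_pow_left₀ hv.le hvw.le n) (by positivity) (hp.le.trans hpq))
  unfold stress
  linarith

theorem stress_le_stress (hn : 2 ≤ n) (hκ : 0 < κ) (H : IsBulkEnergy h) {p q v w : ℝ} (hp : 0 < p)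
    (hv : 0 < v) (hpq : p ≤ q) (hvw : v ≤ w) : stress n κ h p v ≤ stress n κ h q w := by
  rcases hvw.eq_or_lt with rfl | hvw
  · rcases hpq.eq_or_lt with rfl | hpq
    · rfl
    · have := flux_strictMono (n := n) hκ H hv hp hpq
      unfold flux at this
      unfold stress
      linarith
  · exact (stress_lt_stress hn hκ H hp hv hpq hvw).le

namespace IsRadialSolution

variable (hn : 2 ≤ n) (hκ : 0 < κ) (ha : 0 < a) (hab : a ≤ b) (H : IsBulkEnergy h)
  (h11 : stress n κ h 1 1 = 0) (hv : IsRadialSolution n κ h a b v p)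
  (hT : stress n κ h (p a) (v a) = 0)
include hn hκ ha hab H h11 hv hT

/-- A solution that is stretched less than the stress-free state at the cavity surface, where its
stress vanishes, has increasing `v = r/R` and negative stress. -/
theorem of_lt_one (h1 : v a < 1) :
    1 < p a ∧ ∀ R ∈ Ioc a b, v a < v R ∧ v R < 1 ∧ stress n κ h (p R) (v R) < 0 := by
  have haI : a ∈ Icc a b := ⟨le_rfl, hab⟩
  have hp1 : 1 < p a := by
    by_contra! h2
    have := stress_lt_stress hn hκ H (hv.p_pos a haI) (hv.v_pos a haI) h2 h1
    linarith
  have hn1 : (0 : ℝ) < n - 1 := by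
    have : (2 : ℝ) ≤ n := by exact_mod_cast hn
    linarith
  have hpow : ∀ {x : ℝ}, 1 ≤ x → x ≤ x ^ n := fun hx => le_self_pow₀ hx (by omega)
  have hpge : ∀ R ∈ Icc a b, 1 ≤ p R := fun R hR => hv.one_le_strain hn hκ ha H hp1.le hR
  refine ⟨hp1, fun R hR => ?_⟩
  have hRI : R ∈ Icc a b := ⟨hR.1.le, hR.2⟩
  have e1 : v a < v R := lt_of_hasDerivWithinAt_nonneg hv.v_deriv (fun S hS => ?_) ?_ hR
  have e2 : -stress n κ h (p a) (v a) < -stress n κ h (p R) (v R) :=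
    lt_of_hasDerivWithinAt_nonneg (fun S hS => (hv.hasDerivWithinAt_stress ha hS).neg)
      (fun S hS => ?_) ?_ hR
  · have e3 : stress n κ h (p R) (v R) < 0 := by linarith
    refine ⟨e1, ?_, e3⟩
    by_contra! h2
    have := stress_le_stress hn hκ H one_pos one_pos (hpge R hRI) h2
    linarith
  · have := ha.trans_le hS.1
    have := hpow (hpge S hS)
    rw [← neg_div]
    refine div_nonneg ?_ (by positivity)
    have := mul_nonneg (mul_pos hκ hn1).le (sub_nonneg.2 this)
    linarith
  · rw [← neg_div]
    refine div_pos ?_ ha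
    have := mul_pos (mul_pos hκ hn1) (sub_pos.2 (lt_self_pow₀ hp1 (by omega : 1 < n)))
    linarith
  · exact div_nonneg (mul_nonneg (hv.v_pos S hS).le (sub_nonneg.2 (hpge S hS)))
      (ha.trans_le hS.1).le
  · exact div_pos (mul_pos (hv.v_pos a haI) (sub_pos.2 hp1)) ha

/-- A solution that is stretched more than the stress-free state at the cavity surface, where its
stress vanishes, has decreasing `v = r/R` and positive stress. -/
theorem of_one_lt (h1 : 1 < v a) :
    p a < 1 ∧ ∀ R ∈ Ioc a b, v R < v a ∧ 1 < v R ∧ 0 < stress n κ h (p R) (v R) := by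
  have haI : a ∈ Icc a b := ⟨le_rfl, hab⟩
  have hp1 : p a < 1 := by
    by_contra! h2
    have := stress_lt_stress hn hκ H one_pos one_pos h2 h1
    linarith
  have hn1 : (0 : ℝ) < n - 1 := by
    have : (2 : ℝ) ≤ n := by exact_mod_cast hn
    linarith
  have hple : ∀ R ∈ Icc a b, p R ≤ 1 := fun R hR => hv.strain_le_one hn hκ ha H hp1.le hR
  refine ⟨hp1, fun R hR => ?_⟩
  have hRI : R ∈ Icc a b := ⟨hR.1.le, hR.2⟩
  have e1 : -v a < -v R :=
    lt_of_hasDerivWithinAt_nonneg (fun S hS => (hv.v_deriv S hS).neg) (fun S hS => ?_) ?_ hR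
  have e2 : stress n κ h (p a) (v a) < stress n κ h (p R) (v R) :=
    lt_of_hasDerivWithinAt_nonneg (fun S hS => hv.hasDerivWithinAt_stress ha hS)
      (fun S hS => ?_) ?_ hR
  · have e3 : 0 < stress n κ h (p R) (v R) := by linarith
    refine ⟨by linarith, ?_, e3⟩
    by_contra! h2
    have := stress_le_stress hn hκ H (hv.p_pos R hRI) (hv.v_pos R hRI) (hple R hRI) h2
    linarith
  · have := ha.trans_le hS.1
    have := pow_le_of_le_one (hv.p_pos S hS).le (hple S hS) (by omega : n ≠ 0)
    exact div_nonneg (mul_nonneg (mul_pos hκ hn1).le (sub_nonneg.2 this)) (by positivity)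
  · have := pow_lt_self_of_lt_one₀ (hv.p_pos a haI) hp1 (by omega : 1 < n)
    exact div_pos (mul_pos (mul_pos hκ hn1) (sub_pos.2 this)) ha
  · rw [← neg_div]
    refine div_nonneg ?_ (ha.trans_le hS.1).le
    have := mul_nonneg (hv.v_pos S hS).le (sub_nonneg.2 (hple S hS))
    linarith
  · rw [← neg_div]
    refine div_pos ?_ ha
    have := mul_pos (hv.v_pos a haI) (sub_pos.2 hp1)
    linarith

/-- A stress-free cavity surface at the stress-free stretch belongs to the undeformed solution. -/
theorem of_eq_one (h1 : v a = 1) : ∀ R ∈ Icc a b, v R = 1 := by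
  have haI : a ∈ Icc a b := ⟨le_rfl, hab⟩
  have hp1 : p a = 1 := by
    rcases lt_trichotomy (p a) 1 with h2 | h2 | h2
    · have := flux_strictMono (n := n) hκ H one_pos (hv.p_pos a haI) h2
      rw [h1] at hT
      unfold stress at hT h11
      unfold flux at this
      linarith
    · exact h2
    · have := flux_strictMono (n := n) hκ H one_pos one_pos h2
      rw [h1] at hT
      unfold stress at hT h11
      unfold flux at this
      linarith
  have hp : ∀ R ∈ Icc a b, p R = 1 := fun R hR =>
    le_antisymm (hv.strain_le_one hn hκ ha H hp1.le hR) (hv.one_le_strain hn hκ ha H hp1.ge hR)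
  intro R hR
  have e0 : ∀ S ∈ Icc a b, v S * (p S - 1) / S = 0 := fun S hS => by rw [hp S hS]; simp
  have e1 := monotoneOn_of_hasDerivWithinAt_nonneg hv.v_deriv (fun S hS => (e0 S hS).ge) haI hR hR.1
  have e2 := monotoneOn_of_hasDerivWithinAt_nonneg (fun S hS => (hv.v_deriv S hS).neg)
    (fun S hS => by rw [e0 S hS, neg_zero]) haI hR hR.1
  simp only [Pi.neg_apply] at e2
  linarith

end IsRadialSolution

namespace IsRadialSolution

/-- Comparison of a solution started at radius `R` with one started at radius `a`, by rescaling the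
former to the starting radius `a`. -/
theorem lt_of_shift (hn : 2 ≤ n) (hκ : 0 < κ) (ha : 0 < a) (H : IsBulkEnergy h)
    (hv : IsRadialSolution n κ h a b v p) (hw : IsRadialSolution n κ h a b w q) {R : ℝ}
    (hR : R ∈ Ioo a b) (h0 : v R = w a) :
    (p R < q a → v b < w (a * b / R)) ∧ (q a < p R → w (a * b / R) < v b) := by
  have hR0 : 0 < R := ha.trans hR.1
  have hab : a < b := hR.1.trans hR.2
  have hc : 0 < R / a := div_pos hR0 ha
  have h1 := (hv.mono hR.1.le le_rfl).comp_mul hc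
  have e1 : R / (R / a) = a := by field_simp
  have e2 : b / (R / a) = a * b / R := by field_simp
  rw [e1, e2] at h1
  have e3 : a * b / R ≤ b := by
    rw [div_le_iff₀ hR0]
    nlinarith [hR.1]
  have e4 : a < a * b / R := by
    rw [lt_div_iff₀ hR0]
    exact mul_lt_mul_of_pos_left hR.2 ha
  have h2 := hw.mono le_rfl e3
  have e5 : R / a * a = R := by field_simp
  have e6 : R / a * (a * b / R) = b := by field_simp
  constructor
  · intro hpq
    have := lt_of_strain_lt hn hκ ha e4 H h1 h2 (by rw [e5, h0]) (by rwa [e5])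
    rwa [e6] at this
  · intro hpq
    have := lt_of_strain_lt hn hκ ha e4 H h2 h1 (by rw [e5, h0]) (by rwa [e5])
    rwa [e6] at this

/-- The boundary displacement determines the solution that is stress-free at the cavity surface. -/
theorem ne_of_stress_eq_zero (hn : 2 ≤ n) (hκ : 0 < κ) (ha : 0 < a) (hab : a < b)
    (H : IsBulkEnergy h) (h11 : stress n κ h 1 1 = 0)
    (hv : IsRadialSolution n κ h a b v p) (hw : IsRadialSolution n κ h a b w q)
    (hTv : stress n κ h (p a) (v a) = 0) (hTw : stress n κ h (q a) (w a) = 0)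
    (hlt : v a < w a) : v b ≠ w b := by
  have haI : a ∈ Icc a b := ⟨le_rfl, hab.le⟩
  have hbI : b ∈ Ioc a b := ⟨hab, le_rfl⟩
  intro heq
  have hbI' : b ∈ Icc a b := ⟨hab.le, le_rfl⟩
  have harg : ∀ {R : ℝ}, R ∈ Ioo a b → a * b / R ∈ Ioo a b := fun {R} hR => by
    have hR0 : 0 < R := ha.trans hR.1
    exact ⟨by rw [lt_div_iff₀ hR0]; exact mul_lt_mul_of_pos_left hR.2 ha,
      by rw [div_lt_iff₀ hR0]; nlinarith [hR.1]⟩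
  rcases lt_or_ge (w a) 1 with hw1 | hw1
  · -- both solutions increase, so that the smaller one attains `w a` at a later radius `R`
    obtain ⟨-, hvm⟩ := hv.of_lt_one hn hκ ha hab.le H h11 hTv (hlt.trans hw1)
    obtain ⟨hq1, hwm⟩ := hw.of_lt_one hn hκ ha hab.le H h11 hTw hw1
    obtain ⟨R, hR, hRw⟩ := intermediate_value_Ioo hab.le hv.continuousOn
      ⟨hlt, (hwm b hbI).1.trans_eq heq.symm⟩
    have hpq : p R < q a := by
      by_contra! h2
      have := stress_le_stress hn hκ H (hw.p_pos a haI) (hw.v_pos a haI) h2 hRw.ge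
      linarith [(hvm R ⟨hR.1, hR.2.le⟩).2.2]
    have h3 := (hv.lt_of_shift hn hκ ha H hw hR hRw).1 hpq
    have hmono : MonotoneOn w (Icc a b) := monotoneOn_of_hasDerivWithinAt_nonneg hw.v_deriv
      fun S hS => div_nonneg (mul_nonneg (hw.v_pos S hS).le
        (sub_nonneg.2 (hw.one_le_strain hn hκ ha H hq1.le hS))) (ha.trans_le hS.1).le
    have h4 := harg hR
    exact (h3.trans_le (hmono (Ioo_subset_Icc_self h4) hbI' h4.2.le)).ne heq
  · rcases lt_or_ge 1 (v a) with hv1 | hv1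
    · -- both solutions decrease, so that the larger one attains `v a` at a later radius `R`
      obtain ⟨hp1, hvm⟩ := hv.of_one_lt hn hκ ha hab.le H h11 hTv hv1
      obtain ⟨-, hwm⟩ := hw.of_one_lt hn hκ ha hab.le H h11 hTw (hv1.trans hlt)
      obtain ⟨R, hR, hRw⟩ := intermediate_value_Ioo' hab.le hw.continuousOn
        ⟨heq.symm.trans_lt (hvm b hbI).1, hlt⟩
      have hpq : p a < q R := by
        by_contra! h2
        have := stress_le_stress hn hκ H (hw.p_pos R (Ioo_subset_Icc_self hR))
          (hw.v_pos R (Ioo_subset_Icc_self hR)) h2 hRw.le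
        linarith [(hwm R ⟨hR.1, hR.2.le⟩).2.2]
      have h3 := (hw.lt_of_shift hn hκ ha H hv hR hRw).2 hpq
      have hanti : MonotoneOn (-v) (Icc a b) := monotoneOn_of_hasDerivWithinAt_nonneg
        (fun S hS => (hv.v_deriv S hS).neg) fun S hS => by
          rw [← neg_div]
          refine div_nonneg ?_ (ha.trans_le hS.1).le
          have := mul_nonneg (hv.v_pos S hS).le
            (sub_nonneg.2 (hv.strain_le_one hn hκ ha H hp1.le hS))
          linarith
      have h4 := harg hR
      have h5 := hanti (Ioo_subset_Icc_self h4) hbI' h4.2.le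
      simp only [Pi.neg_apply] at h5
      linarith
    · have h1 : v b ≤ 1 := by
        rcases hv1.eq_or_lt with h2 | h2
        · exact (hv.of_eq_one hn hκ ha hab.le H h11 hTv h2 b hbI').le
        · exact ((hv.of_lt_one hn hκ ha hab.le H h11 hTv h2).2 b hbI).2.1.le
      have h2 : 1 ≤ w b := by
        rcases hw1.eq_or_lt with h2 | h2
        · exact (hw.of_eq_one hn hκ ha hab.le H h11 hTw h2.symm b hbI').ge
        · exact ((hw.of_one_lt hn hκ ha hab.le H h11 hTw h2).2 b hbI).2.1.le
      rcases hv1.eq_or_lt with h3 | h3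
      · linarith [((hw.of_one_lt hn hκ ha hab.le H h11 hTw (by linarith)).2 b hbI).2.1]
      · linarith [((hv.of_lt_one hn hκ ha hab.le H h11 hTv h3).2 b hbI).2.1]

end IsRadialSolution

/-- Critical points with the same boundary displacement have the same cavity volume. -/
theorem IsCritical.vol_eq {ε L : ℝ} {d e : ℝ → ℝ} (hn : 2 ≤ n) (hκ : 0 < κ) (hε : 0 < ε)
    (hε1 : ε < 1) (H : IsBulkEnergy h) (h11 : stress n κ h 1 1 = 0) (hd : IsCritical n κ h ε L d)
    (he : IsCritical n κ h ε L e) : vol n L d ε = vol n L e ε := by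
  obtain ⟨p, hv, -, hTv⟩ := hd.isRadialSolution hn hκ hε hε1 H
  obtain ⟨q, hw, -, hTw⟩ := he.isRadialSolution hn hκ hε hε1 H
  have hb : (fun R => defOfJac n L d R / R) 1 = (fun R => defOfJac n L e R / R) 1 := by
    simp only [defOfJac, vol_one]
  have ha : defOfJac n L d ε / ε = defOfJac n L e ε / ε := by
    rcases lt_trichotomy (defOfJac n L d ε / ε) (defOfJac n L e ε / ε) with h1 | h1 | h1
    · have := hv.ne_of_stress_eq_zero hn hκ hε hε1 H h11 hw hTv hTw h1
      exact absurd hb this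
    · exact h1
    · have := hw.ne_of_stress_eq_zero hn hκ hε hε1 H h11 hv hTw hTv h1
      exact absurd hb.symm this
  have h2 : defOfJac n L d ε = defOfJac n L e ε := (div_left_inj' hε.ne').1 ha
  rw [← defOfJac_pow hn hd.bdry_pos.le, ← defOfJac_pow hn he.bdry_pos.le, h2]

end Comparison

/-! ### Uniqueness of the minimiser -/

section Uniqueness

variable {n : ℕ} {κ ε L lam : ℝ} {h : ℝ → ℝ} {d e : ℝ → ℝ}

/-- The difference of a convex function and a continuous one whose minimum over an interval is
attained at both end points has an interior maximum. -/
theorem exists_isMaxOn_Ioo {a b : ℝ} {c β : ℝ → ℝ} (hab : a < b) (hc : ConvexOn ℝ (Icc a b) c)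
    (hβ : Continuous β) (heq : c a - β a = c b - β b)
    (hmin : ∀ x ∈ Icc a b, c a - β a ≤ c x - β x) :
    ∃ x₀ ∈ Ioo a b, ∀ x ∈ Icc a b, c x - β x ≤ c x₀ - β x₀ := by
  by_cases hall : ∀ x ∈ Icc a b, c x - β x ≤ c a - β a
  · have hm : (a + b) / 2 ∈ Ioo a b := ⟨by linarith, by linarith⟩
    exact ⟨_, hm, fun x hx => (hall x hx).trans (hmin _ (Ioo_subset_Icc_self hm))⟩
  push Not at hall
  obtain ⟨y, hy, hyc⟩ := hall
  have haI : a ∈ Icc a b := ⟨le_rfl, hab.le⟩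
  have hbI : b ∈ Icc a b := ⟨hab.le, le_rfl⟩
  have hyI : y ∈ Ioo a b := by
    refine ⟨lt_of_le_of_ne hy.1 ?_, lt_of_le_of_ne hy.2 ?_⟩
    · rintro rfl; exact lt_irrefl _ hyc
    · rintro rfl; exact hyc.ne heq
  have hba : 0 < b - a := by linarith
  -- the chord of `c` minus `β`, a continuous upper bound for `c - β` up to the end points
  let M : ℝ → ℝ := fun x => (b - x) / (b - a) * c a + (x - a) / (b - a) * c b - β x
  have hMc : Continuous M := by fun_prop
  have hcM : ∀ x ∈ Icc a b, c x - β x ≤ M x := by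
    intro x hx
    have h1 := hc.2 haI hbI (div_nonneg (sub_nonneg.2 hx.2) hba.le)
      (div_nonneg (sub_nonneg.2 hx.1) hba.le) (by field_simp; ring)
    have h2 : (b - x) / (b - a) * a + (x - a) / (b - a) * b = x := by field_simp; ring
    simp only [smul_eq_mul, h2] at h1
    simp only [M]
    linarith
  have hMa : M a < c y - β y := by
    have : M a = c a - β a := by simp [M, div_self hba.ne']
    linarith
  have hMb : M b < c y - β y := by
    have : M b = c b - β b := by simp [M, div_self hba.ne']
    linarith
  obtain ⟨a', ha', hMa'⟩ : ∃ a' ∈ Ioo a y, ∀ x ∈ Icc a a', M x < c y - β y := by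
    obtain ⟨δ, hδ, hδM⟩ := Metric.eventually_nhds_iff.1 (hMc.continuousAt.eventually
      (gt_mem_nhds hMa))
    refine ⟨min (a + δ / 2) ((a + y) / 2), ⟨lt_min (by linarith) (by linarith [hyI.1]),
      (min_le_right _ _).trans_lt (by linarith [hyI.1])⟩, fun x hx => hδM ?_⟩
    rw [Real.dist_eq, abs_of_nonneg (by linarith [hx.1])]
    linarith [hx.2.trans (min_le_left _ _)]
  obtain ⟨b', hb', hMb'⟩ : ∃ b' ∈ Ioo y b, ∀ x ∈ Icc b' b, M x < c y - β y := by
    obtain ⟨δ, hδ, hδM⟩ := Metric.eventually_nhds_iff.1 (hMc.continuousAt.eventually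
      (gt_mem_nhds hMb))
    refine ⟨max (b - δ / 2) ((b + y) / 2), ⟨lt_of_lt_of_le (by linarith [hyI.2])
      (le_max_right _ _), max_lt (by linarith) (by linarith [hyI.2])⟩, fun x hx => hδM ?_⟩
    rw [Real.dist_eq, abs_of_nonpos (by linarith [hx.2])]
    linarith [(le_max_left _ _).trans hx.1]
  have hcc : ContinuousOn c (Ioo a b) :=
    (hc.subset Ioo_subset_Icc_self (convex_Ioo a b)).continuousOn isOpen_Ioo
  have hsub : Icc a' b' ⊆ Ioo a b := fun x hx => ⟨ha'.1.trans_le hx.1, hx.2.trans_lt hb'.2⟩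
  obtain ⟨x₀, hx₀, hmax⟩ := isCompact_Icc.exists_isMaxOn ⟨y, ha'.2.le, hb'.1.le⟩
    ((hcc.mono hsub).sub hβ.continuousOn)
  have hy₀ : c y - β y ≤ c x₀ - β x₀ := hmax ⟨ha'.2.le, hb'.1.le⟩
  refine ⟨x₀, hsub hx₀, fun x hx => ?_⟩
  rcases le_total x a' with h1 | h1
  · exact ((hcM x hx).trans (hMa' x ⟨hx.1, h1⟩).le).trans hy₀
  rcases le_total b' x with h2 | h2
  · exact ((hcM x hx).trans (hMb' x ⟨h2, hx.2⟩).le).trans hy₀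
  · exact hmax ⟨h1, h2⟩

theorem FiniteEnergy.bulkEnergy_convexComb_le (hn : 2 ≤ n) (hκ : 0 < κ) (hε : 0 < ε) (hε1 : ε < 1)
    (H : IsBulkEnergy h) (hd : FiniteEnergy n κ h ε L d) (he : FiniteEnergy n κ h ε L e) {s : ℝ}
    (hs0 : 0 ≤ s) (hs1 : s ≤ 1) :
    bulkEnergy n κ h ε L (fun x => (1 - s) * d x + s * e x) ≤
      (1 - s) * bulkEnergy n κ h ε L d + s * bulkEnergy n κ h ε L e := by
  obtain ⟨-, -, h1⟩ := hd.convexComb hn hκ hε hε1 H he hs0 hs1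
  have h2 : 0 ≤ ∫ R in Ioo ε 1, R ^ (n - 1) * ((1 - s) * h (d R) + s * h (e R) -
      h ((1 - s) * d R + s * e R)) := by
    refine integral_nonneg_of_ae ?_
    filter_upwards [hd.pos, he.pos, ae_restrict_mem measurableSet_Ioo] with R p1 p2 hR
    have h3 := H.strictConvexOn.convexOn.2 (show d R ∈ Ioi 0 from p1) (show e R ∈ Ioi 0 from p2)
      (sub_nonneg.2 hs1) hs0 (by ring)
    simp only [smul_eq_mul] at h3
    exact mul_nonneg (pow_pos (hε.trans hR.1) _).le (by linarith)
  linarith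

/-- Two minimisers have the same cavity volume. Otherwise the minimal energy at fixed cavity volume
would have a maximum in between, which is a further critical value (a mountain pass). -/
theorem IsRedMin.not_vol_lt (hn : 2 ≤ n) (hκ : 0 < κ) (hε : 0 < ε) (hε1 : ε < 1)
    (H : IsBulkEnergy h) (h11 : stress n κ h 1 1 = 0) (hd : IsRedMin n κ h ε L univ d)
    (he : IsRedMin n κ h ε L univ e) : ¬ vol n L d ε < vol n L e ε := by
  intro hab
  set a := vol n L d ε with ha
  set b := vol n L e ε with hb
  have ha0 : 0 ≤ a := hd.finiteEnergy.bdry_nonneg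
  have hbL : b < L := by
    have := strictMonoOn_vol (L := L) hn hε he.finiteEnergy.integrableOn he.finiteEnergy.pos
      ⟨le_rfl, hε1.le⟩ ⟨hε1.le, le_rfl⟩ hε1
    rwa [vol_one] at this
  have hex : ∀ x ∈ Icc a b, ∃ d', IsRedMin n κ h ε L {x} d' := by
    intro x hx
    refine exists_isRedMin hn hκ hε hε1 H isCompact_singleton (convex_singleton x) ?_
    rcases hx.1.eq_or_lt with rfl | h1
    · exact ⟨d, hd.finiteEnergy, rfl⟩
    · exact exists_finiteEnergy hn hε hε1 ⟨ha0.trans_lt h1, hx.2.trans_lt hbL⟩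
  choose! D hD using hex
  -- the minimal bulk energy at fixed cavity volume
  set c : ℝ → ℝ := fun x => bulkEnergy n κ h ε L (D x) with hc
  have hle : ∀ x ∈ Icc a b, ∀ d', FiniteEnergy n κ h ε L d' → vol n L d' ε = x →
      c x ≤ bulkEnergy n κ h ε L d' := by
    intro x hx d' hd' hv
    have h1 := (hD x hx).le d' hd' hv
    have h2 : vol n L (D x) ε = x := (hD x hx).mem
    unfold redEnergy at h1
    rw [hv, h2] at h1
    linarith
  have hcge : ∀ f, IsRedMin n κ h ε L univ f → ∀ x ∈ Icc a b,
      redEnergy n κ h ε L f ≤ c x - bdry n κ ε x := by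
    intro f hf x hx
    have h1 := hf.le _ (hD x hx).finiteEnergy (mem_univ _)
    have h2 : vol n L (D x) ε = x := (hD x hx).mem
    rw [redEnergy, redEnergy, h2] at h1
    exact h1
  have haI : a ∈ Icc a b := ⟨le_rfl, hab.le⟩
  have hbI : b ∈ Icc a b := ⟨hab.le, le_rfl⟩
  have hca : c a - bdry n κ ε a = redEnergy n κ h ε L d :=
    le_antisymm (sub_le_sub_right (hle a haI d hd.finiteEnergy rfl) _) (hcge d hd a haI)
  have hcb : c b - bdry n κ ε b = redEnergy n κ h ε L e :=
    le_antisymm (sub_le_sub_right (hle b hbI e he.finiteEnergy rfl) _) (hcge e he b hbI)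
  have hde : redEnergy n κ h ε L d = redEnergy n κ h ε L e :=
    le_antisymm (hd.le _ he.finiteEnergy (mem_univ _)) (he.le _ hd.finiteEnergy (mem_univ _))
  have hconv : ConvexOn ℝ (Icc a b) c := by
    refine ⟨convex_Icc a b, fun x hx y hy s t hs ht hst => ?_⟩
    obtain rfl : s = 1 - t := by linarith
    have ht1 : t ≤ 1 := by linarith
    have hxf := (hD x hx).finiteEnergy
    have hyf := (hD y hy).finiteEnergy
    have hv := hxf.vol_convexComb hε1 hyf t (R := ε) ⟨le_rfl, hε1.le⟩
    have hvx : vol n L (D x) ε = x := (hD x hx).mem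
    have hvy : vol n L (D y) ε = y := (hD y hy).mem
    rw [hvx, hvy] at hv
    exact (hle _ (convex_Icc a b hx hy hs ht hst) _
      (hxf.convexComb hn hκ hε hε1 H hyf ht ht1).1 hv).trans
      (hxf.bulkEnergy_convexComb_le hn hκ hε hε1 H hyf ht ht1)
  obtain ⟨x₀, hx₀, hmax⟩ := exists_isMaxOn_Ioo hab hconv
    (continuous_bdry (n := n) (κ := κ) (ε := ε))
    (by rw [hca, hcb, hde]) fun x hx => by rw [hca]; exact hcge d hd x hx
  have hx₀I := Ioo_subset_Icc_self hx₀
  have hfe := (hD x₀ hx₀I).finiteEnergy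
  have hv₀ : vol n L (D x₀) ε = x₀ := (hD x₀ hx₀I).mem
  have hx₀pos : 0 < x₀ := ha0.trans_lt hx₀.1
  -- With `U` the first-order change of the cavity volume, the bulk energy along a variation is at
  -- least `c (x₀ + t U) ≥ 2 c x₀ - c (x₀ - t U)` by convexity, and maximality of `c - bdry` at `x₀`
  -- bounds `c (x₀ - t U)`. So the bulk energy has a local minimum at `t = 0` after adding
  -- `bdry (x₀ - t U)`, which has the same derivative there as `-bdry (x₀ + t U)`.
  have hcrit : IsCritical n κ h ε L (D x₀) := by
    refine isCritical_of_isLocalMin hn hκ hε hε1 H hfe (by rwa [hv₀]) fun a' b' η ha' hη => ?_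
    obtain ⟨hev, -, -⟩ := hasDerivAt_bulkEnergy hn hκ hε hε1 H hfe (by rwa [hv₀]) ha' hη
    set U := vol n 0 η ε with hU
    have hlin : HasDerivAt (fun t : ℝ => x₀ - t * U) (-U) 0 := by
      simpa using ((hasDerivAt_id (0 : ℝ)).mul_const U).const_sub x₀
    rw [hv₀]
    refine ⟨fun t => bdry n κ ε (x₀ - t * U), ?_, ?_⟩
    · have h1 : HasDerivAt (bdry n κ ε) (bdrySlope n κ ε x₀) (x₀ - 0 * U) := by
        rw [zero_mul, sub_zero]; exact hasDerivAt_bdry hε hx₀pos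
      have h2 := h1.comp (0 : ℝ) hlin
      rwa [mul_neg] at h2
    · have hm : ∀ᶠ t in 𝓝 (0 : ℝ), x₀ - t * U ∈ Ioo a b :=
        (by fun_prop : Continuous fun t : ℝ => x₀ - t * U).continuousAt.eventually
          (Ioo_mem_nhds (by simpa using hx₀.1) (by simpa using hx₀.2))
      have hp : ∀ᶠ t in 𝓝 (0 : ℝ), x₀ + t * U ∈ Ioo a b :=
        (by fun_prop : Continuous fun t : ℝ => x₀ + t * U).continuousAt.eventually
          (Ioo_mem_nhds (by simpa using hx₀.1) (by simpa using hx₀.2))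
      filter_upwards [hev, hm, hp] with t ht htm htp
      have htm' := Ioo_subset_Icc_self htm
      have htp' := Ioo_subset_Icc_self htp
      have h1 := hle _ htp' _ ht (by
        rw [vol_add_mul hε1 hfe.integrableOn hη.integrableOn t ⟨le_rfl, hε1.le⟩, hv₀])
      have h2 := hmax _ htm'
      have h3 := hconv.2 htp' htm' (by norm_num : (0 : ℝ) ≤ 1 / 2)
        (by norm_num : (0 : ℝ) ≤ 1 / 2) (by norm_num)
      rw [smul_eq_mul, smul_eq_mul, show 1 / 2 * (x₀ + t * U) + 1 / 2 * (x₀ - t * U) = x₀ by ring]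
        at h3
      simp only [smul_eq_mul] at h3
      simp only [zero_mul, add_zero, sub_zero]
      change c x₀ + _ ≤ _
      linarith
  have hce := he.isCritical hn hκ hε hε1 H (ha0.trans_lt hab)
  have := hcrit.vol_eq hn hκ hε hε1 H h11 hce
  rw [hv₀] at this
  exact hx₀.2.ne this

theorem IsRedMin.ae_eq (hn : 2 ≤ n) (hκ : 0 < κ) (hε : 0 < ε) (hε1 : ε < 1)
    (H : IsBulkEnergy h) (h11 : stress n κ h 1 1 = 0) (hd : IsRedMin n κ h ε L univ d)
    (he : IsRedMin n κ h ε L univ e) : d =ᵐ[volume.restrict (Ioo ε 1)] e :=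
  ae_eq_of_isRedMin hn hκ hε hε1 H hd he (le_antisymm
    (not_lt.1 (he.not_vol_lt hn hκ hε hε1 H h11 hd))
    (not_lt.1 (hd.not_vol_lt hn hκ hε hε1 H h11 he)))

/-- The infimum may be taken over the compact range of cavity volumes `[0, L]`. -/
theorem exists_isRedMin_univ (hn : 2 ≤ n) (hκ : 0 < κ) (hε : 0 < ε) (hε1 : ε < 1)
    (H : IsBulkEnergy h) (hL : 0 < L) : ∃ d, IsRedMin n κ h ε L univ d := by
  obtain ⟨d₀, hd₀, hv₀⟩ := exists_finiteEnergy (κ := κ) (h := h) hn hε hε1 (x := L / 2) (L := L)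
    ⟨by linarith, by linarith⟩
  obtain ⟨d, hd⟩ := exists_isRedMin hn hκ hε hε1 H (L := L) (K := Icc 0 L) isCompact_Icc
    (convex_Icc 0 L) ⟨d₀, hd₀, by rw [hv₀]; constructor <;> linarith⟩
  refine ⟨d, hd.finiteEnergy, mem_univ _, fun d' hd' _ => hd.le d' hd' ⟨hd'.bdry_nonneg, ?_⟩⟩
  have := (strictMonoOn_vol (L := L) hn hε hd'.integrableOn hd'.pos).monotoneOn
    ⟨le_rfl, hε1.le⟩ ⟨hε1.le, le_rfl⟩ hε1.le
  rwa [vol_one] at this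

variable [n.AtLeastTwo]

theorem existsUnique_isGlobalMinimizer (hκ : 0 < κ) (hε : 0 < ε) (hε1 : ε < 1) (hlam : 0 < lam)
    (H : IsBulkEnergy h) (h11 : stress n κ h 1 1 = 0) :
    ∃ r : ℝ → ℝ, IsGlobalMinimizer n κ h ε lam r ∧
      ∀ s : ℝ → ℝ, IsGlobalMinimizer n κ h ε lam s → EqOn s r (Icc ε 1) := by
  have hn : 2 ≤ n := two_le_of_atLeastTwo
  obtain ⟨d, hd⟩ := exists_isRedMin_univ hn hκ hε hε1 H (pow_pos hlam n)
  have hr := hd.isGlobalMinimizer hκ hε hε1 hlam H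
  refine ⟨_, hr, fun s hs R hR => ?_⟩
  have h1 := (hs.isRedMin hκ hε hε1 hlam H).ae_eq hn hκ hε hε1 H h11
    (hr.isRedMin hκ hε hε1 hlam H)
  have h2 := vol_congr (n := n) (L := lam ^ n) h1 hR
  rw [vol_jac hε hε1 hs.1 hR, vol_jac hε hε1 hr.1 hR] at h2
  exact (pow_left_inj₀ (nonneg_of_admissible hε1 hs.1 hR) (nonneg_of_admissible hε1 hr.1 hR)
    (by omega)).1 h2

end Uniqueness

/-! ### Minimisers have an open cavity -/

section OpenCavity

variable {n : ℕ} {κ ε L lam : ℝ} {h : ℝ → ℝ} {d e : ℝ → ℝ}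

/-- The density is at least a linear function of `d` plus a quadratic remainder in the ratio
`p = d R^n / u = R r'/r`: `h` lies above its tangent at `1`, and the `n`-th power above its tangent
at `p = 1`, which contributes no term in `u`, since `(u / R^n) p = d`. -/
theorem dens_ge (hn : 2 ≤ n) (hκ : 0 < κ) (H : IsBulkEnergy h) {R u d : ℝ} (hR : 0 < R)
    (hu : 0 < u) (hd : 0 < d) :
    R ^ (n - 1) * (κ * d + h 1 + deriv h 1 * (d - 1)) +
      κ * (n - 1) / n * (u / R * (d * (R ^ n / u) - 1) ^ 2) ≤ dens n κ h R u d := by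
  have hn0 : (0 : ℝ) < n := by exact_mod_cast (by omega : 0 < n)
  have hRn := pow_pos hR n
  have hp : 0 < d * (R ^ n / u) := by positivity
  have h1 := bernoulli_quadratic hn hp.le
  have h2 := H.tangent_le hd one_pos
  have h3 : d ^ n * (R ^ n / u) ^ (n - 1) = (d * (R ^ n / u)) ^ n * (u / R ^ n) := by
    obtain ⟨m, rfl⟩ : ∃ m, n = m + 1 := ⟨n - 1, by omega⟩
    rw [Nat.add_sub_cancel, mul_pow, pow_succ (R ^ (m + 1) / u) m]
    field_simp
  have h4 : R ^ n = R ^ (n - 1) * R := by rw [← pow_succ]; congr 1; omega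
  have h5 : d * (R ^ n / u) * (u / R ^ n) = d := by field_simp
  have h6 : R ^ (n - 1) * (u / R ^ n) = u / R := by
    rw [h4]
    have := pow_pos hR (n - 1)
    field_simp
  unfold dens
  rw [h3]
  set P := d * (R ^ n / u)
  set y := u / R ^ n
  have hy : 0 < y := by positivity
  have h7 := mul_le_mul_of_nonneg_left h1 (mul_pos (div_pos hκ hn0) hy).le
  have h8 : κ * d + κ * (n - 1) / n * (y * (P - 1) ^ 2) =
      κ / n * y * (n * P + (n - 1) * (P - 1) ^ 2) := by
    rw [← h5]
    field_simp
  rw [← h6]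
  have h9 : R ^ (n - 1) * (κ * d + κ * (n - 1) / n * (y * (P - 1) ^ 2) +
      (h 1 + deriv h 1 * (d - 1))) ≤
      R ^ (n - 1) * (κ / n * (P ^ n * y + (n - 1) * y) + h d) := by
    refine mul_le_mul_of_nonneg_left ?_ (pow_pos hR _).le
    rw [h8]
    linarith
  linarith

/-- The left-hand side is `n (k u)'` if `u' = n R^{n-1} d`, for the function
`k(R) = 4 x / (n (2 R^n - x))`, which solves the Riccati equation `-R k' = n k + n² k² / 4`. By this
equation the difference of the two sides is a perfect square. -/
theorem riccati_le (hn : 2 ≤ n) {R u d : ℝ} (hR : 0 < R) (hu : 0 < u) {x : ℝ}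
    (hD : 0 < 2 * R ^ n - x) :
    4 * x / (2 * R ^ n - x) * (n * R ^ (n - 1) * d) -
      4 * x * (2 * (n * R ^ (n - 1))) / (2 * R ^ n - x) ^ 2 * u ≤
      n * (u / R * (d * (R ^ n / u) - 1) ^ 2) := by
  have hn0 : (0 : ℝ) < n := by exact_mod_cast (by omega : 0 < n)
  have h4 : R ^ n = R ^ (n - 1) * R := by rw [← pow_succ]; congr 1; omega
  obtain ⟨D, rfl⟩ : ∃ D, x = 2 * R ^ n - D := ⟨2 * R ^ n - x, by ring⟩
  rw [sub_sub_cancel] at hD ⊢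
  set x := 2 * R ^ n - D with hx
  have key : n * (u / R * (d * (R ^ n / u) - 1) ^ 2) -
      (4 * x / D * (n * R ^ (n - 1) * d) - 4 * x * (2 * (n * R ^ (n - 1))) / D ^ 2 * u) =
      n * (u / R * (d * (R ^ n / u) - 1 - 2 * x / D) ^ 2) := by
    rw [hx, h4]
    field_simp
    ring
  have : 0 ≤ n * (u / R * (d * (R ^ n / u) - 1 - 2 * x / D) ^ 2) := by positivity
  linarith

/-- A lower bound for the energy stored up to the radius `b` by a deformation with a closed cavity.
By `dens_ge` and `riccati_le` with `x = ε^n`, the density is bounded below by an exact derivative,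
whose primitive involves `u` only at `b`, since `u(ε) = 0`. -/
theorem setIntegral_dens_ge (hn : 2 ≤ n) (hκ : 0 < κ) (hε : 0 < ε) (hε1 : ε < 1)
    (H : IsBulkEnergy h) (hd : FiniteEnergy n κ h ε L d) (h0 : vol n L d ε = 0)
    (h1 : κ + deriv h 1 = -(κ * (n - 1) / n)) {b : ℝ} (hb : b ∈ Ioc ε 1) :
    (h 1 - deriv h 1) / n * (b ^ n - ε ^ n) +
      κ * (n - 1) / n ^ 2 * ((4 * ε ^ n / (2 * b ^ n - ε ^ n) - 1) * vol n L d b) ≤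
      ∫ R in Ioo ε b, dens n κ h R (vol n L d R) (d R) := by
  have hn0 : (0 : ℝ) < n := by exact_mod_cast (by omega : 0 < n)
  have hn1 : (0 : ℝ) < n - 1 := by
    have : (2 : ℝ) ≤ n := by exact_mod_cast hn
    linarith
  set x := ε ^ n with hx
  have hD : ∀ R, ε ≤ R → 0 < 2 * R ^ n - x := fun R hR => by
    have : x ≤ R ^ n := pow_le_pow_left₀ hε.le hR n
    have : 0 < x := pow_pos hε n
    linarith
  have hu := isPrim_vol (n := n) (L := L) hd.integrableOn
  have hk : IsPrim ε 1 (fun R => 4 * x / (2 * R ^ n - x))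
      (fun R => -(4 * x * (2 * (n * R ^ (n - 1))) / (2 * R ^ n - x) ^ 2)) := by
    refine isPrim_of_hasDerivAt (fun R hR => ?_) ?_
    · have e1 := ((hasDerivAt_pow n R).const_mul 2).sub_const x
      refine ((hasDerivAt_const R (4 * x)).div e1 (hD R hR.1).ne').congr_deriv ?_
      rw [zero_mul, zero_sub, neg_div]
    · refine (ContinuousOn.div (by fun_prop) (by fun_prop) fun R hR => ?_).neg
      exact (pow_pos (hD R hR.1) 2).ne'
  have hRn : IsPrim ε 1 (fun R : ℝ => R ^ n) (fun R => n * R ^ (n - 1)) :=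
    isPrim_of_hasDerivAt (fun R _ => hasDerivAt_pow n R) (by fun_prop)
  have hG := ((hu.const_mul ((κ + deriv h 1) / n)).add (hRn.const_mul ((h 1 - deriv h 1) / n))
    hε1.le).add ((hk.mul hu hε1.le).const_mul (κ * (n - 1) / n ^ 2)) hε1.le
  have hGb := hG.mono hε1.le (x := ε) (y := b) ⟨le_rfl, hε1.le⟩ ⟨hb.1.le, hb.2⟩
  have hint := hGb.setIntegral_eq hb.1.le
  have hsub : Ioo ε b ⊆ Ioo ε 1 := Ioo_subset_Ioo le_rfl hb.2
  have hle := integral_mono_ae (μ := volume.restrict (Ioo ε b)) hGb.integrableOn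
    (hd.energy.mono_set hsub) (by
      filter_upwards [ae_restrict_of_ae_restrict_of_subset hsub hd.pos,
        ae_restrict_mem measurableSet_Ioo] with R p hR
      have hR0 := hε.trans hR.1
      have hup := vol_pos hn hε hε1 hd.integrableOn hd.pos h0.ge ⟨hR.1, hR.2.le.trans hb.2⟩
      have e1 := dens_ge hn hκ H hR0 hup p
      have e2 := mul_le_mul_of_nonneg_left (riccati_le (d := d R) hn hR0 hup (hD R hR.1.le))
        (show 0 ≤ κ * (n - 1) / n ^ 2 by positivity)
      refine le_trans ?_ e1
      have e3 : κ * (n - 1) / n ^ 2 *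
          (n * (vol n L d R / R * (d R * (R ^ n / vol n L d R) - 1) ^ 2))
          = κ * (n - 1) / n * (vol n L d R / R * (d R * (R ^ n / vol n L d R) - 1) ^ 2) := by
        field_simp
      rw [e3] at e2
      have e4 : (κ + deriv h 1) / n * (n * R ^ (n - 1) * d R) +
          (h 1 - deriv h 1) / n * (n * R ^ (n - 1)) =
          R ^ (n - 1) * (κ * d R + h 1 + deriv h 1 * (d R - 1)) := by
        field_simp
        ring
      rw [e4]
      linarith)
  rw [hint, h0, h1] at hle
  refine le_trans (le_of_eq ?_) hle
  field_simp
  ring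

theorem setIntegral_Ioo_add {f : ℝ → ℝ} (hf : IntegrableOn f (Ioo ε 1)) {b : ℝ} (hb : b ∈ Ioc ε 1) :
    ∫ R in Ioo ε 1, f R = (∫ R in Ioo ε b, f R) + ∫ R in Ioo b 1, f R := by
  have hε1 : ε ≤ 1 := hb.1.le.trans hb.2
  have hi := (intervalIntegrable_iff_integrableOn_Ioo_of_le hε1).2 hf
  have hbI : b ∈ uIcc ε 1 := by rw [uIcc_of_le hε1]; exact ⟨hb.1.le, hb.2⟩
  have h1 := intervalIntegral.integral_add_adjacent_intervals
    (hi.mono_set (uIcc_subset_uIcc_left hbI)) (hi.mono_set (uIcc_subset_uIcc_right hbI))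
  rw [intervalIntegral.integral_of_le hb.1.le, intervalIntegral.integral_of_le hb.2,
    intervalIntegral.integral_of_le hε1] at h1
  simpa only [integral_Ioc_eq_integral_Ioo] using h1.symm

theorem dens_one {R : ℝ} (hn : 2 ≤ n) (hR : 0 < R) {c : ℝ} (hc : 0 < c) :
    dens n κ h R (c * R ^ n) c = R ^ (n - 1) * (κ * c + h c) := by
  have hn0 : (0 : ℝ) < n := by exact_mod_cast (by omega : 0 < n)
  have hRn := pow_pos hR n
  unfold dens
  have h1 : R ^ n / (c * R ^ n) = c⁻¹ := by field_simp
  have h2 : c ^ n * c⁻¹ ^ (n - 1) = c := by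
    obtain ⟨m, rfl⟩ : ∃ m, n = m + 1 := ⟨n - 1, by omega⟩
    rw [Nat.add_sub_cancel, pow_succ, inv_pow]
    field_simp
  have h3 : c * R ^ n / R ^ n = c := by field_simp
  rw [h1, h2, h3]
  field_simp
  ring

theorem setIntegral_pow (hn : 2 ≤ n) {a b : ℝ} (hab : a ≤ b) (c : ℝ) :
    ∫ R in Ioo a b, R ^ (n - 1) * c = c * (b ^ n - a ^ n) / n := by
  have hn0 : (0 : ℝ) < n := by exact_mod_cast (by omega : 0 < n)
  have h1 : IsPrim a b (fun R => c / n * R ^ n) (fun R => R ^ (n - 1) * c) := by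
    refine isPrim_of_hasDerivAt (fun R _ => ?_) (by fun_prop)
    refine ((hasDerivAt_pow n R).const_mul (c / n)).congr_deriv ?_
    field_simp
  rw [h1.setIntegral_eq hab]
  ring

/-- The competitor that is undeformed up to the radius `b`. -/
theorem exists_undeformed_core (hn : 2 ≤ n) (hε : 0 < ε) (hε1 : ε < 1)
    (hd : FiniteEnergy n κ h ε L d) {b : ℝ} (hb : b ∈ Ioc ε 1) (hub : vol n L d b = b ^ n) :
    ∃ e, FiniteEnergy n κ h ε L e ∧ vol n L e ε = ε ^ n ∧ bulkEnergy n κ h ε L e =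
      (κ + h 1) * (b ^ n - ε ^ n) / n + ∫ R in Ioo b 1, dens n κ h R (vol n L d R) (d R) := by
  classical
  set e : ℝ → ℝ := (Iio b).piecewise (fun _ => 1) d with he
  have he1 : ∀ R, R < b → e R = 1 := fun R hR => piecewise_eq_of_mem _ _ _ hR
  have he2 : ∀ R, b ≤ R → e R = d R := fun R hR => piecewise_eq_of_notMem _ _ _ (not_lt.2 hR)
  have hei : IntegrableOn e (Ioo ε 1) :=
    Integrable.piecewise measurableSet_Iio (integrable_const _).integrableOn
      hd.integrableOn.integrableOn
  have hvol2 : ∀ R ∈ Icc b 1, vol n L e R = vol n L d R := by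
    intro R hR
    unfold vol
    congr 1
    refine intervalIntegral.integral_congr fun S hS => ?_
    rw [uIcc_of_le hR.2] at hS
    rw [he2 S (hR.1.trans hS.1)]
  have hvol1 : ∀ R ∈ Icc ε b, vol n L e R = 1 * R ^ n := by
    intro R hR
    have hp := isPrim_vol (n := n) (L := L) hei
    have h1 := hp.integral_eq hε1.le (x := R) (y := b) ⟨hR.1, hR.2.trans hb.2⟩ ⟨hb.1.le, hb.2⟩
    have h2 : ∫ S in R..b, n * S ^ (n - 1) * e S = ∫ S in R..b, n * S ^ (n - 1) := by
      rw [intervalIntegral.integral_of_le hR.2, intervalIntegral.integral_of_le hR.2,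
        integral_Ioc_eq_integral_Ioo, integral_Ioc_eq_integral_Ioo]
      refine setIntegral_congr_fun measurableSet_Ioo fun S hS => ?_
      rw [he1 S hS.2, mul_one]
    have h3 : ∫ S in R..b, (n : ℝ) * S ^ (n - 1) = b ^ n - R ^ n :=
      intervalIntegral.integral_eq_sub_of_hasDerivAt (fun S _ => hasDerivAt_pow n S)
        (Continuous.intervalIntegrable (by fun_prop) _ _)
    rw [h2, h3, hvol2 b ⟨le_rfl, hb.2⟩, hub] at h1
    linarith
  have hepos : ∀ᵐ R ∂(volume.restrict (Ioo ε 1)), 0 < e R := by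
    filter_upwards [hd.pos] with R hR
    rcases lt_or_ge R b with h1 | h1
    · rw [he1 R h1]; exact one_pos
    · rwa [he2 R h1]
  have hdens1 : ∀ R ∈ Ioo ε b, dens n κ h R (vol n L e R) (e R) = R ^ (n - 1) * (κ + h 1) := by
    intro R hR
    rw [hvol1 R (Ioo_subset_Icc_self hR), he1 R hR.2, dens_one hn (hε.trans hR.1) one_pos, mul_one]
  have hdens2 : ∀ R ∈ Ico b 1, dens n κ h R (vol n L e R) (e R) =
      dens n κ h R (vol n L d R) (d R) := by
    intro R hR
    rw [hvol2 R ⟨hR.1, hR.2.le⟩, he2 R hR.1]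
  have hen : IntegrableOn (fun R => dens n κ h R (vol n L e R) (e R)) (Ioo ε 1) := by
    have h1 : IntegrableOn (fun R => dens n κ h R (vol n L e R) (e R)) (Ioo ε b) := by
      refine IntegrableOn.congr_fun (f := fun R => R ^ (n - 1) * (κ + h 1)) ?_
        (fun R hR => (hdens1 R hR).symm) measurableSet_Ioo
      exact (Continuous.integrableOn_Icc (by fun_prop)).mono_set Ioo_subset_Icc_self
    have h2 : IntegrableOn (fun R => dens n κ h R (vol n L e R) (e R)) (Ico b 1) :=
      IntegrableOn.congr_fun (f := fun R => dens n κ h R (vol n L d R) (d R))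
        (hd.energy.mono_set fun R hR => ⟨hb.1.trans_le hR.1, hR.2⟩)
        (fun R hR => (hdens2 R hR).symm) measurableSet_Ico
    exact (h1.union h2).mono_set fun R hR => (lt_or_ge R b).imp (fun h => ⟨hR.1, h⟩)
      fun h => ⟨h, hR.2⟩
  have hve : vol n L e ε = ε ^ n := by rw [hvol1 ε ⟨le_rfl, hb.1.le⟩, one_mul]
  refine ⟨e, ⟨hei, hepos, by rw [hve]; positivity, hen⟩, hve, ?_⟩
  rw [bulkEnergy, setIntegral_Ioo_add hen hb, setIntegral_congr_fun measurableSet_Ioo hdens1,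
    setIntegral_pow hn hb.1.le, setIntegral_congr_fun measurableSet_Ioo
      fun R hR => hdens2 R ⟨hR.1.le, hR.2⟩]

theorem bdry_zero : bdry n κ ε 0 = 0 := by simp [bdry]

theorem bdry_self (hε : 0 < ε) : bdry n κ ε (ε ^ n) = 0 := by
  simp [bdry, div_self (pow_pos hε n).ne']

/-- Under boundary extension the cavity is open: a closed cavity loses against an undeformed
core. -/
theorem IsRedMin.vol_pos_of_one_le (hn : 2 ≤ n) (hκ : 0 < κ) (hε : 0 < ε) (hε1 : ε < 1)
    (H : IsBulkEnergy h) (h1 : κ + deriv h 1 = -(κ * (n - 1) / n)) (hL : 1 ≤ L)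
    (hd : IsRedMin n κ h ε L univ d) : 0 < vol n L d ε := by
  have hn0 : (0 : ℝ) < n := by exact_mod_cast (by omega : 0 < n)
  have hn1 : (0 : ℝ) < n - 1 := by
    have : (2 : ℝ) ≤ n := by exact_mod_cast hn
    linarith
  have hfe := hd.finiteEnergy
  refine lt_of_le_of_ne hfe.bdry_nonneg fun h0 => ?_
  have hεn := pow_pos hε n
  -- `u(ε) = 0 < ε^n` and `u(1) = L ≥ 1`
  obtain ⟨b, hb, hub⟩ : ∃ b ∈ Icc ε 1, vol n L d b = b ^ n :=
    isPreconnected_Icc.intermediate_value₂ (left_mem_Icc.2 hε1.le) (right_mem_Icc.2 hε1.le)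
      (continuousOn_vol hε1 hfe.integrableOn) (by fun_prop) (by rw [← h0]; exact hεn.le)
      (by rw [vol_one, one_pow]; exact hL)
  have hb' : b ∈ Ioc ε 1 := by
    refine ⟨lt_of_le_of_ne hb.1 ?_, hb.2⟩
    rintro rfl
    rw [hub] at h0
    exact hεn.ne h0
  obtain ⟨e, he, hve, hbe⟩ := exists_undeformed_core hn hε hε1 hfe hb' hub
  have h2 := setIntegral_dens_ge hn hκ hε hε1 H hfe h0.symm h1 hb'
  have h3 := hd.le e he (mem_univ _)
  rw [redEnergy, redEnergy, hve, ← h0, bdry_zero, bdry_self hε, hbe, bulkEnergy,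
    setIntegral_Ioo_add hfe.energy hb'] at h3
  rw [hub] at h2
  have hεb : ε ^ n ≤ b ^ n := pow_le_pow_left₀ hε.le hb.1 n
  have hD : 0 < 2 * b ^ n - ε ^ n := by linarith
  have h4 : 2 * ε ^ n - b ^ n ≤ (4 * ε ^ n / (2 * b ^ n - ε ^ n) - 1) * b ^ n := by
    have : 2 * ε ^ n ≤ 4 * ε ^ n / (2 * b ^ n - ε ^ n) * b ^ n := by
      rw [div_mul_eq_mul_div, le_div_iff₀ hD]
      nlinarith
    linarith
  have hc : 0 < κ * (n - 1) / n ^ 2 := by positivity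
  have h5 := mul_le_mul_of_nonneg_left h4 hc.le
  have h6 : (κ + h 1) * (b ^ n - ε ^ n) / n = (h 1 - deriv h 1) / n * (b ^ n - ε ^ n) -
      κ * (n - 1) / n ^ 2 * (b ^ n - ε ^ n) := by
    have : h 1 = h 1 - deriv h 1 - κ + -(κ * (n - 1) / n) := by rw [← h1]; ring
    field_simp at this h1 ⊢
    linear_combination (b ^ n - ε ^ n) * h1
  have h7 := mul_pos hc hεn
  nlinarith

/-- Under slight boundary compression the cavity is open: a closed cavity loses against the
homogeneous deformation. -/
theorem eventually_vol_pos (hn : 2 ≤ n) (hκ : 0 < κ) (hε : 0 < ε) (hε1 : ε < 1)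
    (H : IsBulkEnergy h) (h1 : κ + deriv h 1 = -(κ * (n - 1) / n)) :
    ∀ᶠ L in 𝓝 (1 : ℝ), ∀ d, IsRedMin n κ h ε L univ d → 0 < vol n L d ε := by
  have hn0 : (0 : ℝ) < n := by exact_mod_cast (by omega : 0 < n)
  have hn1 : (0 : ℝ) < n - 1 := by
    have : (2 : ℝ) ≤ n := by exact_mod_cast hn
    linarith
  have hεn := pow_pos hε n
  have hεn1 : ε ^ n < 1 := pow_lt_one₀ hε.le hε1 (by omega)
  -- the lower bound of `setIntegral_dens_ge` with `b = 1`, minus the reduced energy of the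
  -- homogeneous deformation `d = L`
  let f : ℝ → ℝ := fun L => (h 1 - deriv h 1) / n * (1 ^ n - ε ^ n) +
      κ * (n - 1) / n ^ 2 * ((4 * ε ^ n / (2 * 1 ^ n - ε ^ n) - 1) * L) -
      ((κ * L + h L) * (1 ^ n - ε ^ n) / n - bdry n κ ε (L * ε ^ n))
  have hfc : ContinuousAt f 1 := by
    have e1 : ContinuousAt h 1 := (H.hasDerivAt one_pos).continuousAt
    have e2 : ContinuousAt (fun L => bdry n κ ε (L * ε ^ n)) 1 :=
      (continuous_bdry.comp (continuous_mul_const _)).continuousAt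
    simp only [f]
    fun_prop
  have hf1 : 0 < f 1 := by
    have hD : 0 < 2 - ε ^ n := by linarith
    have h4 : 2 * ε ^ n < 4 * ε ^ n / (2 - ε ^ n) := by
      rw [lt_div_iff₀ hD]
      nlinarith
    have h6 : (κ + h 1) * (1 - ε ^ n) / n = (h 1 - deriv h 1) / n * (1 - ε ^ n) -
        κ * (n - 1) / n ^ 2 * (1 - ε ^ n) := by
      field_simp at h1 ⊢
      linear_combination (1 - ε ^ n) * h1
    have hc : 0 < κ * (n - 1) / n ^ 2 := by positivity
    have h5 := mul_lt_mul_of_pos_left h4 hc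
    have h7 := mul_pos hc hεn
    simp only [f, one_pow, mul_one, one_mul, bdry_self hε, h6]
    nlinarith
  filter_upwards [hfc.eventually (lt_mem_nhds hf1), lt_mem_nhds one_pos] with L hL hL0 d hd
  have hfe := hd.finiteEnergy
  refine lt_of_le_of_ne hfe.bdry_nonneg fun h0 => ?_
  obtain ⟨hec, hvc⟩ := finiteEnergy_const (κ := κ) (h := h) hn hε hε1 hL0 (L := L)
    (by nlinarith)
  have hvc' : ∀ R, vol n L (fun _ => L) R = L * R ^ n := fun R => by rw [hvc]; ring
  have h2 := setIntegral_dens_ge hn hκ hε hε1 H hfe h0.symm h1 ⟨hε1, le_rfl⟩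
  have h3 := hd.le _ hec (mem_univ _)
  have h5 : bulkEnergy n κ h ε L (fun _ => L) = (κ * L + h L) * (1 ^ n - ε ^ n) / n := by
    rw [bulkEnergy, ← setIntegral_pow hn hε1.le]
    refine setIntegral_congr_fun measurableSet_Ioo fun R hR => ?_
    rw [hvc', dens_one hn (hε.trans hR.1) hL0]
  rw [redEnergy, redEnergy, hvc', ← h0, bdry_zero, h5, bulkEnergy] at h3
  rw [vol_one] at h2
  simp only [f] at hL
  linarith

end OpenCavity

/-! ### The Euler-Lagrange equation for the deformation -/

section Deformation

variable {n : ℕ} [n.AtLeastTwo] {κ ε lam : ℝ} {h : ℝ → ℝ}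

theorem stretches_zero (q v : ℝ) : stretches n q v 0 = q := by simp [stretches]

theorem fin_one_ne_zero : (1 : Fin n) ≠ 0 := by
  have hn : 2 ≤ n := two_le_of_atLeastTwo
  intro h
  have := congrArg Fin.val h
  rw [Fin.val_one', Nat.mod_eq_of_lt (by omega)] at this
  simp at this

theorem stretches_one (q v : ℝ) : stretches n q v 1 = v := by
  simp [stretches, Function.update_of_ne fin_one_ne_zero]

theorem stretches_self (l : ℝ) : stretches n l l = fun _ => l := by
  simp [stretches]

theorem partialDeriv_modPhi_zero (H : IsBulkEnergy h) {p v : ℝ} (hp : 0 < p) (hv : 0 < v) :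
    partialDeriv (modPhi n κ h) 0 (stretches n (p * v) v) = v ^ (n - 1) * stress n κ h p v := by
  have hn : 2 ≤ n := two_le_of_atLeastTwo
  have hn0 : (0 : ℝ) < n := by exact_mod_cast (by omega : 0 < n)
  have h1 : (fun t => modPhi n κ h (Function.update (stretches n (p * v) v) 0 t)) = fun t =>
      κ / n * t ^ n + h (t * v ^ (n - 1)) +
        κ * (t * v ^ (n - 1)) * (((n : ℝ) - 1) / n + (n - 1) * Real.log v) := by
    ext t
    rw [← modPhi_stretches]
    simp [stretches]
  have hpv : p * v * v ^ (n - 1) = p * v ^ n := by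
    rw [mul_assoc, ← pow_succ']; congr 2; omega
  have e0 : HasDerivAt (fun t : ℝ => t * v ^ (n - 1)) (v ^ (n - 1)) (p * v) := by
    simpa using (hasDerivAt_id (p * v)).mul_const (v ^ (n - 1))
  have e1 : HasDerivAt h (deriv h (p * v ^ n)) (p * v * v ^ (n - 1)) := by
    rw [hpv]; exact H.hasDerivAt (by positivity)
  have e2 := (((hasDerivAt_pow n (p * v)).const_mul (κ / n)).add (e1.comp (p * v) e0)).add
    ((e0.const_mul κ).mul_const (((n : ℝ) - 1) / n + (n - 1) * Real.log v))
  rw [partialDeriv, stretches_zero, h1]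
  refine e2.deriv.trans ?_
  unfold stress
  rw [mul_pow]
  field_simp
  ring

theorem partialDeriv_modPhi_one (H : IsBulkEnergy h) {p v : ℝ} (hp : 0 < p) (hv : 0 < v) :
    partialDeriv (modPhi n κ h) 1 (stretches n (p * v) v) =
      p * v ^ (n - 1) * (stress n κ h p v + κ - κ * p ^ (n - 1)) := by
  have hn : 2 ≤ n := two_le_of_atLeastTwo
  have hn0 : (0 : ℝ) < n := by exact_mod_cast (by omega : 0 < n)
  have hprod : ∀ t, ∏ i, Function.update (stretches n (p * v) v) 1 t i =
      t * (p * v ^ (n - 1)) := by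
    intro t
    rw [Finset.prod_update_of_mem (Finset.mem_univ _)]
    unfold stretches
    rw [Finset.prod_update_of_mem (by simp [fin_one_ne_zero.symm]), Finset.prod_const]
    have : ((Finset.univ \ {1} : Finset (Fin n)) \ {0}).card = n - 2 := by
      rw [Finset.card_sdiff_of_subset (by simp [fin_one_ne_zero.symm]),
        Finset.card_sdiff_of_subset (by simp)]
      simp
      omega
    rw [this, show n - 1 = n - 2 + 1 by omega, pow_succ]
    ring
  have herase : ∀ t, ∏ i ∈ Finset.univ.erase (0 : Fin n),
      Function.update (stretches n (p * v) v) 1 t i = t * v ^ (n - 2) := by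
    intro t
    rw [Finset.prod_update_of_mem (by simp; omega)]
    unfold stretches
    rw [Finset.prod_update_of_notMem (by simp), Finset.prod_const]
    have : (Finset.univ.erase (0 : Fin n) \ {1}).card = n - 2 := by
      rw [Finset.card_sdiff_of_subset (by simp; omega),
        Finset.card_erase_of_mem (by simp)]
      simp
      omega
    rw [this]
  have h1 : (fun t => modPhi n κ h (Function.update (stretches n (p * v) v) 1 t)) = fun t =>
      κ / n * (p * v) ^ n + h (t * (p * v ^ (n - 1))) +
        κ * (t * (p * v ^ (n - 1))) * (((n : ℝ) - 1) / n + Real.log (t * v ^ (n - 2))) := by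
    ext t
    rw [modPhi, hprod, herase, Function.update_of_ne fin_one_ne_zero.symm, stretches_zero]
  have hpv : v * (p * v ^ (n - 1)) = p * v ^ n := by
    rw [mul_left_comm, ← pow_succ']; congr 2; omega
  have hv2 : v * v ^ (n - 2) = v ^ (n - 1) := by
    rw [← pow_succ']; congr 1; omega
  have e0 : ∀ c : ℝ, HasDerivAt (fun t : ℝ => t * c) c v := fun c => by
    simpa using (hasDerivAt_id v).mul_const c
  have e1 : HasDerivAt h (deriv h (p * v ^ n)) (v * (p * v ^ (n - 1))) := by
    rw [hpv]; exact H.hasDerivAt (by positivity)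
  have e2 := (e0 (v ^ (n - 2))).log (by positivity)
  have e3 := ((e1.comp v (e0 _)).const_add (κ / n * (p * v) ^ n)).add
    (((e0 (p * v ^ (n - 1))).const_mul κ).mul (e2.const_add (((n : ℝ) - 1) / n)))
  have hcast : ((n - 1 : ℕ) : ℝ) = (n : ℝ) - 1 := by
    rw [Nat.cast_sub (by omega)]; simp
  rw [partialDeriv, stretches_one, h1]
  refine e3.deriv.trans ?_
  unfold stress
  rw [hv2, Real.log_pow, hcast, ← hv2]
  field_simp
  ring

theorem stress_one_one (H : IsBulkEnergy h)
    (h1 : partialDeriv (modPhi n κ h) 0 (fun _ => (1 : ℝ)) = 0) : stress n κ h 1 1 = 0 := by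
  have := partialDeriv_modPhi_zero (n := n) (κ := κ) H (one_pos (α := ℝ)) (one_pos (α := ℝ))
  rw [mul_one, stretches_self, h1, one_pow, one_mul] at this
  exact this.symm

/-- Minimisers with an open cavity are classical solutions. -/
theorem IsGlobalMinimizer.classical (hκ : 0 < κ) (hε : 0 < ε) (hε1 : ε < 1) (hlam : 0 < lam)
    (H : IsBulkEnergy h) {r : ℝ → ℝ} (hr : IsGlobalMinimizer n κ h ε lam r)
    (h0 : 0 < vol n (lam ^ n) (jac n ε r) ε) :
    ContDiffOn ℝ 2 r (Icc ε 1) ∧ SolvesModEL n κ h ε r ∧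
      (∀ R ∈ Icc ε 1, 0 < derivWithin r (Icc ε 1) R) ∧ 0 < r ε ∧ modStress n κ h ε r ε = 0 := by
  have hn : 2 ≤ n := two_le_of_atLeastTwo
  have hεI : ε ∈ Icc ε 1 := ⟨le_rfl, hε1.le⟩
  have hRpos : ∀ R ∈ Icc ε 1, 0 < R := fun R hR => hε.trans_le hR.1
  obtain ⟨p, hs', hrd', hT'⟩ := ((hr.isRedMin hκ hε hε1 hlam H).isCritical hn hκ hε hε1 H
    h0).isRadialSolution hn hκ hε hε1 H
  have heq : ∀ R ∈ Icc ε 1, defOfJac n (lam ^ n) (jac n ε r) R = r R := fun R hR => by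
    rw [defOfJac, vol_jac hε hε1 hr.1 hR]
    exact Real.pow_rpow_inv_natCast (nonneg_of_admissible hε1 hr.1 hR) (by omega)
  have hrd : ∀ R ∈ Icc ε 1, HasDerivWithinAt r (p R * (r R / R)) (Icc ε 1) R := fun R hR => by
    have := (hrd' R hR).congr (fun S hS => (heq S hS).symm) (heq R hR).symm
    rwa [heq R hR] at this
  have hppos := hs'.p_pos
  have hvpos : ∀ R ∈ Icc ε 1, 0 < r R / R := fun R hR => by
    rw [← heq R hR]; exact hs'.v_pos R hR
  have hrpos : ∀ R ∈ Icc ε 1, 0 < r R := fun R hR => by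
    have := mul_pos (hvpos R hR) (hRpos R hR)
    rwa [div_mul_cancel₀ _ (hRpos R hR).ne'] at this
  have hdw : ∀ R ∈ Icc ε 1, derivWithin r (Icc ε 1) R = p R * (r R / R) := fun R hR =>
    (hrd R hR).derivWithin (uniqueDiffOn_Icc hε1 R hR)
  have hstress : ∀ R ∈ Icc ε 1, HasDerivWithinAt (fun S => stress n κ h (p S) (r S / S))
      (κ * (n - 1) * (p R - p R ^ n) / R) (Icc ε 1) R := fun R hR =>
    (hs'.hasDerivWithinAt_stress hε hR).congr (fun S hS => by rw [heq S hS]) (by rw [heq R hR])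
  have hal0 : ∀ R ∈ Icc ε 1, modPhiAlong n κ h ε r 0 R =
      (r R / R) ^ (n - 1) * stress n κ h (p R) (r R / R) := fun R hR => by
    rw [modPhiAlong, hdw R hR, partialDeriv_modPhi_zero H (hppos R hR) (hvpos R hR)]
  have hal1 : ∀ R ∈ Icc ε 1, modPhiAlong n κ h ε r 1 R = p R * (r R / R) ^ (n - 1) *
      (stress n κ h (p R) (r R / R) + κ - κ * p R ^ (n - 1)) := fun R hR => by
    rw [modPhiAlong, hdw R hR, partialDeriv_modPhi_one H (hppos R hR) (hvpos R hR)]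
  have hpc : ContinuousOn p (Icc ε 1) := hs'.p_smooth.continuousOn
  have hinv : ContDiffOn ℝ 1 (fun R : ℝ => R⁻¹) (Icc ε 1) :=
    contDiffOn_id.inv fun R hR => (hRpos R hR).ne'
  have hr1 : ContDiffOn ℝ 1 r (Icc ε 1) := by
    have h1 : ContinuousOn (fun R => p R * (r R / R)) (Icc ε 1) :=
      hpc.mul (hr.1.2.1.div continuousOn_id fun R hR => (hRpos R hR).ne')
    have := contDiffOn_succ_of_hasDerivWithinAt hε1 (k := 0) hrd (by
      rw [Nat.cast_zero, contDiffOn_zero]; exact h1)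
    simpa using this
  refine ⟨?_, fun R hR => ?_, fun R hR => ?_, hrpos ε hεI, ?_⟩
  · have := contDiffOn_succ_of_hasDerivWithinAt hε1 (k := 1) hrd (by
      rw [Nat.cast_one]
      exact hs'.p_smooth.mul (hr1.div contDiffOn_id fun R hR => (hRpos R hR).ne'))
    norm_num at this
    exact this
  · have hRI := Ioo_subset_Icc_self hR
    have hR0 := hRpos R hRI
    have hnhds := Icc_mem_nhds hR.1 hR.2
    have e1 := (((hrd R hRI).pow (n - 1)).mul (hstress R hRI)).hasDerivAt hnhds
    have e2 : (fun S => S ^ (n - 1) * modPhiAlong n κ h ε r 0 S) =ᶠ[𝓝 R]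
        fun S => r S ^ (n - 1) * stress n κ h (p S) (r S / S) := by
      filter_upwards [hnhds] with S hS
      have := hRpos S hS
      rw [hal0 S hS, div_pow]
      field_simp
    refine (e1.congr_of_eventuallyEq e2).congr_deriv ?_
    rw [hal1 R hRI]
    have hr0 := hrpos R hRI
    generalize stress n κ h (p R) (r R / R) = T
    obtain ⟨m, hm⟩ : ∃ m, n = m + 2 := ⟨n - 2, by omega⟩
    have hc : ((n - 1 : ℕ) : ℝ) = m + 1 := by
      rw [show n - 1 = m + 1 by omega]; push_cast; rfl
    have hc' : (n : ℝ) = m + 2 := by rw [hm]; push_cast; rfl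
    simp only [Pi.pow_apply]
    rw [hc, hc', show n - 1 - 1 = m by omega, show n - 1 = m + 1 by omega,
      show n - 2 = m by omega, hm, div_pow]
    field_simp
    ring
  · rw [hdw R hR]
    exact mul_pos (hppos R hR) (hvpos R hR)
  · rw [heq ε hεI] at hT'
    rw [modStress, hal0 ε hεI, hT', mul_zero, mul_zero]

end Deformation

end PuncturedBall

theorem mainTheorem8 (n : ℕ) [n.AtLeastTwo] (κ : ℝ) (hκ : 0 < κ) (h : ℝ → ℝ)
    (h_smooth : ContDiffOn ℝ 2 h (Ioi 0))
    (h_nonneg : ∀ d : ℝ, 0 < d → 0 ≤ h d)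
    (h_convex : ∀ d : ℝ, 0 < d → 0 < deriv (deriv h) d)
    (h_zero : Tendsto h (𝓝[>] 0) atTop)
    (h_superlinear : Tendsto (fun d => h d / d) atTop atTop)
    (h_deriv_zero : Tendsto (deriv h) (𝓝[>] 0) atBot)
    (h_deriv_top : Tendsto (deriv h) atTop atTop)
    (h_one : ∀ l : ℝ, 0 < l →
      (PuncturedBall.partialDeriv (PuncturedBall.modPhi n κ h) 0 (fun _ => l) = 0 ↔ l = 1))
    (ε : ℝ) (hε : ε ∈ Ioo (0 : ℝ) 1) :
    (∀ lam : ℝ, 0 < lam →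
      ∃ r : ℝ → ℝ, PuncturedBall.IsGlobalMinimizer n κ h ε lam r ∧
        ∀ s : ℝ → ℝ, PuncturedBall.IsGlobalMinimizer n κ h ε lam s → EqOn s r (Icc ε 1)) ∧
    ∃ δ : ℝ, 0 < δ ∧ ∀ lam : ℝ, 0 < lam → 1 - δ < lam →
      ∀ r : ℝ → ℝ, PuncturedBall.IsGlobalMinimizer n κ h ε lam r →
        ContDiffOn ℝ 2 r (Icc ε 1) ∧
        PuncturedBall.SolvesModEL n κ h ε r ∧
        (∀ R ∈ Icc ε 1, 0 < derivWithin r (Icc ε 1) R) ∧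
        0 < r ε ∧
        PuncturedBall.modStress n κ h ε r ε = 0 := by
  have hn : 2 ≤ n := PuncturedBall.two_le_of_atLeastTwo
  have hn0 : (0 : ℝ) < n := by exact_mod_cast (by omega : 0 < n)
  have H : PuncturedBall.IsBulkEnergy h :=
    ⟨h_smooth, h_nonneg, h_convex, h_zero, h_superlinear, h_deriv_zero, h_deriv_top⟩
  have h11 : PuncturedBall.stress n κ h 1 1 = 0 :=
    PuncturedBall.stress_one_one H ((h_one 1 one_pos).2 rfl)
  have h1 : κ + deriv h 1 = -(κ * (n - 1) / n) := by
    simp only [PuncturedBall.stress, one_pow, mul_one, Real.log_one, zero_add] at h11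
    field_simp at h11 ⊢
    linarith
  refine ⟨fun lam hlam => PuncturedBall.existsUnique_isGlobalMinimizer hκ hε.1 hε.2 hlam H h11, ?_⟩
  have hcont : Tendsto (fun lam : ℝ => lam ^ n) (𝓝 1) (𝓝 1) := by
    simpa using (continuous_pow n).tendsto (1 : ℝ)
  obtain ⟨δ, hδ, hδL⟩ := Metric.eventually_nhds_iff.1
    (hcont.eventually (PuncturedBall.eventually_vol_pos hn hκ hε.1 hε.2 H h1))
  refine ⟨δ, hδ, fun lam hlam hlamδ r hr => hr.classical hκ hε.1 hε.2 hlam H ?_⟩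
  have hmin := hr.isRedMin hκ hε.1 hε.2 hlam H
  rcases le_or_gt 1 lam with h2 | h2
  · exact hmin.vol_pos_of_one_le hn hκ hε.1 hε.2 H h1 (one_le_pow₀ h2)
  · refine hδL ?_ _ hmin
    rw [Real.dist_eq, abs_lt]
    constructor <;> linarith
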